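/- Let $\mathfrak g$ be a compact simple real Lie algebra (finite dimensional, with negative definite Killing form), $\mathfrak h\subset\mathfrak g$ a Cartan subalgebra of rank $l$, $R\subset(\mathfrak h_{\mathbb C})^*$ the roots, $R_+$ a system of positive roots (write $\alpha>0$ for $\alpha\in R_+$), $2\varrho=\sum_{\alpha>0}\alpha$. Fix a basis $\{\tau_\alpha\}_{\alpha\in R}\cup\{H_i\}_{i=1}^l$ of $\mathfrak g_{\mathbb C}$ with $H_i\in\mathfrak h_{\mathbb C}$, $[H,\tau_\alpha]=\alpha(H)\tau_\alpha$ for $H\in\mathfrak h_{\mathbb C}$, $[\tau_\alpha,\tau_{-\alpha}]=-H_\alpha$ with $\alpha(H_\alpha)=2$, $[\tau_\alpha,\tau_\beta]=N_{\alpha\beta}\tau_{\alpha+\beta}$ for $\alpha+\beta\ne0$ (with $N_{\alpha\beta}=0$ if $\alpha+\beta\notin R$), $N_{-\alpha,-\beta}=N_{\alpha\beta}$, and $\overline{\tau_\alpha}=\tau_{-\alpha}$ for the complex conjugation defined by $\mathfrak g$. Let $\{\theta^\alpha,\theta^i\}$ be the dual basis. Write $H_\alpha=\sum_iH_\alpha^iH_i$.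 Let $V$ be a complex inner product space with a representation of $\mathfrak g$ by anti-hermitian operators $\rho(x)$, extended complex linearly to $\mathfrak g_{\mathbb C}$. Let $\chi\in(\mathfrak g_{\mathbb C})^*$ vanish on all $\tau_\alpha$ and satisfy $\langle\chi,H_\alpha\rangle\in\mathbb R_{>0}$ for all $\alpha>0$. Put $\mathcal L_x=\rho(x)-\langle\chi,x\rangle$, $\mathcal L_\alpha=\mathcal L_{\tau_\alpha}$, $\mathcal L_i=\mathcal L_{H_i}$ and $r_\alpha=\langle\chi+2\varrho,H_\alpha\rangle$ for $\alpha>0$. On $\mathcal C=\Lambda(\mathfrak g_{\mathbb C})^*$ let $c^\alpha=\theta^{-\alpha}\wedge\cdot$, $c^i=\theta^i\wedge\cdot$, and let $b_\alpha$, $b_i$ be the interior products with $\tau_\alpha$, $H_i$. Let $\omega=\theta^{-\alpha_1}\wedge\dots\wedge\theta^{-\alpha_m}$ (product over all positive roots) and $\upsilon=c^1\cdots c^l$. Define $$L_\alpha=-\sum_{\beta\in R,\ \alpha+\beta\in R}N_{\alpha\beta}\,c^{-\beta}b_{\alpha+\beta}+\sum_iH^i_\alpha\,c^\alpha b_i+\sum_i\alpha(H_i)\,c^ib_\alpha\quad(\alpha\in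 R),$$ $$L_H=-\sum_{\beta>0}\beta(H)\,(c^{-\beta}b_\beta+b_{-\beta}c^\beta)\quad(H\in\mathfrak h_{\mathbb C}),$$ $$d=\tfrac12\sum_{\alpha>0}\big(c^{-\alpha}L_\alpha+L_{-\alpha}c^\alpha\big)+\tfrac12\sum_ic^iL_{H_i}.$$ On $\mathcal C(V)=\mathcal C\otimes V$ let $$D=\sum_{\alpha\in R}c^{-\alpha}\otimes\mathcal L_\alpha+\sum_ic^i\otimes\mathcal L_i+d\otimes1,\qquad L^{\rm tot}_H=1\otimes\mathcal L_H+L_H\otimes1 .$$ The relative differential space is $$\mathcal C_{\rm rel}(V)=\{\Psi\in\mathcal C(V):\ L_H^{\rm tot}\Psi=0\ (H\in\mathfrak h_{\mathbb C}),\ b_i\Psi=0\ (1\le i\le l)\}.$$ Let $D_{\rm rel}$ be the restriction of $D$ to it and put, on $\mathcal C_{\rm rel}(V)$, $$\overline{\mathcal D}=\sum_{\alpha>0}c^{-\alpha}\mathcal L_\alpha-\tfrac12\sum_{\alpha,\beta>0}N_{\alpha\beta}c^{-\alpha}c^{-\beta}b_{\alpha+\beta}-\sum_{\alpha>0}\ \sum_{\beta>0,\,\beta-\alpha\in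 R_+}N_{\alpha,-\beta}\,c^{-\alpha}c^\beta b_{\alpha-\beta},$$ $$\mathcal D=\sum_{\alpha>0}c^{\alpha}\mathcal L_{-\alpha}-\tfrac12\sum_{\alpha,\beta>0}N_{\alpha\beta}c^{\alpha}c^{\beta}b_{-\alpha-\beta}-\sum_{\alpha>0}\ \sum_{\beta>0,\,\beta-\alpha\in R_+}N_{\alpha,-\beta}\,c^{\alpha}c^{-\beta}b_{\beta-\alpha},$$ $$D^c_{\rm rel}=\mathcal D-\overline{\mathcal D},\quad J^+=\sum_{\alpha>0}r_\alpha c^{-\alpha}c^\alpha,\quad J^-=\sum_{\alpha>0}\tfrac1{r_\alpha}b_{-\alpha}b_\alpha,\quad{\rm gh}_{\rm rel}=\sum_{\alpha>0}(c^{-\alpha}b_\alpha-b_{-\alpha}c^\alpha).$$ Let $(\cdot,\cdot)$ be the pairing on $\mathcal C(V)$, conjugate linear in the first and linear in the second argument, induced by the inner product of $V$ and the pairing of $\mathcal C$ with $(\omega,\upsilon\omega)=1$ for which the conjugates of $c^\alpha,b_\alpha,c^i,b_i$ are $-c^{-\alpha},-b_{-\alpha},c^i,b_i$. (On $\mathcal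 C$ the first argument is conjugated through its coordinates in the basis of exterior monomials in the $\theta^\alpha,\theta^i$.) Let $\star$ be the linear operation, acting as the identity on the factor $V$, defined on the common kernel of the $b_i$ by $$\star\,b_{-\alpha_1}\cdots b_{-\alpha_k}c^{-\beta_1}\cdots c^{-\beta_s}\omega\otimes\varphi=(-1)^{(l+1)(k+s)+ks}\,\frac{\prod_{j}r_{\alpha_j}}{\prod_{i}r_{\beta_i}}\;b_{-\beta_1}\cdots b_{-\beta_s}c^{-\alpha_1}\cdots c^{-\alpha_k}\omega\otimes\varphi$$ for $\alpha_j,\beta_i>0$, and let $\langle\Psi,\Psi'\rangle=(\star\Psi,\upsilon\Psi')$. Denote by $A^\dagger$ the operator on $\mathcal C_{\rm rel}(V)$ with $\langle A\Psi,\Psi'\rangle=\langle\Psi,A^\dagger\Psi'\rangle$ for all $\Psi,\Psi'\in\mathcal C_{\rm rel}(V)$. Then $D,\mathcal D,\overline{\mathcal D},J^\pm,{\rm gh}_{\rm rel}$ preserve $\mathcal C_{\rm rel}(V)$, $D_{\rm rel}=\overline{\mathcal D}+\mathcal D$, the conjugates $D_{\rm rel}^\dagger,(D^c_{\rm rel})^\dagger,\mathcal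 D^\dagger,\overline{\mathcal D}^\dagger$ exist and are unique, and the Laplace operators $$\Delta=D_{\rm rel}D_{\rm rel}^\dagger+D_{\rm rel}^\dagger D_{\rm rel},\quad\Delta^c=D^c_{\rm rel}(D^c_{\rm rel})^\dagger+(D^c_{\rm rel})^\dagger D^c_{\rm rel},\quad\Box=\mathcal D\mathcal D^\dagger+\mathcal D^\dagger\mathcal D,\quad\overline\Box=\overline{\mathcal D}\,\overline{\mathcal D}^\dagger+\overline{\mathcal D}^\dagger\overline{\mathcal D}$$ on $\mathcal C_{\rm rel}(V)$ satisfy: 1. $\Delta=\Box+\overline\Box=\Delta^c$ and $[J^\pm,\Delta]=0$; 2. $[J^\pm,\Box]=\pm J^\pm$, $[J^\pm,\overline\Box]=\mp J^\pm$, and $[{\rm gh}_{\rm rel},\Box]=0=[{\rm gh}_{\rm rel},\overline\Box]$; 3. $\Box=\overline\Box-{\rm gh}_{\rm rel}$. -/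

import Mathlib

open scoped TensorProduct

namespace AnomalousBRST

/-- The complexification `ℂ ⊗ 𝔤` of a real Lie algebra. -/
def Cx (𝔤 : Type*) [LieRing 𝔤] [LieAlgebra ℝ 𝔤] : Type _ := ℂ ⊗[ℝ] 𝔤

noncomputable section
section Complexification
variable {𝔤 : Type*} [LieRing 𝔤] [LieAlgebra ℝ 𝔤]

instance : LieRing (Cx 𝔤) := inferInstanceAs (LieRing (ℂ ⊗[ℝ] 𝔤))
instance : LieAlgebra ℂ (Cx 𝔤) := inferInstanceAs (LieAlgebra ℂ (ℂ ⊗[ℝ] 𝔤))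
instance [FiniteDimensional ℝ 𝔤] : FiniteDimensional ℂ (Cx 𝔤) :=
  inferInstanceAs (Module.Finite ℂ (ℂ ⊗[ℝ] 𝔤))

/-- The element `z ⊗ x`. -/
def Cx.tmul (z : ℂ) (x : 𝔤) : Cx 𝔤 := z ⊗ₜ[ℝ] x

theorem Cx.lie_tmul (z w : ℂ) (x y : 𝔤) :
    ⁅Cx.tmul z x, Cx.tmul w y⁆ = Cx.tmul (z * w) ⁅x, y⁆ := rfl

theorem Cx.smul_tmul (z w : ℂ) (x : 𝔤) : z • Cx.tmul w x = Cx.tmul (z * w) x := rfl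

/-- Complex conjugation of `ℂ ⊗ 𝔤` with respect to `𝔤`. -/
def Cx.conj : Cx 𝔤 → Cx 𝔤 :=
  fun x => TensorProduct.map Complex.conjAe.toLinearMap (LinearMap.id (R := ℝ) (M := 𝔤)) x

theorem Cx.exists_re_im (x : Cx 𝔤) : ∃ a b : 𝔤, x = Cx.tmul 1 a + Cx.tmul Complex.I b := by
  refine TensorProduct.induction_on (motive := fun x : ℂ ⊗[ℝ] 𝔤 =>
    ∃ a b : 𝔤, x = (1 : ℂ) ⊗ₜ[ℝ] a + Complex.I ⊗ₜ[ℝ] b) x ?_ ?_ ?_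
  · exact ⟨0, 0, by simp⟩
  · intro z x
    refine ⟨z.re • x, z.im • x, ?_⟩
    rw [TensorProduct.tmul_smul, TensorProduct.tmul_smul, TensorProduct.smul_tmul',
      TensorProduct.smul_tmul', ← TensorProduct.add_tmul]
    congr 1
    apply Complex.ext <;> simp
  · rintro x y ⟨a, b, rfl⟩ ⟨a', b', rfl⟩
    exact ⟨a + a', b + b', by simp only [TensorProduct.tmul_add]; abel⟩

/-- The complexification `ℂ ⊗ 𝔥 ⊆ ℂ ⊗ 𝔤` of a subalgebra `𝔥 ⊆ 𝔤`. -/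
def complexify (𝔥 : LieSubalgebra ℝ 𝔤) : LieSubalgebra ℂ (Cx 𝔤) :=
  { (Submodule.span ℂ (Cx.tmul 1 '' (𝔥 : Set 𝔤)) : Submodule ℂ (Cx 𝔤)) with
    lie_mem' := by
      intro x y hx hy
      change x ∈ Submodule.span ℂ (Cx.tmul 1 '' (𝔥 : Set 𝔤)) at hx
      change y ∈ Submodule.span ℂ (Cx.tmul 1 '' (𝔥 : Set 𝔤)) at hy
      change ⁅x, y⁆ ∈ Submodule.span ℂ (Cx.tmul 1 '' (𝔥 : Set 𝔤))
      induction hx, hy using Submodule.span_induction₂ with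
      | mem_mem x y hx hy =>
        obtain ⟨u, hu, rfl⟩ := hx
        obtain ⟨v, hv, rfl⟩ := hy
        rw [Cx.lie_tmul, mul_one]
        exact Submodule.subset_span ⟨_, 𝔥.lie_mem hu hv, rfl⟩
      | zero_left y hy => rw [zero_lie]; exact zero_mem _
      | zero_right x hx => rw [lie_zero]; exact zero_mem _
      | add_left x y z _ _ _ h h' => rw [add_lie]; exact add_mem h h'
      | add_right x y z _ _ _ h h' => rw [lie_add]; exact add_mem h h'
      | smul_left r x y _ _ h => rw [smul_lie]; exact Submodule.smul_mem _ _ h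
      | smul_right r x y _ _ h => rw [lie_smul]; exact Submodule.smul_mem _ _ h }

theorem tmul_mem_complexify (𝔥 : LieSubalgebra ℝ 𝔤) (z : ℂ) {u : 𝔤} (hu : u ∈ 𝔥) :
    Cx.tmul z u ∈ complexify 𝔥 := by
  rw [← mul_one z, ← Cx.smul_tmul]
  exact (complexify 𝔥).smul_mem _ (Submodule.subset_span ⟨u, hu, rfl⟩)

theorem mem_of_mem_complexify (𝔥 : LieSubalgebra ℝ 𝔤) {a b : 𝔤}
    (h : Cx.tmul 1 a + Cx.tmul Complex.I b ∈ complexify 𝔥) : a ∈ 𝔥 ∧ b ∈ 𝔥 := by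
  let q : 𝔤 →ₗ[ℝ] 𝔤 ⧸ 𝔥.toSubmodule := 𝔥.toSubmodule.mkQ
  let Q : Cx 𝔤 →ₗ[ℂ] ℂ ⊗[ℝ] (𝔤 ⧸ 𝔥.toSubmodule) := q.baseChange ℂ
  have key : complexify 𝔥 ≤ (LinearMap.ker Q : Submodule ℂ (Cx 𝔤)) := by
    refine Submodule.span_le.2 ?_
    rintro _ ⟨u, hu, rfl⟩
    have : q u = 0 := (Submodule.Quotient.mk_eq_zero _).2 hu
    change (1 : ℂ) ⊗ₜ[ℝ] q u = 0
    rw [this, TensorProduct.tmul_zero]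
  have h0 : (1 : ℂ) ⊗ₜ[ℝ] q a + Complex.I ⊗ₜ[ℝ] q b = 0 := key h
  have h1 := congrArg (fun z => TensorProduct.equivFinsuppOfBasisLeft
    (N := 𝔤 ⧸ 𝔥.toSubmodule) Complex.basisOneI z 0) h0
  have h2 := congrArg (fun z => TensorProduct.equivFinsuppOfBasisLeft
    (N := 𝔤 ⧸ 𝔥.toSubmodule) Complex.basisOneI z 1) h0
  simp at h1 h2
  exact ⟨(Submodule.Quotient.mk_eq_zero _).1 h1, (Submodule.Quotient.mk_eq_zero _).1 h2⟩

/-- The complexification of a Cartan subalgebra is a Cartan subalgebra. -/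
instance (𝔥 : LieSubalgebra ℝ 𝔤) [𝔥.IsCartanSubalgebra] :
    (complexify 𝔥).IsCartanSubalgebra where
  nilpotent := by
    have : LieRing.IsNilpotent (ℂ ⊗[ℝ] 𝔥) := inferInstance
    have : LieRing.IsNilpotent (Cx 𝔥) := this
    let f : Cx 𝔥 →ₗ[ℂ] Cx 𝔤 := (𝔥.incl : 𝔥 →ₗ[ℝ] 𝔤).baseChange ℂ
    have ft : ∀ z u, f (Cx.tmul z u) = Cx.tmul z (u : 𝔤) := fun z u => rfl
    have hf : ∀ z, f z ∈ complexify 𝔥 := by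
      intro z
      obtain ⟨a, b, rfl⟩ := Cx.exists_re_im z
      rw [map_add, ft, ft]
      exact add_mem (tmul_mem_complexify 𝔥 _ a.2) (tmul_mem_complexify 𝔥 _ b.2)
    have hl : ∀ x y, f ⁅x, y⁆ = ⁅f x, f y⁆ := by
      intro x y
      obtain ⟨a, b, rfl⟩ := Cx.exists_re_im x
      obtain ⟨c, d, rfl⟩ := Cx.exists_re_im y
      simp only [add_lie, lie_add, map_add, Cx.lie_tmul, ft]
      rfl
    let g : Cx 𝔥 →ₗ⁅ℂ⁆ complexify 𝔥 :=
      { toFun := fun z => ⟨f z, hf z⟩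
        map_add' := fun a b => Subtype.ext (map_add f a b)
        map_smul' := fun t a => Subtype.ext (map_smul f t a)
        map_lie' := fun {a b} => Subtype.ext (hl a b) }
    refine Function.Surjective.lieAlgebra_isNilpotent (f := g) ?_
    rintro ⟨x, hx⟩
    obtain ⟨a, b, rfl⟩ := Cx.exists_re_im x
    obtain ⟨ha, hb⟩ := mem_of_mem_complexify 𝔥 hx
    refine ⟨Cx.tmul 1 ⟨a, ha⟩ + Cx.tmul Complex.I ⟨b, hb⟩, Subtype.ext ?_⟩
    change f _ = _
    rw [map_add, ft, ft]
  self_normalizing := by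
    apply le_antisymm _ (LieSubalgebra.le_normalizer _)
    intro x hx
    obtain ⟨a, b, rfl⟩ := Cx.exists_re_im x
    rw [LieSubalgebra.mem_normalizer_iff] at hx
    have h : ∀ y ∈ 𝔥, ⁅a, y⁆ ∈ 𝔥 ∧ ⁅b, y⁆ ∈ 𝔥 := by
      intro y hy
      have h1 := hx (Cx.tmul 1 y) (tmul_mem_complexify 𝔥 _ hy)
      rw [add_lie, Cx.lie_tmul, Cx.lie_tmul, mul_one, mul_one] at h1
      exact mem_of_mem_complexify 𝔥 h1
    have ha : a ∈ 𝔥 := by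
      rw [← LieSubalgebra.IsCartanSubalgebra.self_normalizing (H := 𝔥),
        LieSubalgebra.mem_normalizer_iff]
      exact fun y hy => (h y hy).1
    have hb : b ∈ 𝔥 := by
      rw [← LieSubalgebra.IsCartanSubalgebra.self_normalizing (H := 𝔥),
        LieSubalgebra.mem_normalizer_iff]
      exact fun y hy => (h y hy).2
    exact add_mem (tmul_mem_complexify 𝔥 _ ha) (tmul_mem_complexify 𝔥 _ hb)
end Complexification

section Roots

variable {𝔤 : Type*} [LieRing 𝔤] [LieAlgebra ℝ 𝔤] [FiniteDimensional ℝ 𝔤]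

/-- Linear functionals on `ℂ ⊗ 𝔥`. -/
abbrev Functional (𝔥 : LieSubalgebra ℝ 𝔤) : Type _ := Module.Dual ℂ (complexify 𝔥)

/-- The rank `l = dim 𝔥`. -/
abbrev rank (𝔥 : LieSubalgebra ℝ 𝔤) : ℕ := Module.finrank ℂ (complexify 𝔥)

open Classical in
/-- The root system `R` of `ℂ ⊗ 𝔤` with respect to `ℂ ⊗ 𝔥`, as a set of linear functionals. -/
def roots (𝔥 : LieSubalgebra ℝ 𝔤) [𝔥.IsCartanSubalgebra] : Finset (Functional 𝔥) :=
  ((complexify 𝔥).root (K := ℂ)).image (LieModule.Weight.toLinear ℂ (complexify 𝔥) (Cx 𝔤))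

/-- Indices of a basis consisting of root vectors and a basis of the Cartan subalgebra. -/
abbrev Idx (𝔥 : LieSubalgebra ℝ 𝔤) [𝔥.IsCartanSubalgebra] : Type _ :=
  {α // α ∈ roots 𝔥} ⊕ Fin (rank 𝔥)

open Classical in
/-- The basis vector `τ_α` if `α` is a root, and `0` for every other functional `α`. -/
def rootVector {𝔥 : LieSubalgebra ℝ 𝔤} [𝔥.IsCartanSubalgebra]
    (e : Module.Basis (Idx 𝔥) ℂ (Cx 𝔤)) (α : Functional 𝔥) : Cx 𝔤 :=
  if h : α ∈ roots 𝔥 then e (Sum.inl ⟨α, h⟩) else 0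

/-- A Chevalley basis `{τ_α} ∪ {H_i}` of `ℂ ⊗ 𝔤`, adapted to the real form `𝔤`, together with
a system of positive roots. The normalization is `[τ_α, τ_{-α}] = -H_α` with `α(H_α) = 2`,
`[τ_α, τ_β] = N_{αβ} τ_{α+β}` with `N_{-α,-β} = N_{αβ}`, and `τ_{-α}` is the complex conjugate
of `τ_α`. The vectors `H_i` may form any basis of `ℂ ⊗ 𝔥`. -/
structure ChevalleyBasis (𝔥 : LieSubalgebra ℝ 𝔤) [𝔥.IsCartanSubalgebra] where
  /-- the positive roots `R₊` -/
  pos : Finset (Functional 𝔥)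
  mem_roots_iff : ∀ α, α ∈ roots 𝔥 ↔ α ∈ pos ∨ -α ∈ pos
  neg_notMem_pos : ∀ α ∈ pos, -α ∉ pos
  add_mem_pos : ∀ α ∈ pos, ∀ β ∈ pos, α + β ∈ roots 𝔥 → α + β ∈ pos
  /-- the basis of `ℂ ⊗ 𝔤` consisting of the `τ_α` and the `H_i` -/
  basis : Module.Basis (Idx 𝔥) ℂ (Cx 𝔤)
  /-- the basis `H_i` of the Cartan subalgebra -/
  cartan : Module.Basis (Fin (rank 𝔥)) ℂ (complexify 𝔥)
  basis_inr : ∀ i, basis (Sum.inr i) = cartan i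
  lie_cartan : ∀ h : complexify 𝔥, ∀ α ∈ roots 𝔥,
    ⁅(h : Cx 𝔤), rootVector basis α⁆ = α h • rootVector basis α
  /-- the dual roots `H_α` -/
  coroot : Functional 𝔥 → complexify 𝔥
  lie_neg : ∀ α ∈ roots 𝔥, ⁅rootVector basis α, rootVector basis (-α)⁆ = -(coroot α : Cx 𝔤)
  apply_coroot : ∀ α ∈ roots 𝔥, α (coroot α) = 2
  /-- the structure constants `N_{αβ}` -/
  N : Functional 𝔥 → Functional 𝔥 → ℂ
  lie_root : ∀ α ∈ roots 𝔥, ∀ β ∈ roots 𝔥, α + β ≠ 0 →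
    ⁅rootVector basis α, rootVector basis β⁆ = N α β • rootVector basis (α + β)
  N_eq_zero : ∀ α β, α + β ∉ roots 𝔥 → N α β = 0
  N_neg_neg : ∀ α ∈ roots 𝔥, ∀ β ∈ roots 𝔥, N (-α) (-β) = N α β
  conj_rootVector : ∀ α ∈ roots 𝔥, (rootVector basis α).conj = rootVector basis (-α)

namespace ChevalleyBasis

variable {𝔥 : LieSubalgebra ℝ 𝔤} [𝔥.IsCartanSubalgebra] (B : ChevalleyBasis 𝔥)

/-- The root vectors `τ_α` (`0` if `α` is not a root). -/
def τ (α : Functional 𝔥) : Cx 𝔤 := rootVector B.basis α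

open Classical in
/-- The form `θ^α` dual to the root vector `τ_α` (`0` if `α` is not a root). -/
def θ (α : Functional 𝔥) : Module.Dual ℂ (Cx 𝔤) :=
  if h : α ∈ roots 𝔥 then B.basis.coord (Sum.inl ⟨α, h⟩) else 0

/-- The form `θ^i` dual to `H_i`. -/
def θH (i : Fin (rank 𝔥)) : Module.Dual ℂ (Cx 𝔤) := B.basis.coord (Sum.inr i)

/-- `2ϱ`, the sum of the positive roots. -/
def twoRho : Functional 𝔥 := ∑ α ∈ B.pos, α

/-- `χ` is carried by the Cartan subalgebra (it vanishes on the root vectors) and lies in the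
interior of the positive Weyl chamber: `⟨χ, H_α⟩` is real and positive for `α > 0`. -/
structure IsRegularDominant (χ : Module.Dual ℂ (Cx 𝔤)) : Prop where
  apply_τ : ∀ α ∈ roots 𝔥, χ (B.τ α) = 0
  pos_coroot : ∀ α ∈ B.pos, ∃ t : ℝ, 0 < t ∧ χ (B.coroot α) = (t : ℂ)

open Classical in
/-- The anomaly coefficients `r_α = sign(α) ⟨χ + 2ϱ, H_α⟩`. -/
def r (χ : Module.Dual ℂ (Cx 𝔤)) (α : Functional 𝔥) : ℂ :=
  (if α ∈ B.pos then 1 else -1) * (χ (B.coroot α) + B.twoRho (B.coroot α))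

theorem pos_subset {α : Functional 𝔥} (h : α ∈ B.pos) : α ∈ roots 𝔥 :=
  (B.mem_roots_iff α).2 (Or.inl h)

theorem neg_mem_roots {α : Functional 𝔥} (h : α ∈ B.pos) : -α ∈ roots 𝔥 :=
  (B.mem_roots_iff (-α)).2 (Or.inr (by rwa [neg_neg]))

theorem θ_τ {α β : Functional 𝔥} (hα : α ∈ roots 𝔥) (hβ : β ∈ roots 𝔥) [Decidable (α = β)] :
    B.θ α (B.τ β) = if α = β then 1 else 0 := by
  rw [θ, τ, rootVector, dif_pos hα, dif_pos hβ, Module.Basis.coord_apply, Module.Basis.repr_self]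
  by_cases h : α = β
  · subst h; simp
  · rw [if_neg h, Finsupp.single_eq_of_ne]
    intro h'
    exact h (by simpa using h')

end ChevalleyBasis

end Roots

section Ghosts

variable {𝔤 : Type*} [LieRing 𝔤] [LieAlgebra ℝ 𝔤]

/-- The ghost space `𝒞 = Λ (ℂ ⊗ 𝔤)^*`. -/
abbrev Ghost (𝔤 : Type*) [LieRing 𝔤] [LieAlgebra ℝ 𝔤] : Type _ :=
  ExteriorAlgebra ℂ (Module.Dual ℂ (Cx 𝔤))

/-- Exterior multiplication from the left by a form. -/
def wedge (ξ : Module.Dual ℂ (Cx 𝔤)) : Module.End ℂ (Ghost 𝔤) :=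
  LinearMap.mulLeft ℂ (ExteriorAlgebra.ι ℂ ξ)

/-- Substitution of a vector into a form (interior multiplication). -/
def subst (x : Cx 𝔤) : Module.End ℂ (Ghost 𝔤) :=
  CliffordAlgebra.contractLeft (Module.Dual.eval ℂ (Cx 𝔤) x)

theorem wedge_wedge (ξ η : Module.Dual ℂ (Cx 𝔤)) :
    wedge ξ * wedge η + wedge η * wedge ξ = 0 := by
  refine LinearMap.ext fun Φ => ?_
  simp only [wedge, LinearMap.add_apply, Module.End.mul_apply, LinearMap.mulLeft_apply,
    LinearMap.zero_apply, ← mul_assoc, ← add_mul]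
  rw [ExteriorAlgebra.ι_add_mul_swap, zero_mul]

theorem subst_subst (x y : Cx 𝔤) : subst x * subst y + subst y * subst x = 0 := by
  refine LinearMap.ext fun Φ => ?_
  simp only [subst, LinearMap.add_apply, Module.End.mul_apply, LinearMap.zero_apply]
  rw [CliffordAlgebra.contractLeft_comm, neg_add_cancel]

theorem subst_wedge (x : Cx 𝔤) (ξ : Module.Dual ℂ (Cx 𝔤)) :
    subst x * wedge ξ + wedge ξ * subst x = ξ x • 1 := by
  refine LinearMap.ext fun Φ => ?_
  have h := CliffordAlgebra.contractLeft_ι_mul (Q := (0 : QuadraticForm ℂ (Module.Dual ℂ (Cx 𝔤))))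
    (d := Module.Dual.eval ℂ (Cx 𝔤) x) ξ Φ
  simp only [subst, wedge, LinearMap.add_apply, Module.End.mul_apply, LinearMap.mulLeft_apply,
    LinearMap.smul_apply, Module.End.one_apply]
  rw [show ExteriorAlgebra.ι ℂ ξ = CliffordAlgebra.ι 0 ξ from rfl, h, sub_add_cancel]
  rfl

theorem wedge_sq (ξ : Module.Dual ℂ (Cx 𝔤)) : wedge ξ * wedge ξ = 0 := by
  have h := wedge_wedge ξ ξ
  rw [← two_smul ℂ] at h
  exact (smul_eq_zero.1 h).resolve_left two_ne_zero

theorem subst_sq (x : Cx 𝔤) : subst x * subst x = 0 := by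
  have h := subst_subst x x
  rw [← two_smul ℂ] at h
  exact (smul_eq_zero.1 h).resolve_left two_ne_zero

end Ghosts

namespace ChevalleyBasis

section GhostOperators

variable {𝔤 : Type*} [LieRing 𝔤] [LieAlgebra ℝ 𝔤] [FiniteDimensional ℝ 𝔤]
  {𝔥 : LieSubalgebra ℝ 𝔤} [𝔥.IsCartanSubalgebra] (B : ChevalleyBasis 𝔥)

/-- The ghost `c^α`: multiplication by the form `θ^{-α}` dual to `τ_{-α}`. -/
def c (α : Functional 𝔥) : Module.End ℂ (Ghost 𝔤) := wedge (B.θ (-α))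

/-- The anti-ghost `b_α`: substitution of `τ_α`. -/
def b (α : Functional 𝔥) : Module.End ℂ (Ghost 𝔤) := subst (B.τ α)

/-- The ghost `c^i`: multiplication by `θ^i`. -/
def cH (i : Fin (rank 𝔥)) : Module.End ℂ (Ghost 𝔤) := wedge (B.θH i)

/-- The anti-ghost `b_i`: substitution of `H_i`. -/
def bH (i : Fin (rank 𝔥)) : Module.End ℂ (Ghost 𝔤) := subst (B.basis (Sum.inr i))

/-- The ghost vacuum `ω = θ^{-α₁} ∧ … ∧ θ^{-αₘ}`, the product over all positive roots. -/
def vacuum : Ghost 𝔤 := (B.pos.toList.map fun α => ExteriorAlgebra.ι ℂ (B.θ (-α))).prod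

/-- The operator `υ(𝔥) = c^1 ⋯ c^l`. -/
def upsilon : Module.End ℂ (Ghost 𝔤) := (List.ofFn B.cH).prod

/-- The ghost operators `L_α` for the root vectors. -/
def ghostL (α : Functional 𝔥) : Module.End ℂ (Ghost 𝔤) :=
  -(∑ β ∈ roots 𝔥, B.N α β • (B.c (-β) * B.b (α + β)))
    + ∑ i, B.cartan.repr (B.coroot α) i • (B.c α * B.bH i)
    + ∑ i, α (B.cartan i) • (B.cH i * B.b α)

/-- The normally ordered ghost operators `L_H` for `H` in the Cartan subalgebra. -/
def ghostLH (h : complexify 𝔥) : Module.End ℂ (Ghost 𝔤) :=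
  -(∑ β ∈ B.pos, β h • (B.c (-β) * B.b β)) - ∑ β ∈ B.pos, β h • (B.b (-β) * B.c β)

/-- The normally ordered (anomalous) ghost differential `d`. -/
def ghostD : Module.End ℂ (Ghost 𝔤) :=
  (1 / 2 : ℂ) • ∑ α ∈ B.pos, B.c (-α) * B.ghostL α
    + (1 / 2 : ℂ) • ∑ α ∈ B.pos, B.ghostL (-α) * B.c α
    + (1 / 2 : ℂ) • ∑ i, B.cH i * B.ghostLH (B.cartan i)

/-- `J⁺ = ∑_{α>0} r_α c^{-α} c^α`. -/
def ghostJplus (χ : Module.Dual ℂ (Cx 𝔤)) : Module.End ℂ (Ghost 𝔤) :=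
  ∑ α ∈ B.pos, B.r χ α • (B.c (-α) * B.c α)

/-- `J⁻ = ∑_{α>0} r_α⁻¹ b_{-α} b_α`. -/
def ghostJminus (χ : Module.Dual ℂ (Cx 𝔤)) : Module.End ℂ (Ghost 𝔤) :=
  ∑ α ∈ B.pos, (B.r χ α)⁻¹ • (B.b (-α) * B.b α)

/-- The relative ghost number `gh_rel = ∑_{α>0} (c^{-α} b_α - b_{-α} c^α)`. -/
def ghostNumber : Module.End ℂ (Ghost 𝔤) :=
  ∑ α ∈ B.pos, (B.c (-α) * B.b α - B.b (-α) * B.c α)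

/-- `-½ ∑_{α,β>0} N_{αβ} c^{-α} c^{-β} b_{α+β}`, the differential of `𝔫₊`. -/
def ghostPartialBar : Module.End ℂ (Ghost 𝔤) :=
  -((1 / 2 : ℂ) • ∑ α ∈ B.pos, ∑ β ∈ B.pos, B.N α β • (B.c (-α) * B.c (-β) * B.b (α + β)))

/-- `-½ ∑_{α,β>0} N_{αβ} c^α c^β b_{-α-β}`, the differential of `𝔫₋`. -/
def ghostPartial : Module.End ℂ (Ghost 𝔤) :=
  -((1 / 2 : ℂ) • ∑ α ∈ B.pos, ∑ β ∈ B.pos, B.N α β • (B.c α * B.c β * B.b (-α - β)))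

open Classical in
/-- `t_α = -∑_{β>α} N_{α,-β} c^β b_{α-β}` for `α > 0`, where `β > α` means `β - α ∈ R₊`. -/
def tPos (α : Functional 𝔥) : Module.End ℂ (Ghost 𝔤) :=
  -(∑ β ∈ B.pos.filter fun β => β - α ∈ B.pos, B.N α (-β) • (B.c β * B.b (α - β)))

open Classical in
/-- `t_{-α} = -∑_{β>α} N_{α,-β} c^{-β} b_{β-α}` for `α > 0`. -/
def tNeg (α : Functional 𝔥) : Module.End ℂ (Ghost 𝔤) :=
  -(∑ β ∈ B.pos.filter fun β => β - α ∈ B.pos, B.N α (-β) • (B.c (-β) * B.b (β - α)))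

/-- The factor of the star operation in the modes of the positive root `α`. It maps
`1 ↦ 1`, `b_{-α} ↦ ε r_α c^{-α}`, `c^{-α} ↦ ε r_α⁻¹ b_{-α}`,
`b_{-α} c^{-α} ↦ -b_{-α} c^{-α}` (applied to the vacuum), with `ε = (-1)^{l+1}`. -/
def starFactor (χ : Module.Dual ℂ (Cx 𝔤)) (α : Functional 𝔥) : Module.End ℂ (Ghost 𝔤) :=
  1 - B.b (-α) * B.c α - B.c (-α) * B.b α
    + (-1 : ℂ) ^ (rank 𝔥 + 1) •
      (B.r χ α • (B.c (-α) * B.c α) + (B.r χ α)⁻¹ • (B.b (-α) * B.b α))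

/-- The star operation on ghosts. On the span of the vectors
`b_{-α₁} ⋯ b_{-αₖ} c^{-β₁} ⋯ c^{-βₛ} ω`, which is the part of the ghost space killed by all
`b_i`, it is the linear operator determined by the rule proved in `star_monomial`. -/
def star (χ : Module.Dual ℂ (Cx 𝔤)) : Module.End ℂ (Ghost 𝔤) :=
  (B.pos.toList.map (B.starFactor χ)).prod

open Classical in
/-- Some linear order on the indices (needed to list the factors of exterior monomials). -/
abbrev idxOrder (𝔥 : LieSubalgebra ℝ 𝔤) [𝔥.IsCartanSubalgebra] : LinearOrder (Idx 𝔥) :=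
  linearOrderOfSTO WellOrderingRel

open Classical in
/-- The basis of `𝒞` consisting of the exterior monomials in the `θ^α` and `θ^i`. -/
def ghostBasis : Module.Basis (Finset (Idx 𝔥)) ℂ (Ghost 𝔤) :=
  letI : LinearOrder (Idx 𝔥) := idxOrder 𝔥
  B.basis.dualBasis.ExteriorAlgebra

open Classical in
/-- The linear map with `θ^α ↦ -θ^{-α}` and `θ^i ↦ θ^i`. -/
def conjForm : Module.Dual ℂ (Cx 𝔤) →ₗ[ℂ] Module.Dual ℂ (Cx 𝔤) :=
  B.basis.dualBasis.constr ℂ (Sum.elim (fun α => -B.θ (-α.1)) B.θH)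

/-- The coefficient of the top exterior monomial (Berezin integral). -/
def top : Ghost 𝔤 →ₗ[ℂ] ℂ := B.ghostBasis.coord Finset.univ

/-- The bilinear form `∫ (σ Φ)^{rev} ∧ Ψ`, with `σ` the algebra map that extends `conjForm`. -/
def preForm (Φ Ψ : Ghost 𝔤) : ℂ :=
  B.top (CliffordAlgebra.reverse (ExteriorAlgebra.map B.conjForm Φ) * Ψ)

/-- The pairing of `𝒞` on vectors with real coordinates in the basis `ghostBasis`: the bilinear
form with `(c^α Φ, Ψ) = -(Φ, c^{-α} Ψ)`, `(b_α Φ, Ψ) = -(Φ, b_{-α} Ψ)`,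
`(c^i Φ, Ψ) = (Φ, c^i Ψ)`, `(b_i Φ, Ψ) = (Φ, b_i Ψ)` and `(ω, υ(𝔥) ω) = 1`. -/
def ghostForm (Φ Ψ : Ghost 𝔤) : ℂ :=
  B.preForm Φ Ψ / B.preForm B.vacuum (B.upsilon B.vacuum)

end GhostOperators

section StarRule

variable {𝔤 : Type*} [LieRing 𝔤] [LieAlgebra ℝ 𝔤] [FiniteDimensional ℝ 𝔤]
  {𝔥 : LieSubalgebra ℝ 𝔤} [𝔥.IsCartanSubalgebra] (B : ChevalleyBasis 𝔥)

theorem mem_roots_neg_iff (B : ChevalleyBasis 𝔥) {α : Functional 𝔥} : -α ∈ roots 𝔥 ↔ α ∈ roots 𝔥 := by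
  rw [B.mem_roots_iff, B.mem_roots_iff, neg_neg, or_comm]

theorem b_c {α β : Functional 𝔥} (hα : α ∈ roots 𝔥) (hβ : β ∈ roots 𝔥) (h : α + β ≠ 0) :
    B.b α * B.c β = -(B.c β * B.b α) := by
  classical
  have h1 := subst_wedge (B.τ α) (B.θ (-β))
  rw [B.θ_τ (B.mem_roots_neg_iff.2 hβ) hα, if_neg, zero_smul] at h1
  · exact eq_neg_of_add_eq_zero_left h1
  · rintro rfl
    exact h (neg_add_cancel β)

theorem b_c_self {α : Functional 𝔥} (hα : α ∈ roots 𝔥) :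
    B.b α * B.c (-α) = 1 - B.c (-α) * B.b α := by
  classical
  have h1 := subst_wedge (B.τ α) (B.θ (- -α))
  rw [neg_neg, B.θ_τ hα hα, if_pos rfl, one_smul] at h1
  rw [b, c, neg_neg]
  exact eq_sub_of_add_eq h1

theorem c_c (α β : Functional 𝔥) : B.c α * B.c β = -(B.c β * B.c α) :=
  eq_neg_of_add_eq_zero_left (wedge_wedge _ _)

theorem b_b (α β : Functional 𝔥) : B.b α * B.b β = -(B.b β * B.b α) :=
  eq_neg_of_add_eq_zero_left (subst_subst _ _)

section

variable {E : Type*} [Ring E] [Algebra ℂ E]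

theorem factor_left {A a C d : E} {ε r : ℂ} (hε : ε * ε = 1) (hr : r ≠ 0)
    (hAa : a * A = 1 - A * a) (hdA : d * A = -(A * d)) (hCA : C * A = -(A * C))
    (hA : A * A = 0) (hC : C * C = 0) :
    (1 - A * a - C * d + ε • (r • (C * a) + r⁻¹ • (A * d))) * A
      = (ε * r) • (C * (1 - A * a - C * d + ε • (r • (C * a) + r⁻¹ • (A * d)))) := by
  have e1 : A * a * A = A := by rw [mul_assoc, hAa, mul_sub, ← mul_assoc, hA]; simp
  have e2 : C * d * A = A * C * d := by
    rw [mul_assoc, hdA, mul_neg, ← mul_assoc, hCA, neg_mul, neg_neg]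
  have e3 : C * a * A = C - C * A * a := by rw [mul_assoc, hAa, mul_sub, mul_one, ← mul_assoc]
  have e4 : A * d * A = 0 := by rw [mul_assoc, hdA, mul_neg, ← mul_assoc, hA]; simp
  have e5 : C * (C * d) = 0 := by rw [← mul_assoc, hC, zero_mul]
  have e6 : C * (C * a) = 0 := by rw [← mul_assoc, hC, zero_mul]
  have e7 : C * (A * d) = -(A * C * d) := by rw [← mul_assoc, hCA, neg_mul]
  have e8 : (ε * r) * (ε * r⁻¹) = 1 := by
    rw [mul_mul_mul_comm, hε, mul_inv_cancel₀ hr, one_mul]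
  simp only [add_mul, sub_mul, smul_mul_assoc, mul_add, mul_sub, mul_smul_comm, e1, e2, e3, e4,
    e5, e6, e7, one_mul, mul_one, smul_zero, sub_zero, zero_add, add_zero, smul_neg, smul_add,
    smul_sub, smul_smul, ← mul_assoc]
  rw [mul_assoc (ε * r), e8, one_smul]
  abel

theorem factor_right {A a C d : E} {ε r : ℂ} (hε : ε * ε = 1) (hr : r ≠ 0)
    (hdC : d * C = 1 - C * d) (haC : a * C = -(C * a))
    (hA : A * A = 0) (hC : C * C = 0) :
    (1 - A * a - C * d + ε • (r • (C * a) + r⁻¹ • (A * d))) * C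
      = (ε * r⁻¹) • (A * (1 - A * a - C * d + ε • (r • (C * a) + r⁻¹ • (A * d)))) := by
  have e1 : A * a * C = -(A * C * a) := by rw [mul_assoc, haC, mul_neg, ← mul_assoc]
  have e2 : C * d * C = C := by rw [mul_assoc, hdC, mul_sub, ← mul_assoc, hC]; simp
  have e3 : C * a * C = 0 := by rw [mul_assoc, haC, mul_neg, ← mul_assoc, hC]; simp
  have e4 : A * d * C = A - A * C * d := by rw [mul_assoc, hdC, mul_sub, mul_one, ← mul_assoc]
  have e5 : A * (A * a) = 0 := by rw [← mul_assoc, hA, zero_mul]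
  have e6 : A * (A * d) = 0 := by rw [← mul_assoc, hA, zero_mul]
  have e8 : (ε * r⁻¹) * (ε * r) = 1 := by
    rw [mul_mul_mul_comm, hε, inv_mul_cancel₀ hr, one_mul]
  simp only [add_mul, sub_mul, smul_mul_assoc, mul_add, mul_sub, mul_smul_comm, e1, e2, e3, e4,
    e5, e6, one_mul, mul_one, smul_zero, sub_zero, zero_add, add_zero, smul_add,
    smul_sub, smul_smul, ← mul_assoc]
  rw [mul_assoc (ε * r⁻¹), e8, one_smul]
  abel

theorem factor_comm {A a C d X : E} {ε r : ℂ} (hA : A * X = -(X * A)) (ha : a * X = -(X * a))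
    (hC : C * X = -(X * C)) (hd : d * X = -(X * d)) :
    Commute (1 - A * a - C * d + ε • (r • (C * a) + r⁻¹ • (A * d))) X := by
  have key : ∀ {u v : E}, u * X = -(X * u) → v * X = -(X * v) → Commute (u * v) X := by
    intro u v hu hv
    rw [Commute, SemiconjBy, mul_assoc, hv, mul_neg, ← mul_assoc, hu, neg_mul, neg_neg, mul_assoc]
  exact (((Commute.one_left X).sub_left (key hA ha)).sub_left (key hC hd)).add_left
    ((((key hC ha).smul_left r).add_left ((key hA hd).smul_left r⁻¹)).smul_left ε)

theorem prod_intertwine {ι : Type*} {P : Finset ι} {s : ι → E} {i : ι} {X Y : E} {k : ℂ}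
    (h : s i * X = k • (Y * s i)) (hX : ∀ j ∈ P, j ≠ i → Commute (s j) X)
    (hY : ∀ j ∈ P, j ≠ i → Commute (s j) Y) {l : List ι} (hP : ∀ j ∈ l, j ∈ P)
    (hl : l.Nodup) (hi : i ∈ l) : (l.map s).prod * X = k • (Y * (l.map s).prod) := by
  induction l with
  | nil => simp at hi
  | cons j l ih =>
    rw [List.nodup_cons] at hl
    rw [List.map_cons, List.prod_cons, mul_assoc]
    by_cases hj : j = i
    · subst hj
      have hc : Commute (l.map s).prod X := by
        refine Commute.list_prod_left _ _ fun x hx => ?_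
        obtain ⟨m, hm, rfl⟩ := List.mem_map.1 hx
        exact hX m (hP m (by simp [hm])) fun e => hl.1 (e ▸ hm)
      rw [hc.eq, ← mul_assoc, h, smul_mul_assoc, mul_assoc]
    · have hi' : i ∈ l := (List.mem_cons.1 hi).resolve_left fun e => hj e.symm
      rw [ih (fun m hm => hP m (by simp [hm])) hl.2 hi', mul_smul_comm, ← mul_assoc,
        (hY j (hP j (by simp)) hj).eq, mul_assoc]

theorem list_intertwine {ι : Type*} {S : E} {f g : ι → E} {k : ι → ℂ} (l : List ι)
    (h : ∀ i ∈ l, S * f i = k i • (g i * S)) :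
    S * (l.map f).prod = (l.map k).prod • ((l.map g).prod * S) := by
  induction l with
  | nil => simp
  | cons i l ih =>
    rw [List.map_cons, List.prod_cons, ← mul_assoc, h i (by simp), smul_mul_assoc, mul_assoc,
      ih fun j hj => h j (by simp [hj])]
    simp only [List.map_cons, List.prod_cons, mul_smul_comm, smul_smul, mul_assoc]

theorem prod_swap {ι κ : Type*} {f : ι → E} {g : κ → E} (l : List ι) (m : List κ)
    (h : ∀ i ∈ l, ∀ j ∈ m, f i * g j = -(g j * f i)) :
    (l.map f).prod * (m.map g).prod
      = (-1 : ℂ) ^ (l.length * m.length) • ((m.map g).prod * (l.map f).prod) := by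
  have h1 : ∀ i ∈ l, f i * (m.map g).prod = (-1 : ℂ) ^ m.length • ((m.map g).prod * f i) := by
    intro i hi
    have := list_intertwine (S := f i) (f := g) (g := g) (k := fun _ => -1) m
      fun j hj => by rw [h i hi j hj, neg_smul, one_smul]
    simpa using this
  clear h
  induction l with
  | nil => simp
  | cons i l ih =>
    simp only [List.map_cons, List.prod_cons, List.length_cons]
    rw [mul_assoc, ih fun j hj => h1 j (by simp [hj]), mul_smul_comm, ← mul_assoc,
      h1 i (by simp), smul_mul_assoc, smul_smul, ← pow_add, mul_assoc]
    congr 2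
    ring

end

theorem pos_add_ne {α β : Functional 𝔥} (hα : α ∈ B.pos) (hβ : β ∈ B.pos) : α + β ≠ 0 := by
  intro h
  have := B.neg_notMem_pos α hα
  rw [neg_eq_of_add_eq_zero_right h] at this
  exact this hβ

theorem wedge_vacuum {α : Functional 𝔥} (hα : α ∈ B.pos) : B.c α B.vacuum = 0 := by
  have key : ∀ l : List (Functional 𝔥), α ∈ l →
      ExteriorAlgebra.ι ℂ (B.θ (-α)) *
        (l.map fun α => ExteriorAlgebra.ι ℂ (B.θ (-α))).prod = 0 := by
    intro l
    induction l with
    | nil => simp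
    | cons β l ih =>
      intro h
      rw [List.map_cons, List.prod_cons, ← mul_assoc]
      by_cases hβ : α = β
      · subst hβ
        rw [ExteriorAlgebra.ι_sq_zero, zero_mul]
      · rw [eq_neg_of_add_eq_zero_left (ExteriorAlgebra.ι_add_mul_swap _ _), neg_mul, mul_assoc,
          ih ((List.mem_cons.1 h).resolve_left hβ), mul_zero, neg_zero]
  exact key _ (Finset.mem_toList.2 hα)

theorem subst_vacuum {α : Functional 𝔥} (hα : α ∈ B.pos) : B.b α B.vacuum = 0 := by
  classical
  have key : ∀ l : List (Functional 𝔥), (∀ β ∈ l, β ∈ B.pos) →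
      B.b α (l.map fun α => ExteriorAlgebra.ι ℂ (B.θ (-α))).prod = 0 := by
    intro l
    induction l with
    | nil =>
      intro _
      exact CliffordAlgebra.contractLeft_one
        (Q := (0 : QuadraticForm ℂ (Module.Dual ℂ (Cx 𝔤)))) (Module.Dual.eval ℂ (Cx 𝔤) (B.τ α))
    | cons β l ih =>
      intro h
      rw [List.map_cons, List.prod_cons]
      have hβ := h β (by simp)
      have h1 := LinearMap.congr_fun
        (B.b_c (B.pos_subset hα) (B.pos_subset hβ) (B.pos_add_ne hα hβ))
        (l.map fun α => ExteriorAlgebra.ι ℂ (B.θ (-α))).prod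
      refine h1.trans ?_
      rw [LinearMap.neg_apply, Module.End.mul_apply, ih fun γ hγ => h γ (by simp [hγ]), map_zero,
        neg_zero]
  exact key _ fun β hβ => Finset.mem_toList.1 hβ

theorem star_vacuum (χ : Module.Dual ℂ (Cx 𝔤)) : B.star χ B.vacuum = B.vacuum := by
  have key : ∀ l : List (Functional 𝔥), (∀ β ∈ l, β ∈ B.pos) →
      (l.map (B.starFactor χ)).prod B.vacuum = B.vacuum := by
    intro l
    induction l with
    | nil => intro _; rfl
    | cons β l ih =>
      intro h
      have hβ := h β (by simp)
      rw [List.map_cons, List.prod_cons, Module.End.mul_apply, ih fun γ hγ => h γ (by simp [hγ])]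
      simp [starFactor, B.wedge_vacuum hβ, B.subst_vacuum hβ]
  exact key _ fun β hβ => Finset.mem_toList.1 hβ

theorem starFactor_comm_b (χ : Module.Dual ℂ (Cx 𝔤)) {α β : Functional 𝔥} (hα : α ∈ B.pos)
    (hβ : β ∈ B.pos) (h : β ≠ α) : Commute (B.starFactor χ β) (B.b (-α)) := by
  refine factor_comm (B.b_b _ _) ?_ ?_ (B.b_b _ _)
  · rw [B.b_c (B.neg_mem_roots hα) (B.pos_subset hβ) (fun e => h (neg_add_eq_zero.1 e).symm), neg_neg]
  · rw [B.b_c (B.neg_mem_roots hα) (B.neg_mem_roots hβ), neg_neg]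
    rw [← neg_add, neg_ne_zero]
    exact B.pos_add_ne hα hβ

theorem starFactor_comm_c (χ : Module.Dual ℂ (Cx 𝔤)) {α β : Functional 𝔥} (hα : α ∈ B.pos)
    (hβ : β ∈ B.pos) (h : β ≠ α) : Commute (B.starFactor χ β) (B.c (-α)) := by
  refine factor_comm ?_ (B.c_c _ _) (B.c_c _ _) ?_
  · rw [B.b_c (B.neg_mem_roots hβ) (B.neg_mem_roots hα)]
    rw [← neg_add, neg_ne_zero]
    exact B.pos_add_ne hβ hα
  · rw [B.b_c (B.pos_subset hβ) (B.neg_mem_roots hα)]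
    rw [add_comm]
    exact fun e => h (neg_add_eq_zero.1 e).symm

theorem starFactor_b (χ : Module.Dual ℂ (Cx 𝔤)) {α : Functional 𝔥} (hα : α ∈ B.pos)
    (hr : B.r χ α ≠ 0) :
    B.starFactor χ α * B.b (-α)
      = ((-1 : ℂ) ^ (rank 𝔥 + 1) * B.r χ α) • (B.c (-α) * B.starFactor χ α) := by
  have h2 := B.b_c_self (B.neg_mem_roots hα)
  rw [neg_neg] at h2
  refine factor_left (by rw [← mul_pow]; simp) hr ?_ (B.b_b _ _) ?_ (subst_sq _) (wedge_sq _)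
  · rw [h2, sub_sub_cancel]
  · rw [B.b_c (B.neg_mem_roots hα) (B.neg_mem_roots hα), neg_neg]
    rw [← neg_add, neg_ne_zero]
    exact B.pos_add_ne hα hα

theorem starFactor_c (χ : Module.Dual ℂ (Cx 𝔤)) {α : Functional 𝔥} (hα : α ∈ B.pos)
    (hr : B.r χ α ≠ 0) :
    B.starFactor χ α * B.c (-α)
      = ((-1 : ℂ) ^ (rank 𝔥 + 1) * (B.r χ α)⁻¹) • (B.b (-α) * B.starFactor χ α) :=
  factor_right (by rw [← mul_pow]; simp) hr (B.b_c_self (B.pos_subset hα)) (B.c_c _ _) (subst_sq _) (wedge_sq _)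

/-- The rule that determines the star operation, for monomials in the modes of positive roots
`α₁, …, αₖ` and `β₁, …, βₛ`. -/
theorem star_monomial (χ : Module.Dual ℂ (Cx 𝔤)) (hr : ∀ α ∈ B.pos, B.r χ α ≠ 0)
    (as bs : List (Functional 𝔥)) (has : ∀ α ∈ as, α ∈ B.pos) (hbs : ∀ β ∈ bs, β ∈ B.pos) :
    B.star χ (((as.map fun α => B.b (-α)).prod * (bs.map fun β => B.c (-β)).prod) B.vacuum)
      = ((-1 : ℂ) ^ ((rank 𝔥 + 1) * (as.length + bs.length) + as.length * bs.length)
          * ((as.map (B.r χ)).prod / (bs.map (B.r χ)).prod)) •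
        ((bs.map fun β => B.b (-β)).prod * (as.map fun α => B.c (-α)).prod) B.vacuum := by
  set ε : ℂ := (-1) ^ (rank 𝔥 + 1) with hε
  have hb : ∀ α ∈ as, B.star χ * B.b (-α) = (ε * B.r χ α) • (B.c (-α) * B.star χ) := by
    intro α hα
    have := prod_intertwine (B.starFactor_b χ (has α hα) (hr α (has α hα)))
      (l := B.pos.toList) (P := B.pos) (fun j hj h => B.starFactor_comm_b χ (has α hα) hj h)
      (fun j hj h => B.starFactor_comm_c χ (has α hα) hj h)
      (fun j hj => Finset.mem_toList.1 hj) B.pos.nodup_toList (Finset.mem_toList.2 (has α hα))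
    exact this
  have hc : ∀ α ∈ bs, B.star χ * B.c (-α) = (ε * (B.r χ α)⁻¹) • (B.b (-α) * B.star χ) := by
    intro α hα
    have := prod_intertwine (B.starFactor_c χ (hbs α hα) (hr α (hbs α hα)))
      (l := B.pos.toList) (P := B.pos) (fun j hj h => B.starFactor_comm_c χ (hbs α hα) hj h)
      (fun j hj h => B.starFactor_comm_b χ (hbs α hα) hj h)
      (fun j hj => Finset.mem_toList.1 hj) B.pos.nodup_toList (Finset.mem_toList.2 (hbs α hα))
    exact this
  have h1 := list_intertwine as hb
  have h2 := list_intertwine bs hc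
  have h3 := prod_swap (f := fun α => B.c (-α)) (g := fun β => B.b (-β)) as bs (by
    intro α hα β hβ
    rw [B.b_c (B.neg_mem_roots (hbs β hβ)) (B.neg_mem_roots (has α hα)), neg_neg]
    rw [← neg_add, neg_ne_zero]
    exact B.pos_add_ne (hbs β hβ) (has α hα))
  have hk : ∀ (l : List (Functional 𝔥)) (f : Functional 𝔥 → ℂ),
      (l.map fun α => ε * f α).prod = ε ^ l.length * (l.map f).prod := by
    intro l f
    rw [List.prod_map_mul, List.map_const', List.prod_replicate]
  have hinv : (bs.map fun β => (B.r χ β)⁻¹).prod = ((bs.map (B.r χ)).prod)⁻¹ := by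
    clear * -
    induction bs with
    | nil => simp
    | cons β l ih => simp [ih, mul_comm]
  have h4 : B.star χ * ((as.map fun α => B.b (-α)).prod * (bs.map fun β => B.c (-β)).prod)
      = ((-1 : ℂ) ^ ((rank 𝔥 + 1) * (as.length + bs.length) + as.length * bs.length)
          * ((as.map (B.r χ)).prod / (bs.map (B.r χ)).prod)) •
        (((bs.map fun β => B.b (-β)).prod * (as.map fun α => B.c (-α)).prod) * B.star χ) := by
    rw [← mul_assoc, h1, smul_mul_assoc, mul_assoc, h2, mul_smul_comm, ← mul_assoc, h3,
      smul_mul_assoc, smul_smul, smul_smul, hk as (B.r χ), hk bs (fun β => (B.r χ β)⁻¹), hinv, hε,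
      div_eq_mul_inv, pow_add, pow_mul, pow_add]
    congr 1
    ring
  have h5 := LinearMap.congr_fun h4 B.vacuum
  rw [Module.End.mul_apply, LinearMap.smul_apply, Module.End.mul_apply _ (B.star χ),
    B.star_vacuum] at h5
  exact h5

end StarRule

end ChevalleyBasis

section Operators

variable {𝔤 : Type*} [LieRing 𝔤] [LieAlgebra ℝ 𝔤] [FiniteDimensional ℝ 𝔤]
  {V : Type*} [NormedAddCommGroup V] [InnerProductSpace ℂ V]

/-- The complex linear extension to `ℂ ⊗ 𝔤` of a representation of `𝔤` on a complex space. -/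
def complexRep (ρ : 𝔤 →ₗ[ℝ] Module.End ℂ V) : Cx 𝔤 →ₗ[ℂ] Module.End ℂ V :=
  LinearMap.liftBaseChange ℂ ρ

/-- The constraint operators `ℒ_x = ρ(x) - ⟨χ, x⟩`. -/
def constraint (ρ : 𝔤 →ₗ[ℝ] Module.End ℂ V) (χ : Module.Dual ℂ (Cx 𝔤)) (x : Cx 𝔤) :
    Module.End ℂ V :=
  complexRep ρ x - χ x • 1

/-- The total differential space `𝒞(V) = 𝒞 ⊗ V`. -/
def GhostV (𝔤 : Type*) [LieRing 𝔤] [LieAlgebra ℝ 𝔤] (V : Type*) [NormedAddCommGroup V]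
    [InnerProductSpace ℂ V] : Type _ :=
  Ghost 𝔤 ⊗[ℂ] V

instance : AddCommGroup (GhostV 𝔤 V) := inferInstanceAs (AddCommGroup (Ghost 𝔤 ⊗[ℂ] V))
instance : Module ℂ (GhostV 𝔤 V) := inferInstanceAs (Module ℂ (Ghost 𝔤 ⊗[ℂ] V))

/-- The operator `A ⊗ T` on `𝒞(V)`. -/
def tensorOp (A : Module.End ℂ (Ghost 𝔤)) (T : Module.End ℂ V) : Module.End ℂ (GhostV 𝔤 V) :=
  (TensorProduct.map A T : Module.End ℂ (Ghost 𝔤 ⊗[ℂ] V))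

/-- A ghost operator, as the operator `A ⊗ 1` on `𝒞(V)`. -/
def onV (V : Type*) [NormedAddCommGroup V] [InnerProductSpace ℂ V]
    (A : Module.End ℂ (Ghost 𝔤)) : Module.End ℂ (GhostV 𝔤 V) :=
  tensorOp A 1

open Classical in
/-- The restriction of an operator to an invariant subspace (`0` if `p` is not invariant). -/
def restrictTo {E : Type*} [AddCommGroup E] [Module ℂ E] (p : Submodule ℂ E)
    (A : Module.End ℂ E) : Module.End ℂ p :=
  if h : ∀ x ∈ p, A x ∈ p then A.restrict h else 0

namespace ChevalleyBasis

variable {𝔥 : LieSubalgebra ℝ 𝔤} [𝔥.IsCartanSubalgebra] (B : ChevalleyBasis 𝔥)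
  (ρ : 𝔤 →ₗ[ℝ] Module.End ℂ V) (χ : Module.Dual ℂ (Cx 𝔤))

/-- The total differential
`D = ∑_{α ∈ R} c^{-α} ⊗ ℒ_α + ∑_i c^i ⊗ ℒ_i + d ⊗ 1`. -/
def totalD : Module.End ℂ (GhostV 𝔤 V) :=
  ∑ α ∈ roots 𝔥, tensorOp (B.c (-α)) (constraint ρ χ (B.τ α))
    + ∑ i, tensorOp (B.cH i) (constraint ρ χ (B.cartan i))
    + onV V B.ghostD

/-- `L_H^tot = 1 ⊗ ℒ_H + L_H ⊗ 1` for `H` in the Cartan subalgebra. -/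
def totalLH (h : complexify 𝔥) : Module.End ℂ (GhostV 𝔤 V) :=
  tensorOp 1 (constraint ρ χ h) + onV V (B.ghostLH h)

/-- The relative differential space: `L_H^tot Ψ = 0` for all `H`, and `b_i Ψ = 0` for all `i`. -/
def Crel : Submodule ℂ (GhostV 𝔤 V) :=
  (⨅ h, LinearMap.ker (B.totalLH ρ χ h)) ⊓ ⨅ i, LinearMap.ker (onV V (B.bH i))

/-- The component of bidegree `(1, 0)` of the relative differential. -/
def diffBarOp : Module.End ℂ (GhostV 𝔤 V) :=
  ∑ α ∈ B.pos, tensorOp (B.c (-α)) (constraint ρ χ (B.τ α))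
    + onV V B.ghostPartialBar + ∑ α ∈ B.pos, onV V (B.c (-α) * B.tPos α)

/-- The component of bidegree `(0, -1)` of the relative differential. -/
def diffOp : Module.End ℂ (GhostV 𝔤 V) :=
  ∑ α ∈ B.pos, tensorOp (B.c α) (constraint ρ χ (B.τ (-α)))
    + onV V B.ghostPartial + ∑ α ∈ B.pos, onV V (B.c α * B.tNeg α)

/-- The `V`-valued coordinate of an element of `𝒞 ⊗ V` at an exterior monomial. -/
def coeff (V : Type*) [NormedAddCommGroup V] [InnerProductSpace ℂ V] (S : Finset (Idx 𝔥)) :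
    GhostV 𝔤 V →ₗ[ℂ] V :=
  ((TensorProduct.lid ℂ V).toLinearMap ∘ₗ (B.ghostBasis.coord S).rTensor V :
    Ghost 𝔤 ⊗[ℂ] V →ₗ[ℂ] V)

/-- The pairing `(·, ·)` of `𝒞(V)`, conjugate linear in the first argument, induced by the
pairing of `𝒞` and the scalar product of `V`. -/
def pairing (Ψ Ψ' : GhostV 𝔤 V) : ℂ :=
  ∑ S : Finset (Idx 𝔥), ∑ T : Finset (Idx 𝔥),
    B.ghostForm (B.ghostBasis S) (B.ghostBasis T) *
      inner ℂ (B.coeff V S Ψ) (B.coeff V T Ψ')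

/-- The Kähler inner product `⟨Ψ, Ψ'⟩ = (⋆Ψ, υ(𝔥) Ψ')`. -/
def kahler (Ψ Ψ' : GhostV 𝔤 V) : ℂ :=
  B.pairing (onV V (B.star χ) Ψ) (onV V B.upsilon Ψ')

/-- `A'` is the conjugate of `A` for the Kähler inner product on the relative space. -/
def IsKahlerAdjoint (A A' : Module.End ℂ (B.Crel ρ χ)) : Prop :=
  ∀ Ψ Ψ' : B.Crel ρ χ, B.kahler χ (A Ψ : GhostV 𝔤 V) Ψ' = B.kahler χ (Ψ : GhostV 𝔤 V) (A' Ψ')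

open Classical in
/-- The conjugate `A†` for the Kähler inner product (`0` if there is none). -/
def dagger (A : Module.End ℂ (B.Crel ρ χ)) : Module.End ℂ (B.Crel ρ χ) :=
  if h : ∃ A', B.IsKahlerAdjoint ρ χ A A' then h.choose else 0

/-- The Laplace operator `A A† + A† A`. -/
def laplace (A : Module.End ℂ (B.Crel ρ χ)) : Module.End ℂ (B.Crel ρ χ) :=
  A * B.dagger ρ χ A + B.dagger ρ χ A * A

/-- The relative differential, the restriction of `D` to the relative space. -/
def Drel : Module.End ℂ (B.Crel ρ χ) := restrictTo (B.Crel ρ χ) (B.totalD ρ χ)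

/-- The differential of bidegree `(1, 0)` on the relative space. -/
def diffBar : Module.End ℂ (B.Crel ρ χ) := restrictTo (B.Crel ρ χ) (B.diffBarOp ρ χ)

/-- The differential of bidegree `(0, -1)` on the relative space. -/
def diff : Module.End ℂ (B.Crel ρ χ) := restrictTo (B.Crel ρ χ) (B.diffOp ρ χ)

/-- `D_rel^c`, the difference of the two components. -/
def Dc : Module.End ℂ (B.Crel ρ χ) := B.diff ρ χ - B.diffBar ρ χ

/-- `J⁺` on the relative space. -/
def Jplus : Module.End ℂ (B.Crel ρ χ) := restrictTo (B.Crel ρ χ) (onV V (B.ghostJplus χ))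

/-- `J⁻` on the relative space. -/
def Jminus : Module.End ℂ (B.Crel ρ χ) := restrictTo (B.Crel ρ χ) (onV V (B.ghostJminus χ))

/-- `gh_rel` on the relative space. -/
def ghRel : Module.End ℂ (B.Crel ρ χ) := restrictTo (B.Crel ρ χ) (onV V B.ghostNumber)

/-- The Laplacian of `D_rel`. -/
def Lap : Module.End ℂ (B.Crel ρ χ) := B.laplace ρ χ (B.Drel ρ χ)

/-- The Laplacian of `D_rel^c`. -/
def LapC : Module.End ℂ (B.Crel ρ χ) := B.laplace ρ χ (B.Dc ρ χ)

/-- The Laplacian of the differential of bidegree `(0, -1)`. -/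
def Box : Module.End ℂ (B.Crel ρ χ) := B.laplace ρ χ (B.diff ρ χ)

/-- The Laplacian of the differential of bidegree `(1, 0)`. -/
def BoxBar : Module.End ℂ (B.Crel ρ χ) := B.laplace ρ χ (B.diffBar ρ χ)

end ChevalleyBasis

end Operators

end

end AnomalousBRST

/-! Write $a=\mathcal D$, $b=\overline{\mathcal D}$, $J=J^+$, $K=J^-$, $g={\rm gh}_{\rm rel}$. The
statement is a Kähler package: once the bidegree splitting of $D_{\rm rel}$, the square $D_{\rm
rel}^2=-J$, the adjoints $b^\dagger=[K,a]$, $a^\dagger=-[K,b]$, and $[J,K]=g$ are known, the rest is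
graded algebra, collected in `kahler_algebra`.

The differential. Normal ordering shifts the Chevalley-Eilenberg differential by the ghost of
$2\varrho$ (`ghostD_eq`), so $D$ is the ordinary differential of $\mathfrak g_{\mathbb C}$ with
values in $V$, twisted by the functional $\xi=\chi+2\varrho$ (`totalD_eq`). The square of a twisted
differential is $-d\xi$, and $\xi$ sees only the brackets $[\tau_\alpha,\tau_{-\alpha}]$; hence
$D^2=-J$ (`totalD_sq`). Cartan's formula gives $L^{\rm tot}_H$ as the anticommutator of $D$ with the
substitution of $H$, so $D$ preserves the relative space. There the terms of $D$ involving Cartan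
modes vanish (`totalD_apply`), and the remaining ones have degree $1$ or $0$ in the modes of
positive roots. Comparing degrees in $(b+a)^2=-J$ gives $a^2=b^2=0$ and $ab+ba=-J$
(`sq_eq_zero_of_grading`).

The metric. The star operation exchanges $b_\alpha$ and $c^\alpha$ up to factors $r_\alpha^{\pm1}$
(`star_intertwine`), which makes $r_\alpha^{-1}b_\alpha$ the conjugate of $c^{-\alpha}$ and $K$ the
conjugate of $J$. Since $2\varrho(H_\alpha)\ge0$, all $r_\alpha$ are positive, so the form is
definite where all $b_i$ vanish (`eq_zero_of_kahler_self`). Definiteness gives uniqueness of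
conjugates. As $V$ need not be complete, existence is proved by exhibiting them.

The Kähler identity. The conjugate of $b+a$ is $[K,a-b]$ (`isAdj_weighted`). For the cubic ghost
terms this is the Cartan component of the Jacobi identity, evaluated on $\xi$ (`N_jacobi`,
`Jminus_cubic_sum`). Separating degrees gives $b^\dagger$ and $a^\dagger$ individually
(`isAdj_diff`).

Conclusion. The cross terms in $\Delta$ and $\Delta^c$ are $\pm[K,a^2]$ and $\pm[K,b^2]$, hence
zero, while $\overline\Box-\Box=[K,ab+ba]=[J,K]=g$. The other commutators follow from the Jacobi
identity, with $[K,a^\dagger]=[K,b^\dagger]=0$ obtained by conjugating $[J,a]=[J,b]=0$. -/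

namespace AnomalousBRST
noncomputable section

/-! ### Roots and coroots of the complexification; positivity of the coefficients $r_\alpha$. -/

section RootTheory

variable {𝔤 : Type*} [LieRing 𝔤] [LieAlgebra ℝ 𝔤] [FiniteDimensional ℝ 𝔤]

theorem killingForm_tmul_one (a c : 𝔤) :
    killingForm ℂ (Cx 𝔤) (Cx.tmul 1 a) (Cx.tmul 1 c) = (killingForm ℝ 𝔤 a c : ℂ) := by
  have h : killingForm ℂ (ℂ ⊗[ℝ] 𝔤) = (killingForm ℝ 𝔤).baseChange ℂ :=
    LieModule.traceForm_baseChange ℝ 𝔤 𝔤 ℂ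
  have h' := congrArg (fun f => f ((1 : ℂ) ⊗ₜ[ℝ] a) ((1 : ℂ) ⊗ₜ[ℝ] c)) h
  refine h'.trans ?_
  simp

/-- A radical element $a+ib$ pairs to zero with every real $c$. The Killing form is real on
$\mathfrak g$, so real and imaginary parts give $\kappa(c,a)=\kappa(c,b)=0$; taking $c=a$ and $c=b$
contradicts definiteness unless both vanish. -/
theorem isKilling_cx (hcompact : ∀ x : 𝔤, x ≠ 0 → killingForm ℝ 𝔤 x x < 0) :
    LieAlgebra.IsKilling ℂ (Cx 𝔤) where
  killingCompl_top_eq_bot := by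
    have hanis : ∀ a : 𝔤, killingForm ℝ 𝔤 a a = 0 → a = 0 := fun a h =>
      by_contra fun h' => (hcompact a h').ne h
    rw [eq_bot_iff]
    intro x hx
    rw [LieIdeal.mem_killingCompl] at hx
    obtain ⟨a, b, rfl⟩ := Cx.exists_re_im x
    have key : ∀ c, killingForm ℝ 𝔤 c a = 0 ∧ killingForm ℝ 𝔤 c b = 0 := by
      intro c
      have h := hx (Cx.tmul 1 c) trivial
      have e : Cx.tmul Complex.I b = Complex.I • Cx.tmul 1 b := by
        rw [Cx.smul_tmul, mul_one]
      rw [e, map_add, map_smul, killingForm_tmul_one, killingForm_tmul_one] at h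
      have h1 := congrArg Complex.re h
      have h2 := congrArg Complex.im h
      simp at h1 h2
      exact ⟨h1, h2⟩
    rw [hanis a (key a).1, hanis b (key b).2]
    rw [LieSubmodule.mem_bot]
    have : ∀ z : ℂ, Cx.tmul z (0 : 𝔤) = 0 := fun z => TensorProduct.tmul_zero _ _
    rw [this, this, add_zero]

variable {𝔥 : LieSubalgebra ℝ 𝔤} [𝔥.IsCartanSubalgebra]

theorem exists_weight_of_mem_roots {α : Functional 𝔥} (hα : α ∈ roots 𝔥) :
    ∃ w : LieModule.Weight ℂ (complexify 𝔥) (Cx 𝔤), w.IsNonZero ∧ w.toLinear = α := by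
  classical
  obtain ⟨w, hw, rfl⟩ := Finset.mem_image.1 hα
  refine ⟨w, ?_, rfl⟩
  simpa using hw

theorem mem_roots_of_rootSpace_ne_bot {α : Functional 𝔥} (hα : α ≠ 0)
    (h : LieAlgebra.rootSpace (complexify 𝔥) (α : complexify 𝔥 → ℂ) ≠ ⊥) : α ∈ roots 𝔥 := by
  classical
  refine Finset.mem_image.2 ⟨⟨α, h⟩, ?_, rfl⟩
  simp only [LieSubalgebra.root, Finset.mem_filter, Finset.mem_univ, true_and]
  intro h0
  exact hα (LinearMap.ext fun x => congrFun h0 x)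

namespace ChevalleyBasis

variable (B : ChevalleyBasis 𝔥)

theorem τ_eq {α : Functional 𝔥} (hα : α ∈ roots 𝔥) :
    B.τ α = B.basis (Sum.inl ⟨α, hα⟩) := by
  rw [τ, rootVector, dif_pos hα]

theorem τ_ne_zero {α : Functional 𝔥} (hα : α ∈ roots 𝔥) : B.τ α ≠ 0 := by
  rw [B.τ_eq hα]
  exact B.basis.ne_zero _

theorem ne_zero_of_mem_roots (B : ChevalleyBasis 𝔥) {α : Functional 𝔥} (hα : α ∈ roots 𝔥) : α ≠ 0 := by
  rintro rfl
  simpa using B.apply_coroot 0 hα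

theorem zero_notMem_roots (B : ChevalleyBasis 𝔥) : (0 : Functional 𝔥) ∉ roots 𝔥 := fun h =>
  B.ne_zero_of_mem_roots h rfl

theorem coroot_neg {α : Functional 𝔥} (hα : α ∈ roots 𝔥) : B.coroot (-α) = -B.coroot α := by
  have h1 := B.lie_neg α hα
  have h2 := B.lie_neg (-α) (B.mem_roots_neg_iff.2 hα)
  rw [neg_neg, ← lie_skew, h1] at h2
  apply Subtype.ext
  simpa using (neg_injective h2).symm

theorem N_antisymm {α β : Functional 𝔥} (hα : α ∈ roots 𝔥) (hβ : β ∈ roots 𝔥) :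
    B.N α β = -B.N β α := by
  by_cases h : α + β ∈ roots 𝔥
  · have h0 := B.ne_zero_of_mem_roots h
    have h1 := B.lie_root α hα β hβ h0
    have h2 := B.lie_root β hβ α hα (by rwa [add_comm])
    rw [← lie_skew, h2, add_comm β α, ← neg_smul] at h1
    exact (smul_left_injective ℂ (B.τ_ne_zero h) h1).symm
  · rw [B.N_eq_zero _ _ h, B.N_eq_zero _ _ (by rwa [add_comm]), neg_zero]

/-- The Cartan component of the Jacobi identity for three roots with sum zero. -/
theorem N_jacobi (f : complexify 𝔥 →ₗ[ℂ] ℂ) {α β γ : Functional 𝔥} (hα : α ∈ roots 𝔥)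
    (hβ : β ∈ roots 𝔥) (hγ : γ ∈ roots 𝔥) (h : α + β + γ = 0) :
    B.N β γ * f (B.coroot α) + B.N γ α * f (B.coroot β) + B.N α β * f (B.coroot γ) = 0 := by
  have key : ∀ {α β γ : Functional 𝔥}, α ∈ roots 𝔥 → β ∈ roots 𝔥 → γ ∈ roots 𝔥 →
      α + β + γ = 0 → ⁅B.τ α, ⁅B.τ β, B.τ γ⁆⁆ = -(B.N β γ • (B.coroot α : Cx 𝔤)) := by
    intro α β γ hα hβ hγ h
    have e : β + γ = -α := by rw [eq_neg_iff_add_eq_zero, ← h]; abel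
    have h0 : β + γ ≠ 0 := by
      rw [e]; exact neg_ne_zero.2 (B.ne_zero_of_mem_roots hα)
    have h1 := B.lie_root β hβ γ hγ h0
    change ⁅B.τ β, B.τ γ⁆ = _ at h1
    rw [h1, lie_smul, e]
    have h2 := B.lie_neg α hα
    change ⁅B.τ α, _⁆ = _ at h2
    rw [h2, smul_neg]
  have hj := lie_jacobi (B.τ α) (B.τ β) (B.τ γ)
  rw [key hα hβ hγ h, key hβ hγ hα (by rw [← h]; abel), key hγ hα hβ (by rw [← h]; abel)] at hj
  have hj' : B.N β γ • B.coroot α + B.N γ α • B.coroot β + B.N α β • B.coroot γ = 0 := by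
    apply Subtype.ext
    change B.N β γ • (B.coroot α : Cx 𝔤) + B.N γ α • (B.coroot β : Cx 𝔤)
      + B.N α β • (B.coroot γ : Cx 𝔤) = 0
    rw [← neg_eq_zero, ← hj]
    abel
  have := congrArg f hj'
  simpa using this

theorem τ_mem_rootSpace {α : Functional 𝔥} (hα : α ∈ roots 𝔥) :
    B.τ α ∈ LieAlgebra.rootSpace (complexify 𝔥) (α : complexify 𝔥 → ℂ) := by
  refine LieModule.weightSpace_le_genWeightSpace _ _ ?_
  rw [LieModule.mem_weightSpace]
  intro h
  exact B.lie_cartan h α hα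

theorem neg_mem_pos_of_notMem {α : Functional 𝔥} (hα : α ∈ roots 𝔥) (h : α ∉ B.pos) :
    -α ∈ B.pos := ((B.mem_roots_iff α).1 hα).resolve_left h

/-- The weight `χ + 2ϱ` on the Cartan subalgebra. -/
def shifted (χ : Module.Dual ℂ (Cx 𝔤)) : complexify 𝔥 →ₗ[ℂ] ℂ :=
  χ ∘ₗ (complexify 𝔥).toSubmodule.subtype + B.twoRho

theorem r_of_pos (χ : Module.Dual ℂ (Cx 𝔤)) {α : Functional 𝔥} (hα : α ∈ B.pos) :
    B.r χ α = B.shifted χ (B.coroot α) := by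
  rw [r, if_pos hα, one_mul]
  rfl

/-- The sign factor and the coroot are both odd, so `r` is even. This is what lets the adjoints
below be stated uniformly for all roots rather than for positive ones only. -/
theorem r_neg (χ : Module.Dual ℂ (Cx 𝔤)) {α : Functional 𝔥} (hα : α ∈ roots 𝔥) :
    B.r χ (-α) = B.r χ α := by
  rw [r, r, B.coroot_neg hα]
  rcases (B.mem_roots_iff α).1 hα with h | h
  · rw [if_pos h, if_neg (B.neg_notMem_pos α h)]
    simp only [map_neg, NegMemClass.coe_neg]
    ring
  · rw [if_pos h, if_neg (by have := B.neg_notMem_pos _ h; rwa [neg_neg] at this)]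
    simp only [map_neg, NegMemClass.coe_neg]
    ring

variable [LieAlgebra.IsKilling ℂ (Cx 𝔤)]

theorem lie_cartan_cartan (x y : complexify 𝔥) : ⁅(x : Cx 𝔤), (y : Cx 𝔤)⁆ = 0 := by
  rw [← LieSubalgebra.coe_bracket, trivial_lie_zero]
  rfl

/-- The bracket of opposite root vectors lies in the coroot space, and the value $2$ of the root
singles out one point of it. The identification makes Mathlib's root strings available for
`B.coroot`. -/
theorem coroot_eq {α : Functional 𝔥} (hα : α ∈ roots 𝔥)
    (w : LieModule.Weight ℂ (complexify 𝔥) (Cx 𝔤)) (hw : w.toLinear = α) :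
    B.coroot α = LieAlgebra.IsKilling.coroot w := by
  subst hw
  have h1 := B.τ_mem_rootSpace hα
  have h2 := B.τ_mem_rootSpace (B.mem_roots_neg_iff.2 hα)
  have h3 := B.lie_neg _ hα
  refine LieAlgebra.IsKilling.eq_coroot_of_mem_corootSpace_of_two w ?_ (B.apply_coroot _ hα)
  refine (LieAlgebra.mem_corootSpace _).2 ?_
  rw [← neg_neg (B.coroot w.toLinear : Cx 𝔤), ← h3]
  exact neg_mem (Submodule.subset_span ⟨_, h1, _, h2, rfl⟩)

/-- The root string of `β` in the direction `α`. -/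
theorem exists_string {α β : Functional 𝔥} (hα : α ∈ roots 𝔥) (hβ : β ∈ roots 𝔥) :
    ∃ p q : ℕ, β (B.coroot α) = ((p : ℤ) - (q : ℤ) : ℤ) ∧
      ∀ n : ℤ, -p ≤ n → n ≤ q → n • α + β ≠ 0 → n • α + β ∈ roots 𝔥 := by
  obtain ⟨v, hv, rfl⟩ := exists_weight_of_mem_roots hα
  obtain ⟨w, hw, rfl⟩ := exists_weight_of_mem_roots hβ
  refine ⟨LieModule.chainBotCoeff v w, LieModule.chainTopCoeff v w, ?_, ?_⟩
  · rw [B.coroot_eq hα v rfl]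
    exact LieAlgebra.IsKilling.apply_coroot_eq_cast v w
  · intro n h1 h2 h0
    refine mem_roots_of_rootSpace_ne_bot h0 ?_
    exact (LieAlgebra.IsKilling.rootSpace_zsmul_add_ne_bot_iff v w hv n).2 ⟨h2, by omega⟩

/-- A root `β > 0` with `s_α β < 0`, `α > 0`, satisfies `β(H_α) ≥ 0`. -/
theorem apply_coroot_nonneg {α β : Functional 𝔥} (hα : α ∈ B.pos) (hβ : β ∈ B.pos)
    (h : β - β (B.coroot α) • α ∉ B.pos) : ∃ n : ℕ, β (B.coroot α) = n := by
  obtain ⟨p, q, h1, h2⟩ := B.exists_string (B.pos_subset hα) (B.pos_subset hβ)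
  rcases le_or_gt q p with hqp | hqp
  · refine ⟨p - q, ?_⟩
    rw [h1]
    push_cast [hqp]
    ring
  · exfalso
    apply h
    -- If $q>p$, adding $\alpha$ repeatedly to $\beta$ stays among the positive roots, because these
    -- are closed under sums that are roots. After $q-p=-\beta(H_\alpha)$ steps the string reaches
    -- the reflection of $\beta$, which was assumed not to be positive.
    have hstep : ∀ j : ℕ, j ≤ q → (j : ℤ) • α + β ∈ B.pos := by
      intro j
      induction j with
      | zero => intro _; simpa using hβ
      | succ j ih =>
        intro hj
        have h3 := ih (by omega)
        have e : ((j + 1 : ℕ) : ℤ) • α + β = α + ((j : ℤ) • α + β) := by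
          push_cast
          rw [add_smul, one_smul]
          abel
        rw [e]
        refine B.add_mem_pos _ hα _ h3 ?_
        have := h2 (j + 1 : ℕ) (by omega) (by omega) (by rw [e]; exact B.pos_add_ne hα h3)
        rwa [e] at this
    have h4 := hstep (q - p) (by omega)
    have e : β - β (B.coroot α) • α = ((q - p : ℕ) : ℤ) • α + β := by
      rw [h1, Int.cast_smul_eq_zsmul, sub_eq_add_neg, ← neg_smul, add_comm]
      congr 2
      omega
    rwa [e]

/-- The reflection $s_\alpha$ changes the sign of $\beta(H_\alpha)$ and permutes those positive
roots that it keeps positive, so their contributions cancel. Each remaining positive root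
contributes a natural number by `apply_coroot_nonneg`. No simple roots enter, and $\alpha$ is any
positive root. -/
theorem twoRho_coroot_nonneg {α : Functional 𝔥} (hα : α ∈ B.pos) :
    ∃ n : ℕ, B.twoRho (B.coroot α) = n := by
  classical
  set s : Functional 𝔥 → Functional 𝔥 := fun β => β - β (B.coroot α) • α with hs
  have hsc : ∀ β, s β (B.coroot α) = -β (B.coroot α) := by
    intro β
    simp only [hs, LinearMap.sub_apply, LinearMap.smul_apply, B.apply_coroot α (B.pos_subset hα),
      smul_eq_mul]
    ring
  have hss : ∀ β, s (s β) = β := by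
    intro β
    have : s (s β) = s β - s β (B.coroot α) • α := rfl
    rw [this, hsc]
    simp only [hs]
    module
  have hsum : B.twoRho (B.coroot α) = ∑ β ∈ B.pos, β (B.coroot α) := by
    simp [twoRho, LinearMap.sum_apply]
  rw [hsum, ← Finset.sum_filter_add_sum_filter_not B.pos (fun β => s β ∈ B.pos)]
  have h1 : ∑ β ∈ B.pos with s β ∈ B.pos, β (B.coroot α) = 0 := by
    have h2 : ∑ β ∈ B.pos with s β ∈ B.pos, β (B.coroot α)
        = ∑ β ∈ B.pos with s β ∈ B.pos, s β (B.coroot α) := by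
      refine Finset.sum_nbij' s s ?_ ?_ ?_ ?_ ?_
      · intro β hβ
        rw [Finset.mem_filter] at hβ ⊢
        exact ⟨hβ.2, by rw [hss]; exact hβ.1⟩
      · intro β hβ
        rw [Finset.mem_filter] at hβ ⊢
        exact ⟨hβ.2, by rw [hss]; exact hβ.1⟩
      · intro β _; exact hss β
      · intro β _; exact hss β
      · intro β _; rw [hss]
    simp only [hsc, Finset.sum_neg_distrib] at h2
    exact self_eq_neg.1 h2
  rw [h1, zero_add]
  have h3 : ∀ β ∈ B.pos.filter (fun β => s β ∉ B.pos), ∃ n : ℕ, β (B.coroot α) = n := by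
    intro β hβ
    rw [Finset.mem_filter] at hβ
    exact B.apply_coroot_nonneg hα hβ.1 hβ.2
  choose! n hn using h3
  refine ⟨∑ β ∈ B.pos with s β ∉ B.pos, n β, ?_⟩
  push_cast
  exact Finset.sum_congr rfl hn

/-- For positive roots, `r` is the positive number $\langle\chi,H_\alpha\rangle$ plus a natural
number; negative roots follow by evenness. The definiteness of the inner product rests on this. -/
theorem exists_r_eq {χ : Module.Dual ℂ (Cx 𝔤)} (hχ : B.IsRegularDominant χ)
    {α : Functional 𝔥} (hα : α ∈ roots 𝔥) : ∃ t : ℝ, 0 < t ∧ B.r χ α = t := by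
  have key : ∀ α ∈ B.pos, ∃ t : ℝ, 0 < t ∧ B.r χ α = t := by
    intro α hα
    obtain ⟨t, ht, h⟩ := hχ.pos_coroot α hα
    obtain ⟨n, hn⟩ := B.twoRho_coroot_nonneg hα
    refine ⟨t + n, by positivity, ?_⟩
    rw [r, if_pos hα, h, hn]
    simp
  by_cases h : α ∈ B.pos
  · exact key α h
  · obtain ⟨t, ht, h'⟩ := key _ (B.neg_mem_pos_of_notMem hα h)
    exact ⟨t, ht, by rw [← h', B.r_neg χ hα]⟩

end ChevalleyBasis
end RootTheory
end
end AnomalousBRST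

namespace AnomalousBRST
noncomputable section

/-! ### Cartan calculus for ghosts of a finite-dimensional complex Lie algebra. -/

section Weil

variable {ι : Type*} [Fintype ι] {L : Type*} [LieRing L] [LieAlgebra ℂ L]
  (e : Module.Basis ι ℂ L) {E : Type*} [Ring E] [Algebra ℂ E]

/-- Ghosts `C`, anti-ghosts `I` and a representation `R` of a Lie algebra commuting with them. -/
structure IsGhostSystem (C : Module.Dual ℂ L →ₗ[ℂ] E) (I R : L →ₗ[ℂ] E) : Prop where
  C_C : ∀ ξ η, C ξ * C η = -(C η * C ξ)
  I_I : ∀ x y, I x * I y = -(I y * I x)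
  I_C : ∀ x ξ, I x * C ξ = ξ x • 1 - C ξ * I x
  R_C : ∀ x ξ, R x * C ξ = C ξ * R x
  R_I : ∀ x y, R x * I y = I y * R x
  R_lie : ∀ x y, R ⁅x, y⁆ = R x * R y - R y * R x

variable (C : Module.Dual ℂ L →ₗ[ℂ] E) (I R : L →ₗ[ℂ] E)

/-- The Lie derivative on ghosts. -/
def lieGhost : L →ₗ[ℂ] E :=
  -∑ a, LinearMap.mulLeft ℂ (C (e.coord a)) ∘ₗ I ∘ₗ
    (LieModule.toEnd ℂ L L : L →ₗ[ℂ] Module.End ℂ L).flip (e a)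

theorem lieGhost_apply (x : L) :
    lieGhost e C I x = -∑ a, C (e.coord a) * I ⁅x, e a⁆ := by
  simp [lieGhost]

/-- The Chevalley-Eilenberg differential. -/
def chevalleyD : E := ∑ a, C (e.coord a) * (R (e a) + (1 / 2 : ℂ) • lieGhost e C I (e a))

theorem sum_coord_smul {M : Type*} [AddCommGroup M] [Module ℂ M] (F : L →ₗ[ℂ] M) (y : L) :
    ∑ a, e.coord a y • F (e a) = F y := by
  conv_rhs => rw [← e.sum_repr y, map_sum]
  simp

/-- The tensor $\sum_a e^a\otimes e_a$ is canonical: the transpose of `T` acting on the first factor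
equals `T` acting on the second. -/
theorem sum_C_comp (T F : L →ₗ[ℂ] L) (G : L →ₗ[ℂ] E) :
    ∑ a, C (e.coord a ∘ₗ T) * G (F (e a)) = ∑ a, C (e.coord a) * G (F (T (e a))) := by
  have h1 : ∀ ξ : Module.Dual ℂ L, ξ = ∑ c, ξ (e c) • e.coord c := by
    intro ξ
    refine e.ext fun d => ?_
    simp
  have h2 : ∀ a, C (e.coord a ∘ₗ T) * G (F (e a))
      = ∑ c, C (e.coord c) * (e.coord a (T (e c)) • (G ∘ₗ F) (e a)) := by
    intro a
    rw [h1 (e.coord a ∘ₗ T), map_sum, Finset.sum_mul]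
    simp
  rw [Finset.sum_congr rfl fun a _ => h2 a, Finset.sum_comm]
  refine Finset.sum_congr rfl fun c _ => ?_
  rw [← Finset.mul_sum, sum_coord_smul]
  rfl

namespace IsGhostSystem

variable {C I R} (h : IsGhostSystem C I R)
include h

/-- In the commutator of a bilinear $C\,I$ with a ghost only the contraction survives, which leaves
the coadjoint action. The analogous computation with an anti-ghost leaves the adjoint action. -/
theorem lieGhost_C (x : L) (ξ : Module.Dual ℂ L) :
    lieGhost e C I x * C ξ - C ξ * lieGhost e C I x
      = -C (ξ ∘ₗ LieModule.toEnd ℂ L L x) := by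
  have key : ∀ a, C (e.coord a) * I ⁅x, e a⁆ * C ξ - C ξ * (C (e.coord a) * I ⁅x, e a⁆)
      = ξ ⁅x, e a⁆ • C (e.coord a) := by
    intro a
    rw [mul_assoc, h.I_C, mul_sub, ← mul_assoc, ← mul_assoc, h.C_C ξ, neg_mul]
    simp
  have h1 : C (ξ ∘ₗ LieModule.toEnd ℂ L L x) = ∑ a, ξ ⁅x, e a⁆ • C (e.coord a) := by
    rw [← Finset.sum_congr rfl fun a _ => C.map_smul _ _, ← map_sum]
    congr 1
    refine e.ext fun d => ?_
    classical
    simp [Finsupp.single_apply]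
  rw [lieGhost_apply, neg_mul, mul_neg, Finset.sum_mul, Finset.mul_sum, h1,
    ← Finset.sum_congr rfl fun a _ => key a, Finset.sum_sub_distrib]
  abel

theorem lieGhost_I (x y : L) :
    lieGhost e C I x * I y - I y * lieGhost e C I x = I ⁅x, y⁆ := by
  have key : ∀ a, C (e.coord a) * I ⁅x, e a⁆ * I y - I y * (C (e.coord a) * I ⁅x, e a⁆)
      = -(e.coord a y • (I ∘ₗ LieModule.toEnd ℂ L L x) (e a)) := by
    intro a
    rw [mul_assoc, h.I_I, ← mul_assoc (I y), h.I_C, sub_mul, mul_neg, mul_assoc, smul_mul_assoc,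
      one_mul]
    simp only [LinearMap.comp_apply, LieModule.toEnd_apply_apply]
    abel
  have h1 := sum_coord_smul e (I ∘ₗ LieModule.toEnd ℂ L L x) y
  rw [lieGhost_apply, neg_mul, mul_neg, Finset.sum_mul, Finset.mul_sum, sub_neg_eq_add,
    neg_add_eq_sub, ← Finset.sum_sub_distrib]
  rw [show I ⁅x, y⁆ = (I ∘ₗ LieModule.toEnd ℂ L L x) y from rfl, ← h1]
  refine Finset.sum_congr rfl fun a _ => ?_
  rw [← neg_sub, key, neg_neg]

/-- The commutator with $\Lambda_x$ is a derivation, so it acts on each bilinear in $\Lambda_y$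
through its two factors. `sum_C_comp` moves the coadjoint part onto the anti-ghost, where the Jacobi
identity combines the two contributions. -/
theorem lieGhost_lieGhost (x y : L) :
    lieGhost e C I x * lieGhost e C I y - lieGhost e C I y * lieGhost e C I x
      = lieGhost e C I ⁅x, y⁆ := by
  set Λ := lieGhost e C I x with hΛ
  have key : ∀ a, Λ * (C (e.coord a) * I ⁅y, e a⁆) - C (e.coord a) * I ⁅y, e a⁆ * Λ
      = C (e.coord a) * I ⁅x, ⁅y, e a⁆⁆
        - C (e.coord a ∘ₗ LieModule.toEnd ℂ L L x) * I ⁅y, e a⁆ := by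
    intro a
    have h1 := h.lieGhost_C e x (e.coord a)
    have h2 := h.lieGhost_I e x ⁅y, e a⁆
    rw [sub_eq_iff_eq_add] at h1
    rw [← mul_assoc, h1, ← h2]
    noncomm_ring
  have h3 := sum_C_comp e C (LieModule.toEnd ℂ L L x) (LieModule.toEnd ℂ L L y) I
  simp only [LieModule.toEnd_apply_apply] at h3
  rw [lieGhost_apply, lieGhost_apply, mul_neg, neg_mul, Finset.sum_mul, Finset.mul_sum,
    sub_neg_eq_add, neg_add_eq_sub, ← neg_sub, ← Finset.sum_sub_distrib,
    Finset.sum_congr rfl fun a _ => key a, Finset.sum_sub_distrib, h3, ← Finset.sum_sub_distrib]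
  congr 1
  refine Finset.sum_congr rfl fun a _ => ?_
  rw [← mul_sub, ← map_sub, lie_lie]

/-- Cartan's formula. -/
theorem chevalleyD_I (y : L) :
    chevalleyD e C I R * I y + I y * chevalleyD e C I R = R y + lieGhost e C I y := by
  set Λ := lieGhost e C I with hΛ
  have key : ∀ a, C (e.coord a) * (R (e a) + (1 / 2 : ℂ) • Λ (e a)) * I y
      + I y * (C (e.coord a) * (R (e a) + (1 / 2 : ℂ) • Λ (e a)))
      = e.coord a y • (R + (1 / 2 : ℂ) • Λ) (e a) - (1 / 2 : ℂ) • (C (e.coord a) * I ⁅y, e a⁆) := by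
    intro a
    have h2 := h.lieGhost_I e (e a) y
    rw [sub_eq_iff_eq_add, ← hΛ] at h2
    rw [← mul_assoc (I y), h.I_C, mul_assoc, add_mul, h.R_I, smul_mul_assoc, h2,
      ← lie_skew y, map_neg]
    simp only [LinearMap.add_apply, LinearMap.smul_apply, sub_mul, mul_add, smul_add, smul_mul_assoc,
      one_mul, mul_smul_comm, mul_neg, smul_neg, mul_assoc]
    module
  rw [chevalleyD, Finset.sum_mul, Finset.mul_sum, ← Finset.sum_add_distrib,
    Finset.sum_congr rfl fun a _ => key a, Finset.sum_sub_distrib, sum_coord_smul,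
    ← Finset.smul_sum, ← neg_neg (∑ a, C (e.coord a) * I ⁅y, e a⁆), ← lieGhost_apply]
  simp only [LinearMap.add_apply, LinearMap.smul_apply]
  change _ - (1 / 2 : ℂ) • -Λ y = _
  module

/-- A cyclic permutation of three anticommuting ghosts is even, so averaging the cubic sum over
cyclic relabellings produces the Jacobi sum of the brackets, which vanishes. The three relabelled
sums are equal, hence each is zero. -/
theorem sum_C_C_lieGhost :
    ∑ a, ∑ c, C (e.coord a) * C (e.coord c) * lieGhost e C I ⁅e a, e c⁆ = 0 := by
  set t : ι → ι → ι → E := fun a c d =>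
    C (e.coord a) * C (e.coord c) * C (e.coord d) * I ⁅⁅e a, e c⁆, e d⁆ with ht
  have h1 : ∀ a c, C (e.coord a) * C (e.coord c) * lieGhost e C I ⁅e a, e c⁆
      = -∑ d, t a c d := by
    intro a c
    rw [lieGhost_apply, mul_neg, Finset.mul_sum]
    simp only [ht, mul_assoc]
  have h2 : ∀ a c d, t a c d + t c d a + t d a c = 0 := by
    intro a c d
    have e1 : C (e.coord c) * C (e.coord d) * C (e.coord a)
        = C (e.coord a) * C (e.coord c) * C (e.coord d) := by
      rw [mul_assoc, h.C_C (e.coord d), mul_neg, ← mul_assoc, h.C_C (e.coord c), neg_mul, neg_neg]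
    have e2 : C (e.coord d) * C (e.coord a) * C (e.coord c)
        = C (e.coord a) * C (e.coord c) * C (e.coord d) := by
      rw [h.C_C (e.coord d), neg_mul, mul_assoc, h.C_C (e.coord d), mul_neg, neg_neg, ← mul_assoc]
    simp only [ht, e1, e2]
    rw [← mul_add, ← mul_add, ← map_add, ← map_add]
    have := lie_jacobi (e d) (e a) (e c)
    rw [show ⁅⁅e a, e c⁆, e d⁆ + ⁅⁅e c, e d⁆, e a⁆ + ⁅⁅e d, e a⁆, e c⁆ = 0 by
      rw [← lie_skew (e d) ⁅e a, e c⁆, ← lie_skew (e a) ⁅e c, e d⁆, ← lie_skew (e c) ⁅e d, e a⁆,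
        ← neg_add, ← neg_add, neg_eq_zero] at this
      exact this,
      map_zero, mul_zero]
  have h3 : ∑ a, ∑ c, ∑ d, t a c d = ∑ a, ∑ c, ∑ d, t c d a := by
    conv_rhs => rw [Finset.sum_comm]
    exact Finset.sum_congr rfl fun a _ => Finset.sum_comm
  have h4 : ∑ a, ∑ c, ∑ d, t a c d = ∑ a, ∑ c, ∑ d, t d a c := by
    conv_rhs => rw [Finset.sum_congr rfl fun a _ => Finset.sum_comm, Finset.sum_comm]
  have h5 : ∑ a, ∑ c, ∑ d, t a c d + ∑ a, ∑ c, ∑ d, t c d a + ∑ a, ∑ c, ∑ d, t d a c = 0 := by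
    simp only [← Finset.sum_add_distrib, h2, Finset.sum_const_zero]
  rw [← h3, ← h4] at h5
  have h6 : (3 : ℂ) • ∑ a, ∑ c, ∑ d, t a c d = 0 := by
    rw [← h5]; module
  simp only [h1, Finset.sum_neg_distrib, neg_eq_zero]
  exact (smul_eq_zero.1 h6).resolve_left (by norm_num)

/-- With $X=R+\tfrac12\Lambda$ the differential is $\sum_aC_aX_a$. Its square, antisymmetrized in
the two ghosts, involves only the failure of $X$ to be a representation. That failure is a multiple
of $\Lambda_{[x,y]}$ and is removed by `sum_C_C_lieGhost`. -/
theorem chevalleyD_sq : chevalleyD e C I R * chevalleyD e C I R = 0 := by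
  set X : L →ₗ[ℂ] E := R + (1 / 2 : ℂ) • lieGhost e C I with hX
  have hD : chevalleyD e C I R = ∑ a, C (e.coord a) * X (e a) := rfl
  have hXC : ∀ x ξ, X x * C ξ = C ξ * X x - (1 / 2 : ℂ) • C (ξ ∘ₗ LieModule.toEnd ℂ L L x) := by
    intro x ξ
    have := h.lieGhost_C e x ξ
    rw [sub_eq_iff_eq_add] at this
    simp only [hX, LinearMap.add_apply, LinearMap.smul_apply, add_mul, mul_add, smul_mul_assoc,
      mul_smul_comm, this, h.R_C]
    module
  have hLR : ∀ x y, lieGhost e C I x * R y = R y * lieGhost e C I x := by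
    intro x y
    rw [lieGhost_apply, neg_mul, mul_neg, Finset.sum_mul, Finset.mul_sum]
    congr 1
    refine Finset.sum_congr rfl fun a _ => ?_
    rw [mul_assoc, ← h.R_I, ← mul_assoc, ← mul_assoc, h.R_C]
  -- The square of the factor $\tfrac12$ produces $\tfrac14\Lambda_{[x,y]}$ where a representation
  -- would need $\tfrac12\Lambda_{[x,y]}$.
  have hXX : ∀ x y, X x * X y - X y * X x - X ⁅x, y⁆ = -(1 / 4 : ℂ) • lieGhost e C I ⁅x, y⁆ := by
    intro x y
    rw [hX]
    simp only [LinearMap.add_apply, LinearMap.smul_apply, h.R_lie, ← h.lieGhost_lieGhost e x y,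
      add_mul, mul_add, smul_mul_assoc, mul_smul_comm, hLR]
    module
  have h1 : chevalleyD e C I R * chevalleyD e C I R
      = ∑ a, ∑ c, C (e.coord a) * C (e.coord c) * (X (e a) * X (e c) - (1 / 2 : ℂ) • X ⁅e a, e c⁆) := by
    rw [hD, Finset.sum_mul]
    refine Finset.sum_congr rfl fun a _ => ?_
    rw [Finset.mul_sum]
    have e1 : ∀ c, C (e.coord a) * X (e a) * (C (e.coord c) * X (e c))
        = C (e.coord a) * C (e.coord c) * (X (e a) * X (e c))
          - (1 / 2 : ℂ) • (C (e.coord a) *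
            (C (e.coord c ∘ₗ LieModule.toEnd ℂ L L (e a)) * X (LinearMap.id (R := ℂ) (e c)))) := by
      intro c
      rw [mul_assoc, ← mul_assoc (X (e a)), hXC, sub_mul, mul_sub]
      simp only [smul_mul_assoc, mul_smul_comm, mul_assoc, LinearMap.id_apply]
    rw [Finset.sum_congr rfl fun c _ => e1 c, Finset.sum_sub_distrib, ← Finset.smul_sum,
      ← Finset.mul_sum, sum_C_comp e C, Finset.mul_sum, Finset.smul_sum, ← Finset.sum_sub_distrib]
    refine Finset.sum_congr rfl fun c _ => ?_
    simp only [LinearMap.id_apply, LieModule.toEnd_apply_apply, mul_sub, mul_smul_comm, mul_assoc]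
  have h2 : ∑ a, ∑ c, C (e.coord a) * C (e.coord c) * (X (e a) * X (e c) - (1 / 2 : ℂ) • X ⁅e a, e c⁆)
      = -∑ a, ∑ c, C (e.coord a) * C (e.coord c) *
        (X (e c) * X (e a) + (1 / 2 : ℂ) • X ⁅e a, e c⁆) := by
    rw [Finset.sum_comm, ← Finset.sum_neg_distrib]
    refine Finset.sum_congr rfl fun a _ => ?_
    rw [← Finset.sum_neg_distrib]
    refine Finset.sum_congr rfl fun c _ => ?_
    rw [h.C_C, ← lie_skew (e c), map_neg, smul_neg, sub_neg_eq_add, neg_mul]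
  -- Adding the square to its copy with the summation indices exchanged turns the product $X_aX_c$
  -- into a commutator.
  have h3 : (2 : ℂ) • (chevalleyD e C I R * chevalleyD e C I R) = 0 := by
    rw [two_smul]
    nth_rewrite 2 [h1]
    rw [h2, h1, ← sub_eq_add_neg, ← Finset.sum_sub_distrib]
    simp only [← Finset.sum_sub_distrib, ← mul_sub]
    have e2 : ∀ a c, X (e a) * X (e c) - (1 / 2 : ℂ) • X ⁅e a, e c⁆
        - (X (e c) * X (e a) + (1 / 2 : ℂ) • X ⁅e a, e c⁆)
        = -(1 / 4 : ℂ) • lieGhost e C I ⁅e a, e c⁆ := by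
      intro a c
      rw [← hXX]
      module
    simp only [e2, mul_smul_comm, ← Finset.smul_sum, h.sum_C_C_lieGhost, smul_zero]
  exact (smul_eq_zero.1 h3).resolve_left two_ne_zero

/-- The square of the differential twisted by a linear functional. -/
theorem twisted_sq (ξ : Module.Dual ℂ L) :
    (chevalleyD e C I R - C ξ) * (chevalleyD e C I R - C ξ)
      = (1 / 2 : ℂ) • ∑ a, ∑ c, ξ ⁅e a, e c⁆ • (C (e.coord a) * C (e.coord c)) := by
  have hsq : C ξ * C ξ = 0 := by
    have := h.C_C ξ ξ
    rw [eq_neg_iff_add_eq_zero, ← two_smul ℂ] at this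
    exact (smul_eq_zero.1 this).resolve_left two_ne_zero
  have key : ∀ a, C (e.coord a) * (R (e a) + (1 / 2 : ℂ) • lieGhost e C I (e a)) * C ξ
      + C ξ * (C (e.coord a) * (R (e a) + (1 / 2 : ℂ) • lieGhost e C I (e a)))
      = -(1 / 2 : ℂ) • ∑ c, ξ ⁅e a, e c⁆ • (C (e.coord a) * C (e.coord c)) := by
    intro a
    have h1 := h.lieGhost_C e (e a) ξ
    rw [sub_eq_iff_eq_add] at h1
    have h2 : C (ξ ∘ₗ LieModule.toEnd ℂ L L (e a)) = ∑ c, ξ ⁅e a, e c⁆ • C (e.coord c) := by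
      rw [← Finset.sum_congr rfl fun a _ => C.map_smul _ _, ← map_sum]
      congr 1
      refine e.ext fun d => ?_
      classical
      simp [Finsupp.single_apply]
    rw [h2] at h1
    have h3 : ∑ c, ξ ⁅e a, e c⁆ • (C (e.coord a) * C (e.coord c))
        = C (e.coord a) * ∑ c, ξ ⁅e a, e c⁆ • C (e.coord c) := by
      rw [Finset.mul_sum]
      simp only [mul_smul_comm]
    rw [h3, ← mul_assoc (C ξ), h.C_C ξ, mul_assoc, add_mul, h.R_C, smul_mul_assoc, h1]
    simp only [mul_add, smul_add, mul_smul_comm, mul_neg, smul_neg, neg_mul, mul_assoc, neg_smul]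
    abel
  -- Both the differential and the ghost $C_\xi$ square to zero, so the twisted square is minus
  -- their anticommutator, that is, minus the differential of $\xi$.
  have h4 : chevalleyD e C I R * C ξ + C ξ * chevalleyD e C I R
      = -(1 / 2 : ℂ) • ∑ a, ∑ c, ξ ⁅e a, e c⁆ • (C (e.coord a) * C (e.coord c)) := by
    rw [chevalleyD, Finset.sum_mul, Finset.mul_sum, ← Finset.sum_add_distrib,
      Finset.sum_congr rfl fun a _ => key a, Finset.smul_sum]
  rw [sub_mul, mul_sub, mul_sub, h.chevalleyD_sq, hsq, zero_sub, sub_zero, ← neg_add', h4,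
    neg_smul, neg_neg]

end IsGhostSystem
end Weil
end
end AnomalousBRST

namespace AnomalousBRST
noncomputable section

/-! ### Ghost operators and the representation as commuting algebras on $\mathcal C\otimes V$. -/

section TensorOperators

variable {𝔤 : Type*} [LieRing 𝔤] [LieAlgebra ℝ 𝔤]
  {V : Type*} [NormedAddCommGroup V] [InnerProductSpace ℂ V]

/-- `A ↦ A ⊗ 1` as an algebra homomorphism. -/
def onVHom (𝔤 : Type*) [LieRing 𝔤] [LieAlgebra ℝ 𝔤] (V : Type*) [NormedAddCommGroup V]
    [InnerProductSpace ℂ V] :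
    Module.End ℂ (Ghost 𝔤) →ₐ[ℂ] Module.End ℂ (GhostV 𝔤 V) :=
  Module.End.rTensorAlgHom ℂ (Ghost 𝔤) V

/-- `T ↦ 1 ⊗ T` as an algebra homomorphism. -/
def opV (𝔤 : Type*) [LieRing 𝔤] [LieAlgebra ℝ 𝔤] (V : Type*) [NormedAddCommGroup V]
    [InnerProductSpace ℂ V] :
    Module.End ℂ V →ₐ[ℂ] Module.End ℂ (GhostV 𝔤 V) :=
  Module.End.lTensorAlgHom ℂ V (Ghost 𝔤)

theorem onV_eq (A : Module.End ℂ (Ghost 𝔤)) : onV V A = onVHom 𝔤 V A := rfl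

theorem tensorOp_eq (A : Module.End ℂ (Ghost 𝔤)) (T : Module.End ℂ V) :
    tensorOp A T = onVHom 𝔤 V A * opV 𝔤 V T :=
  TensorProduct.ext' fun _ _ => rfl

theorem tensorOp_one (T : Module.End ℂ V) : tensorOp (1 : Module.End ℂ (Ghost 𝔤)) T = opV 𝔤 V T :=
  rfl

theorem opV_onVHom (A : Module.End ℂ (Ghost 𝔤)) (T : Module.End ℂ V) :
    opV 𝔤 V T * onVHom 𝔤 V A = onVHom 𝔤 V A * opV 𝔤 V T :=
  TensorProduct.ext' fun _ _ => rfl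

/-- Exterior multiplication, as a linear map. -/
def wedgeHom (𝔤 : Type*) [LieRing 𝔤] [LieAlgebra ℝ 𝔤] :
    Module.Dual ℂ (Cx 𝔤) →ₗ[ℂ] Module.End ℂ (Ghost 𝔤) :=
  LinearMap.mul ℂ (Ghost 𝔤) ∘ₗ ExteriorAlgebra.ι ℂ

/-- Substitution, as a linear map. -/
def substHom (𝔤 : Type*) [LieRing 𝔤] [LieAlgebra ℝ 𝔤] : Cx 𝔤 →ₗ[ℂ] Module.End ℂ (Ghost 𝔤) :=
  CliffordAlgebra.contractLeft ∘ₗ Module.Dual.eval ℂ (Cx 𝔤)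

theorem ghost_neg_mul (A A' : Module.End ℂ (Ghost 𝔤)) : -A * A' = -(A * A') := neg_mul A A'

theorem ghost_mul_neg (A A' : Module.End ℂ (Ghost 𝔤)) : A * -A' = -(A * A') := mul_neg A A'

theorem wedgeHom_apply (ξ : Module.Dual ℂ (Cx 𝔤)) : wedgeHom 𝔤 ξ = wedge ξ := rfl

theorem substHom_apply (x : Cx 𝔤) : substHom 𝔤 x = subst x := rfl

theorem subst_neg (x : Cx 𝔤) : subst (-x) = -subst x := (substHom 𝔤).map_neg x

theorem subst_smul (z : ℂ) (x : Cx 𝔤) : subst (z • x) = z • subst x := (substHom 𝔤).map_smul z x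

theorem wedge_neg (ξ : Module.Dual ℂ (Cx 𝔤)) : wedge (-ξ) = -wedge ξ := (wedgeHom 𝔤).map_neg ξ

theorem wedge_smul (z : ℂ) (ξ : Module.Dual ℂ (Cx 𝔤)) : wedge (z • ξ) = z • wedge ξ :=
  (wedgeHom 𝔤).map_smul z ξ

theorem wedge_sum {ι : Type*} (s : Finset ι) (ξ : ι → Module.Dual ℂ (Cx 𝔤)) :
    wedge (∑ i ∈ s, ξ i) = ∑ i ∈ s, wedge (ξ i) := map_sum (wedgeHom 𝔤) ξ s

theorem isGhostSystem_ghost : IsGhostSystem (wedgeHom 𝔤) (substHom 𝔤) 0 where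
  C_C ξ η := eq_neg_of_add_eq_zero_left (wedge_wedge ξ η)
  I_I x y := eq_neg_of_add_eq_zero_left (subst_subst x y)
  I_C x ξ := eq_sub_of_add_eq (subst_wedge x ξ)
  R_C := by simp
  R_I := by simp
  R_lie := by simp

theorem complexRep_tmul (ρ : 𝔤 →ₗ[ℝ] Module.End ℂ V) (z : ℂ) (x : 𝔤) :
    complexRep ρ (Cx.tmul z x) = z • ρ x := by
  change LinearMap.liftBaseChange ℂ ρ (z ⊗ₜ x) = _
  rw [LinearMap.liftBaseChange_tmul]

theorem complexRep_lie (ρ : 𝔤 →ₗ[ℝ] Module.End ℂ V)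
    (hρ : ∀ x y : 𝔤, ρ ⁅x, y⁆ = ρ x * ρ y - ρ y * ρ x) (x y : Cx 𝔤) :
    complexRep ρ ⁅x, y⁆ = complexRep ρ x * complexRep ρ y - complexRep ρ y * complexRep ρ x := by
  obtain ⟨a, b, rfl⟩ := Cx.exists_re_im x
  obtain ⟨c, d, rfl⟩ := Cx.exists_re_im y
  simp only [add_lie, lie_add, Cx.lie_tmul, map_add, complexRep_tmul, hρ, one_mul, mul_one, one_smul,
    mul_add, add_mul, smul_mul_assoc, mul_smul_comm]
  module

/-- Ghosts on `𝒞(V)`. -/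
abbrev totalC (𝔤 : Type*) [LieRing 𝔤] [LieAlgebra ℝ 𝔤] (V : Type*) [NormedAddCommGroup V]
    [InnerProductSpace ℂ V] : Module.Dual ℂ (Cx 𝔤) →ₗ[ℂ] Module.End ℂ (GhostV 𝔤 V) :=
  (onVHom 𝔤 V).toLinearMap ∘ₗ wedgeHom 𝔤

/-- Anti-ghosts on `𝒞(V)`. -/
abbrev totalI (𝔤 : Type*) [LieRing 𝔤] [LieAlgebra ℝ 𝔤] (V : Type*) [NormedAddCommGroup V]
    [InnerProductSpace ℂ V] : Cx 𝔤 →ₗ[ℂ] Module.End ℂ (GhostV 𝔤 V) :=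
  (onVHom 𝔤 V).toLinearMap ∘ₗ substHom 𝔤

/-- The representation on `𝒞(V)`. -/
abbrev totalR (ρ : 𝔤 →ₗ[ℝ] Module.End ℂ V) : Cx 𝔤 →ₗ[ℂ] Module.End ℂ (GhostV 𝔤 V) :=
  (opV 𝔤 V).toLinearMap ∘ₗ complexRep ρ

theorem isGhostSystem_total (ρ : 𝔤 →ₗ[ℝ] Module.End ℂ V)
    (hρ : ∀ x y : 𝔤, ρ ⁅x, y⁆ = ρ x * ρ y - ρ y * ρ x) :
    IsGhostSystem (totalC 𝔤 V) (totalI 𝔤 V) (totalR ρ) where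
  C_C ξ η := by simpa using congrArg (onVHom 𝔤 V) (isGhostSystem_ghost.C_C ξ η)
  I_I x y := by simpa using congrArg (onVHom 𝔤 V) (isGhostSystem_ghost.I_I x y)
  I_C x ξ := by simpa using congrArg (onVHom 𝔤 V) (isGhostSystem_ghost.I_C x ξ)
  R_C x ξ := opV_onVHom _ _
  R_I x y := opV_onVHom _ _
  R_lie x y := by simp [complexRep_lie ρ hρ]

theorem onVHom_lieGhost {ι : Type*} [Fintype ι] (e : Module.Basis ι ℂ (Cx 𝔤)) (x : Cx 𝔤) :
    onVHom 𝔤 V (lieGhost e (wedgeHom 𝔤) (substHom 𝔤) x)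
      = lieGhost e (totalC 𝔤 V) (totalI 𝔤 V) x := by
  simp [lieGhost_apply]

end TensorOperators

namespace ChevalleyBasis

/-! ### Normal ordering of the ghost operators in a Chevalley basis. -/

section GhostLie

variable {𝔤 : Type*} [LieRing 𝔤] [LieAlgebra ℝ 𝔤] [FiniteDimensional ℝ 𝔤]
  {𝔥 : LieSubalgebra ℝ 𝔤} [𝔥.IsCartanSubalgebra] (B : ChevalleyBasis 𝔥)

theorem sum_idx {M : Type*} [AddCommMonoid M] (f : Idx 𝔥 → M) (F : Functional 𝔥 → M)
    (hF : ∀ a : {α // α ∈ roots 𝔥}, f (Sum.inl a) = F a) :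
    ∑ a, f a = ∑ α ∈ roots 𝔥, F α + ∑ i, f (Sum.inr i) := by
  rw [Fintype.sum_sum_type, Finset.sum_congr rfl fun a _ => hF a, Finset.sum_coe_sort]

theorem sum_roots (B : ChevalleyBasis 𝔥) {M : Type*} [AddCommMonoid M] (F : Functional 𝔥 → M) :
    ∑ α ∈ roots 𝔥, F α = ∑ α ∈ B.pos, F α + ∑ α ∈ B.pos, F (-α) := by
  classical
  have h1 : roots 𝔥 = B.pos ∪ B.pos.image Neg.neg := by
    ext α
    rw [B.mem_roots_iff, Finset.mem_union, Finset.mem_image]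
    refine or_congr_right ⟨fun h => ⟨_, h, neg_neg α⟩, ?_⟩
    rintro ⟨β, hβ, rfl⟩
    rwa [neg_neg]
  rw [h1, Finset.sum_union, Finset.sum_image fun _ _ _ _ h => neg_injective h]
  rw [Finset.disjoint_left]
  intro α hα h
  obtain ⟨β, hβ, rfl⟩ := Finset.mem_image.1 h
  exact B.neg_notMem_pos β hβ hα

theorem coord_inl (a : {α // α ∈ roots 𝔥}) : B.basis.coord (Sum.inl a) = B.θ a := by
  rw [θ, dif_pos a.2]

theorem basis_inl (a : {α // α ∈ roots 𝔥}) : B.basis (Sum.inl a) = B.τ a := by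
  rw [B.τ_eq a.2]

theorem lie_τ_cartan {α : Functional 𝔥} (hα : α ∈ roots 𝔥) (h : complexify 𝔥) :
    ⁅B.τ α, (h : Cx 𝔤)⁆ = -(α h • B.τ α) := by
  rw [← lie_skew]
  exact congrArg Neg.neg (B.lie_cartan h α hα)

theorem cartan_sum (h : complexify 𝔥) :
    (h : Cx 𝔤) = ∑ i, B.cartan.repr h i • B.basis (Sum.inr i) := by
  conv_lhs => rw [← B.cartan.sum_repr h]
  simp only [B.basis_inr]
  exact AddSubmonoidClass.coe_finsetSum _ _

theorem subst_cartan (h : complexify 𝔥) : subst (h : Cx 𝔤) = ∑ i, B.cartan.repr h i • B.bH i := by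
  rw [← substHom_apply]
  conv_lhs => rw [B.cartan_sum h]
  rw [map_sum]
  simp only [LinearMap.map_smul, substHom_apply]
  rfl

/-- The three sums in `ghostL` are the brackets of $\tau_\alpha$ with root vectors not opposite to
it, with $\tau_{-\alpha}$, and with the $H_i$. The index $\beta=-\alpha$ contributes nothing to the
first sum, since $0$ is not a root and $N$ vanishes there. -/
theorem ghostL_eq {α : Functional 𝔥} (hα : α ∈ roots 𝔥) :
    B.ghostL α = lieGhost B.basis (wedgeHom 𝔤) (substHom 𝔤) (B.τ α) := by
  classical
  have key : ∀ β ∈ roots 𝔥, B.c (-β) * subst ⁅B.τ α, B.τ β⁆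
      = B.N α β • (B.c (-β) * B.b (α + β))
        - if β = -α then ∑ i, B.cartan.repr (B.coroot α) i • (B.c α * B.bH i) else 0 := by
    intro β hβ
    split_ifs with h
    · subst h
      have h1 := B.lie_neg α hα
      change ⁅B.τ α, B.τ (-α)⁆ = _ at h1
      rw [h1, B.N_eq_zero α (-α) (by rw [add_neg_cancel]; exact B.zero_notMem_roots), zero_smul,
        zero_sub, neg_neg, subst_neg, B.subst_cartan, ghost_mul_neg,
        Finset.mul_sum]
      simp only [mul_smul_comm]
    · have h1 := B.lie_root α hα β hβ (fun e => h (eq_neg_of_add_eq_zero_right e))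
      change ⁅B.τ α, B.τ β⁆ = B.N α β • B.τ (α + β) at h1
      rw [h1, subst_smul, mul_smul_comm, sub_zero]
      rfl
  rw [lieGhost_apply, sum_idx _ (fun β => B.c (-β) * subst ⁅B.τ α, B.τ β⁆) ?_]
  · rw [Finset.sum_congr rfl key, Finset.sum_sub_distrib, Finset.sum_ite_eq',
      if_pos (B.mem_roots_neg_iff.2 hα)]
    have h2 : ∀ i, wedgeHom 𝔤 (B.basis.coord (Sum.inr i)) * substHom 𝔤 ⁅B.τ α, B.basis (Sum.inr i)⁆
        = -(α (B.cartan i) • (B.cH i * B.b α)) := by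
      intro i
      rw [B.basis_inr, B.lie_τ_cartan hα, substHom_apply, subst_neg, subst_smul, ghost_mul_neg,
        mul_smul_comm]
      rfl
    rw [Finset.sum_congr rfl fun i _ => h2 i, Finset.sum_neg_distrib, ghostL]
    abel
  · intro a
    rw [B.coord_inl, B.basis_inl, c, neg_neg]
    rfl

theorem lieGhost_cartan [LieAlgebra.IsKilling ℂ (Cx 𝔤)] (h : complexify 𝔥) :
    lieGhost B.basis (wedgeHom 𝔤) (substHom 𝔤) (h : Cx 𝔤)
      = -∑ β ∈ roots 𝔥, β h • (B.c (-β) * B.b β) := by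
  rw [lieGhost_apply, sum_idx _ (fun β => B.c (-β) * subst ⁅(h : Cx 𝔤), B.τ β⁆) ?_]
  · have h1 : ∀ i, wedgeHom 𝔤 (B.basis.coord (Sum.inr i)) * substHom 𝔤 ⁅(h : Cx 𝔤), B.basis (Sum.inr i)⁆
        = 0 := by
      intro i
      rw [B.basis_inr, lie_cartan_cartan, map_zero, mul_zero]
    rw [Finset.sum_congr rfl fun i _ => h1 i, Finset.sum_const_zero, add_zero]
    congr 1
    refine Finset.sum_congr rfl fun β hβ => ?_
    have h2 := B.lie_cartan h β hβ
    change ⁅(h : Cx 𝔤), B.τ β⁆ = β h • B.τ β at h2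
    rw [h2, subst_smul, mul_smul_comm]
    rfl
  · intro a
    rw [B.coord_inl, B.basis_inl, c, neg_neg]
    rfl

theorem b_neg_c {α : Functional 𝔥} (hα : α ∈ roots 𝔥) :
    B.b (-α) * B.c α = 1 - B.c α * B.b (-α) := by
  have := B.b_c_self (B.mem_roots_neg_iff.2 hα)
  rwa [neg_neg] at this

/-- Reordering each $b_{-\beta}c^\beta$ with $\beta>0$ leaves a constant $\beta(H)$; together these
constants make up $2\varrho(H)$. -/
theorem ghostLH_eq [LieAlgebra.IsKilling ℂ (Cx 𝔤)] (h : complexify 𝔥) :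
    B.ghostLH h = lieGhost B.basis (wedgeHom 𝔤) (substHom 𝔤) (h : Cx 𝔤) - B.twoRho h • 1 := by
  have h1 : ∀ β ∈ B.pos, β h • (B.b (-β) * B.c β) = β h • (1 : Module.End ℂ (Ghost 𝔤))
      + (-β) h • (B.c (- -β) * B.b (-β)) := by
    intro β hβ
    rw [B.b_neg_c (B.pos_subset hβ), neg_neg, LinearMap.neg_apply]
    module
  rw [B.lieGhost_cartan, B.sum_roots, ghostLH, Finset.sum_congr rfl h1, Finset.sum_add_distrib,
    ← Finset.sum_smul, twoRho, LinearMap.sum_apply]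
  abel

/-- `2ϱ` extended by zero to the root vectors. -/
def rhoForm : Module.Dual ℂ (Cx 𝔤) := ∑ i, B.twoRho (B.cartan i) • B.θH i

/-- Among the basis vectors only those of the Cartan subalgebra are sent by
$\operatorname{ad}\tau_\alpha$ to something with a $\tau_\alpha$ component. The result is the
anomalous term that appears when $L_{-\alpha}$ is moved past $c^\alpha$. -/
theorem coord_comp_ad {α : Functional 𝔥} (hα : α ∈ roots 𝔥) :
    B.θ α ∘ₗ LieModule.toEnd ℂ (Cx 𝔤) (Cx 𝔤) (B.τ α) = -∑ i, α (B.cartan i) • B.θH i := by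
  classical
  refine B.basis.ext fun a => ?_
  rw [LinearMap.comp_apply, LieModule.toEnd_apply_apply]
  rcases a with a | i
  · have h0 : (-∑ i, α (B.cartan i) • B.θH i) (B.basis (Sum.inl a)) = 0 := by
      simp [θH]
    rw [h0, B.basis_inl]
    by_cases h : α + a = 0
    · have e : (a : Functional 𝔥) = -α := eq_neg_of_add_eq_zero_right h
      rw [e]
      have h1 := B.lie_neg α hα
      change ⁅B.τ α, B.τ (-α)⁆ = _ at h1
      rw [h1, map_neg, B.cartan_sum, θ, dif_pos hα]
      simp
    · have h1 := B.lie_root α hα a a.2 h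
      change ⁅B.τ α, B.τ a⁆ = B.N α a • B.τ (α + a) at h1
      rw [h1, map_smul]
      by_cases h2 : α + a ∈ roots 𝔥
      · rw [B.θ_τ hα h2, if_neg, smul_zero]
        intro e
        exact B.ne_zero_of_mem_roots a.2 (left_eq_add.1 e)
      · rw [B.N_eq_zero _ _ h2, zero_smul]
  · rw [B.basis_inr, B.lie_τ_cartan hα, map_neg, map_smul, B.θ_τ hα hα, if_pos rfl,
      ← B.basis_inr]
    simp [θH, Finsupp.single_apply]

theorem chevalleyD_ghost : chevalleyD B.basis (wedgeHom 𝔤) (substHom 𝔤) 0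
    = (1 / 2 : ℂ) • ∑ α ∈ roots 𝔥, B.c (-α) * lieGhost B.basis (wedgeHom 𝔤) (substHom 𝔤) (B.τ α)
      + (1 / 2 : ℂ) • ∑ i, B.cH i * lieGhost B.basis (wedgeHom 𝔤) (substHom 𝔤) (B.cartan i) := by
  rw [chevalleyD, sum_idx _ (fun α => (1 / 2 : ℂ) • (B.c (-α) * lieGhost B.basis (wedgeHom 𝔤) (substHom 𝔤) (B.τ α))), Finset.smul_sum,
    Finset.smul_sum]
  · congr 1
    refine Finset.sum_congr rfl fun i _ => ?_
    rw [LinearMap.zero_apply, zero_add, mul_smul_comm, B.basis_inr]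
    rfl
  · intro a
    rw [B.coord_inl, B.basis_inl, c, neg_neg, LinearMap.zero_apply, zero_add, mul_smul_comm]
    rfl

theorem sum_cH_ghostLH [LieAlgebra.IsKilling ℂ (Cx 𝔤)] : ∑ i, B.cH i * B.ghostLH (B.cartan i)
    = ∑ i, B.cH i * lieGhost B.basis (wedgeHom 𝔤) (substHom 𝔤) (B.cartan i) - wedge B.rhoForm := by
  have h6 : ∀ i, B.cH i * B.ghostLH (B.cartan i)
      = B.cH i * lieGhost B.basis (wedgeHom 𝔤) (substHom 𝔤) (B.cartan i) - B.twoRho (B.cartan i) • B.cH i := by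
    intro i
    rw [B.ghostLH_eq, mul_sub, mul_smul_comm, mul_one]
  rw [Finset.sum_congr rfl fun i _ => h6 i, Finset.sum_sub_distrib, rhoForm, wedge_sum]
  simp only [wedge_smul]
  rfl

/-- The shift has two equal halves: one from reordering $L_{-\alpha}c^\alpha$ over the positive
roots, the other from the constants in the normally ordered $L_{H_i}$. -/
theorem ghostD_eq [LieAlgebra.IsKilling ℂ (Cx 𝔤)] :
    B.ghostD = chevalleyD B.basis (wedgeHom 𝔤) (substHom 𝔤) 0 - wedge B.rhoForm := by
  set Λ := lieGhost B.basis (wedgeHom 𝔤) (substHom 𝔤) with hΛ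
  have h2 : ∀ α ∈ B.pos, B.ghostL (-α) * B.c α
      = B.c (- -α) * Λ (B.τ (-α)) - ∑ i, α (B.cartan i) • B.cH i := by
    intro α hα
    rw [B.ghostL_eq (B.neg_mem_roots hα), ← hΛ, neg_neg]
    have h3 := isGhostSystem_ghost.lieGhost_C B.basis (B.τ (-α)) (B.θ (-α))
    rw [B.coord_comp_ad (B.neg_mem_roots hα), ← hΛ] at h3
    simp only [wedgeHom_apply, wedge_sum, wedge_smul, LinearMap.neg_apply, neg_smul,
      Finset.sum_neg_distrib, neg_neg] at h3
    rw [sub_eq_iff_eq_add] at h3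
    simp only [c, cH]
    rw [h3]
    abel
  have h4 : ∑ α ∈ B.pos, ∑ i, α (B.cartan i) • B.cH i = wedge B.rhoForm := by
    rw [Finset.sum_comm, rhoForm, wedge_sum]
    refine Finset.sum_congr rfl fun i _ => ?_
    rw [← Finset.sum_smul, wedge_smul, twoRho, LinearMap.sum_apply]
    rfl
  have h7 : ∑ α ∈ B.pos, B.c (-α) * B.ghostL α = ∑ α ∈ B.pos, B.c (-α) * Λ (B.τ α) :=
    Finset.sum_congr rfl fun α hα => by rw [B.ghostL_eq (B.pos_subset hα)]
  rw [B.chevalleyD_ghost, ghostD, Finset.sum_congr rfl h2, Finset.sum_sub_distrib, h4,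
    B.sum_cH_ghostLH, h7, B.sum_roots]
  module

end GhostLie

end ChevalleyBasis
end
end AnomalousBRST

namespace AnomalousBRST
noncomputable section

namespace ChevalleyBasis

/-! ### Gradings, and the decomposition of the differential into bidegrees. -/

section TotalOperators

theorem onVHom_neg {𝔤 : Type*} [LieRing 𝔤] [LieAlgebra ℝ 𝔤] {V : Type*} [NormedAddCommGroup V]
    [InnerProductSpace ℂ V] (A : Module.End ℂ (Ghost 𝔤)) : onVHom 𝔤 V (-A) = -onVHom 𝔤 V A :=
  map_neg (onVHom 𝔤 V) A

theorem onVHom_sub {𝔤 : Type*} [LieRing 𝔤] [LieAlgebra ℝ 𝔤] {V : Type*} [NormedAddCommGroup V]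
    [InnerProductSpace ℂ V] (A A' : Module.End ℂ (Ghost 𝔤)) :
    onVHom 𝔤 V (A - A') = onVHom 𝔤 V A - onVHom 𝔤 V A' :=
  map_sub (onVHom 𝔤 V) A A'

variable {𝔤 : Type*} [LieRing 𝔤] [LieAlgebra ℝ 𝔤] [FiniteDimensional ℝ 𝔤]
  {𝔥 : LieSubalgebra ℝ 𝔤} [𝔥.IsCartanSubalgebra] (B : ChevalleyBasis 𝔥)
  (V : Type*) [NormedAddCommGroup V] [InnerProductSpace ℂ V]

/-- The ghost `c^α` on `𝒞(V)`. -/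
def cV (α : Functional 𝔥) : Module.End ℂ (GhostV 𝔤 V) := onVHom 𝔤 V (B.c α)

/-- The anti-ghost `b_α` on `𝒞(V)`. -/
def bV (α : Functional 𝔥) : Module.End ℂ (GhostV 𝔤 V) := onVHom 𝔤 V (B.b α)

variable {V} in
/-- The action of `τ_α` on the factor `V` of `𝒞(V)`. -/
def tV (ρ : 𝔤 →ₗ[ℝ] Module.End ℂ V) (α : Functional 𝔥) : Module.End ℂ (GhostV 𝔤 V) :=
  opV 𝔤 V (complexRep ρ (B.τ α))

theorem cV_cV (α β : Functional 𝔥) : B.cV V α * B.cV V β = -(B.cV V β * B.cV V α) := by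
  have := congrArg (onVHom 𝔤 V) (isGhostSystem_ghost.C_C (B.θ (-α)) (B.θ (-β)))
  rw [map_mul, onVHom_neg, map_mul] at this
  exact this

theorem bV_bV (α β : Functional 𝔥) : B.bV V α * B.bV V β = -(B.bV V β * B.bV V α) := by
  have := congrArg (onVHom 𝔤 V) (isGhostSystem_ghost.I_I (B.τ α) (B.τ β))
  rw [map_mul, onVHom_neg, map_mul] at this
  exact this

open Classical in
theorem bV_cV {α β : Functional 𝔥} (hα : α ∈ roots 𝔥) (hβ : β ∈ roots 𝔥) :
    B.bV V α * B.cV V (-β) = (if α = β then 1 else 0) - B.cV V (-β) * B.bV V α := by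
  have h := congrArg (onVHom 𝔤 V) (isGhostSystem_ghost.I_C (B.τ α) (B.θ β))
  rw [B.θ_τ hβ hα] at h
  rw [map_mul, onVHom_sub, map_smul, map_one, map_mul] at h
  rw [cV, bV, c, neg_neg]
  refine h.trans ?_
  simp only [ite_smul, one_smul, zero_smul, eq_comm (a := β)]
  rfl

theorem tV_cV (ρ : 𝔤 →ₗ[ℝ] Module.End ℂ V) (α β : Functional 𝔥) :
    B.tV ρ α * B.cV V β = B.cV V β * B.tV ρ α := opV_onVHom _ _

theorem tV_bV (ρ : 𝔤 →ₗ[ℝ] Module.End ℂ V) (α β : Functional 𝔥) :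
    B.tV ρ α * B.bV V β = B.bV V β * B.tV ρ α := opV_onVHom _ _

/-- The grading operator with weight `q α` on the mode `θ^α`. -/
def grading (q : Functional 𝔥 → ℂ) : Module.End ℂ (GhostV 𝔤 V) :=
  ∑ α ∈ roots 𝔥, q α • (B.cV V (-α) * B.bV V α)

theorem grading_cV (q : Functional 𝔥 → ℂ) {α : Functional 𝔥} (hα : α ∈ roots 𝔥) :
    B.grading V q * B.cV V (-α) - B.cV V (-α) * B.grading V q = q α • B.cV V (-α) := by
  classical
  have key : ∀ β ∈ roots 𝔥, q β • (B.cV V (-β) * B.bV V β) * B.cV V (-α)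
      - B.cV V (-α) * (q β • (B.cV V (-β) * B.bV V β))
      = if β = α then q β • B.cV V (-β) else 0 := by
    intro β hβ
    rw [smul_mul_assoc, mul_smul_comm, mul_assoc, B.bV_cV V hβ hα, mul_sub, ← mul_assoc,
      ← mul_assoc, B.cV_cV V (-α), neg_mul]
    split_ifs <;> simp [smul_sub]
  rw [grading, Finset.sum_mul, Finset.mul_sum, ← Finset.sum_sub_distrib,
    Finset.sum_congr rfl key, Finset.sum_ite_eq', if_pos hα]

theorem grading_bV (q : Functional 𝔥 → ℂ) {α : Functional 𝔥} (hα : α ∈ roots 𝔥) :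
    B.grading V q * B.bV V α - B.bV V α * B.grading V q = -q α • B.bV V α := by
  classical
  have key : ∀ β ∈ roots 𝔥, q β • (B.cV V (-β) * B.bV V β) * B.bV V α
      - B.bV V α * (q β • (B.cV V (-β) * B.bV V β))
      = if α = β then -q β • B.bV V β else 0 := by
    intro β hβ
    rw [smul_mul_assoc, mul_smul_comm, ← mul_assoc (B.bV V α), B.bV_cV V hα hβ, sub_mul, mul_assoc,
      mul_assoc, B.bV_bV V α, mul_neg]
    split_ifs <;> simp
  rw [grading, Finset.sum_mul, Finset.mul_sum, ← Finset.sum_sub_distrib,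
    Finset.sum_congr rfl key, Finset.sum_ite_eq, if_pos hα]

theorem grading_tV (q : Functional 𝔥 → ℂ) (ρ : 𝔤 →ₗ[ℝ] Module.End ℂ V) (α : Functional 𝔥) :
    B.grading V q * B.tV ρ α - B.tV ρ α * B.grading V q = (0 : ℂ) • B.tV ρ α := by
  rw [zero_smul, sub_eq_zero, grading, Finset.sum_mul, Finset.mul_sum]
  refine Finset.sum_congr rfl fun β _ => ?_
  rw [smul_mul_assoc, mul_smul_comm, mul_assoc, ← B.tV_bV, ← mul_assoc, ← mul_assoc, B.tV_cV]

theorem commutator_mul {E : Type*} [Ring E] [Algebra ℂ E] {G x y : E} {k m : ℂ}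
    (hx : G * x - x * G = k • x) (hy : G * y - y * G = m • y) :
    G * (x * y) - x * y * G = (k + m) • (x * y) := by
  rw [add_smul, ← smul_mul_assoc, ← hx, ← mul_smul_comm m, ← hy]
  noncomm_ring

/-- The component `c^{-α} c^{-β} b_{α+β}` of the ghost differential. -/
def cubic (α β : Functional 𝔥) : Module.End ℂ (GhostV 𝔤 V) :=
  B.cV V (-α) * B.cV V (-β) * B.bV V (α + β)

theorem cubic_swap (α β : Functional 𝔥) : B.cubic V β α = -B.cubic V α β := by
  rw [cubic, cubic, B.cV_cV, neg_mul, add_comm]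

theorem grading_cubic (q : Functional 𝔥 → ℂ) {α β : Functional 𝔥} (hα : α ∈ roots 𝔥)
    (hβ : β ∈ roots 𝔥) (h : α + β ∈ roots 𝔥) :
    B.grading V q * B.cubic V α β - B.cubic V α β * B.grading V q
      = (q α + q β - q (α + β)) • B.cubic V α β := by
  have := commutator_mul (commutator_mul (B.grading_cV V q hα) (B.grading_cV V q hβ))
    (B.grading_bV V q h)
  rwa [← sub_eq_add_neg] at this

variable {V}

/-- The sum of the terms `c^{-α} τ_α` and `-½ N_{αβ} c^{-α} c^{-β} b_{α+β}` of the differential,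
weighted by `u` and `w`. -/
def weighted (ρ : 𝔤 →ₗ[ℝ] Module.End ℂ V) (u : Functional 𝔥 → ℂ)
    (w : Functional 𝔥 → Functional 𝔥 → ℂ) : Module.End ℂ (GhostV 𝔤 V) :=
  ∑ α ∈ roots 𝔥, u α • (B.cV V (-α) * B.tV ρ α)
    - (1 / 2 : ℂ) • ∑ α ∈ roots 𝔥, ∑ β ∈ roots 𝔥, (w α β * B.N α β) • B.cubic V α β

variable (ρ : 𝔤 →ₗ[ℝ] Module.End ℂ V)

/-- The weight of a cubic term matters only if $\alpha+\beta$ is a root, because $N_{\alpha\beta}$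
vanishes otherwise. -/
theorem weighted_congr {u u' : Functional 𝔥 → ℂ} {w w' : Functional 𝔥 → Functional 𝔥 → ℂ}
    (hu : ∀ α ∈ roots 𝔥, u α = u' α)
    (hw : ∀ α ∈ roots 𝔥, ∀ β ∈ roots 𝔥, α + β ∈ roots 𝔥 → w α β = w' α β) :
    B.weighted ρ u w = B.weighted ρ u' w' := by
  rw [weighted, weighted]
  congr 1
  · exact Finset.sum_congr rfl fun α hα => by rw [hu α hα]
  · congr 1
    refine Finset.sum_congr rfl fun α hα => Finset.sum_congr rfl fun β hβ => ?_
    by_cases h : α + β ∈ roots 𝔥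
    · rw [hw α hα β hβ h]
    · rw [B.N_eq_zero _ _ h, mul_zero, mul_zero]

theorem weighted_add (u u' : Functional 𝔥 → ℂ) (w w' : Functional 𝔥 → Functional 𝔥 → ℂ) :
    B.weighted ρ u w + B.weighted ρ u' w'
      = B.weighted ρ (fun α => u α + u' α) (fun α β => w α β + w' α β) := by
  simp only [weighted, add_mul, add_smul, Finset.sum_add_distrib, smul_add]
  abel

theorem weighted_sub (u u' : Functional 𝔥 → ℂ) (w w' : Functional 𝔥 → Functional 𝔥 → ℂ) :
    B.weighted ρ u w - B.weighted ρ u' w'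
      = B.weighted ρ (fun α => u α - u' α) (fun α β => w α β - w' α β) := by
  simp only [weighted, sub_mul, sub_smul, Finset.sum_sub_distrib, smul_sub]
  abel

/-- Every term of `weighted` is homogeneous, so a commutator with a grading multiplies its
coefficient by its degree. Bidegree questions thereby become identities between scalar weights. -/
theorem grading_weighted (q u : Functional 𝔥 → ℂ) (w : Functional 𝔥 → Functional 𝔥 → ℂ) :
    B.grading V q * B.weighted ρ u w - B.weighted ρ u w * B.grading V q
      = B.weighted ρ (fun α => q α * u α) (fun α β => (q α + q β - q (α + β)) * w α β) := by
  have h1 : ∀ α ∈ roots 𝔥, B.grading V q * (u α • (B.cV V (-α) * B.tV ρ α))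
      - u α • (B.cV V (-α) * B.tV ρ α) * B.grading V q
      = (q α * u α) • (B.cV V (-α) * B.tV ρ α) := by
    intro α hα
    have := commutator_mul (B.grading_cV V q hα) (B.grading_tV V q ρ α)
    rw [mul_smul_comm, smul_mul_assoc, ← smul_sub, this, smul_smul, add_zero, mul_comm]
  have h2 : ∀ α ∈ roots 𝔥, ∀ β ∈ roots 𝔥, B.grading V q * ((w α β * B.N α β) • B.cubic V α β)
      - (w α β * B.N α β) • B.cubic V α β * B.grading V q
      = ((q α + q β - q (α + β)) * w α β * B.N α β) • B.cubic V α β := by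
    intro α hα β hβ
    by_cases h : α + β ∈ roots 𝔥
    · rw [mul_smul_comm, smul_mul_assoc, ← smul_sub, B.grading_cubic V q hα hβ h, smul_smul]
      congr 1
      ring
    · rw [B.N_eq_zero _ _ h]
      simp
  simp only [weighted]
  rw [← Finset.sum_congr rfl h1, Finset.sum_sub_distrib,
    ← Finset.sum_congr rfl fun α hα => Finset.sum_congr rfl (h2 α hα)]
  simp only [mul_sub, sub_mul, Finset.sum_mul, Finset.mul_sum, mul_smul_comm (1 / 2 : ℂ),
    smul_mul_assoc (1 / 2 : ℂ), Finset.sum_sub_distrib, smul_sub]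
  abel

open Classical in
/-- The indicator function of the positive roots. -/
def posInd (α : Functional 𝔥) : ℂ := if α ∈ B.pos then 1 else 0

theorem posInd_pos {α : Functional 𝔥} (h : α ∈ B.pos) : B.posInd α = 1 := if_pos h

theorem posInd_neg {α : Functional 𝔥} (h : α ∈ B.pos) : B.posInd (-α) = 0 :=
  if_neg (B.neg_notMem_pos α h)

/-- The degree of `c^{-α} c^{-β} b_{α+β}` in the modes of positive roots. -/
def cubicDeg (α β : Functional 𝔥) : ℂ := B.posInd α + B.posInd β - B.posInd (α + β)

theorem sum_sum_roots (B : ChevalleyBasis 𝔥) {M : Type*} [AddCommMonoid M]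
    (F : Functional 𝔥 → Functional 𝔥 → M) :
    ∑ α ∈ roots 𝔥, ∑ β ∈ roots 𝔥, F α β = ∑ α ∈ B.pos, ∑ β ∈ B.pos, F α β
      + ∑ α ∈ B.pos, ∑ β ∈ B.pos, F α (-β) + (∑ α ∈ B.pos, ∑ β ∈ B.pos, F (-α) β
      + ∑ α ∈ B.pos, ∑ β ∈ B.pos, F (-α) (-β)) := by
  rw [B.sum_roots]
  simp only [B.sum_roots, Finset.sum_add_distrib]

theorem constraint_τ {χ : Module.Dual ℂ (Cx 𝔤)} (hχ : B.IsRegularDominant χ) {α : Functional 𝔥}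
    (hα : α ∈ roots 𝔥) : constraint ρ χ (B.τ α) = complexRep ρ (B.τ α) := by
  rw [constraint, hχ.apply_τ α hα, zero_smul, sub_zero]

theorem posInd_sub {α β : Functional 𝔥} (h : α - β ∈ roots 𝔥) :
    1 - B.posInd (α - β) = B.posInd (β - α) := by
  rcases (B.mem_roots_iff _).1 h with h' | h'
  · have := B.posInd_neg h'
    rw [neg_sub] at this
    rw [this, B.posInd_pos h', sub_self]
  · have := B.posInd_neg h'
    rw [neg_neg] at this
    rw [neg_sub] at h'
    rw [this, B.posInd_pos h', sub_zero]

/-- A mixed cubic term with $\alpha>0$ and $-\beta<0$ has degree $1$ in the positive modes exactly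
when $\alpha-\beta$ is a negative root, which is the condition $\beta-\alpha\in R_+$. The two orders
of a mixed pair give the same term, and this cancels the factor $\tfrac12$. -/
theorem diffBarOp_eq {χ : Module.Dual ℂ (Cx 𝔤)} (hχ : B.IsRegularDominant χ) :
    B.diffBarOp ρ χ = B.weighted ρ B.posInd B.cubicDeg := by
  classical
  have h1 : ∑ α ∈ roots 𝔥, B.posInd α • (B.cV V (-α) * B.tV ρ α)
      = ∑ α ∈ B.pos, tensorOp (B.c (-α)) (constraint ρ χ (B.τ α)) := by
    rw [B.sum_roots, Finset.sum_congr rfl fun α hα => by rw [B.posInd_pos hα, one_smul],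
      Finset.sum_congr (s₁ := B.pos) (f := fun α => B.posInd (-α) • _) rfl
        fun α hα => by rw [B.posInd_neg hα, zero_smul], Finset.sum_const_zero, add_zero]
    refine Finset.sum_congr rfl fun α hα => ?_
    rw [B.constraint_τ ρ hχ (B.pos_subset hα), tensorOp_eq]
    rfl
  have hpp : ∑ α ∈ B.pos, ∑ β ∈ B.pos, (B.cubicDeg α β * B.N α β) • B.cubic V α β
      = ∑ α ∈ B.pos, ∑ β ∈ B.pos, B.N α β • B.cubic V α β := by
    refine Finset.sum_congr rfl fun α hα => Finset.sum_congr rfl fun β hβ => ?_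
    by_cases h : α + β ∈ roots 𝔥
    · rw [cubicDeg, B.posInd_pos hα, B.posInd_pos hβ, B.posInd_pos (B.add_mem_pos α hα β hβ h),
        add_sub_cancel_right, one_mul]
    · rw [B.N_eq_zero _ _ h, mul_zero]
  have hnn : ∑ α ∈ B.pos, ∑ β ∈ B.pos, (B.cubicDeg (-α) (-β) * B.N (-α) (-β)) • B.cubic V (-α) (-β)
      = 0 := by
    refine Finset.sum_eq_zero fun α hα => Finset.sum_eq_zero fun β hβ => ?_
    by_cases h : -α + -β ∈ roots 𝔥
    · rw [← neg_add, B.mem_roots_neg_iff] at h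
      rw [cubicDeg, B.posInd_neg hα, B.posInd_neg hβ, ← neg_add,
        B.posInd_neg (B.add_mem_pos α hα β hβ h)]
      simp
    · rw [B.N_eq_zero _ _ h, mul_zero, zero_smul]
  have hpn : ∑ α ∈ B.pos, ∑ β ∈ B.pos, (B.cubicDeg α (-β) * B.N α (-β)) • B.cubic V α (-β)
      = ∑ α ∈ B.pos, ∑ β ∈ B.pos with β - α ∈ B.pos, B.N α (-β) • B.cubic V α (-β) := by
    refine Finset.sum_congr rfl fun α hα => ?_
    rw [Finset.sum_filter]
    refine Finset.sum_congr rfl fun β hβ => ?_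
    by_cases h : α + -β ∈ roots 𝔥
    · rw [cubicDeg, B.posInd_pos hα, B.posInd_neg hβ, add_zero, ← sub_eq_add_neg α β,
        B.posInd_sub (by rwa [← sub_eq_add_neg] at h), posInd]
      split_ifs <;> simp
    · rw [B.N_eq_zero _ _ h]
      simp
  have hnp : ∑ α ∈ B.pos, ∑ β ∈ B.pos, (B.cubicDeg (-α) β * B.N (-α) β) • B.cubic V (-α) β
      = ∑ α ∈ B.pos, ∑ β ∈ B.pos, (B.cubicDeg α (-β) * B.N α (-β)) • B.cubic V α (-β) := by
    rw [Finset.sum_comm]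
    refine Finset.sum_congr rfl fun α hα => Finset.sum_congr rfl fun β hβ => ?_
    rw [B.cubic_swap V α (-β), B.N_antisymm (B.neg_mem_roots hβ) (B.pos_subset hα), cubicDeg,
      cubicDeg, add_comm (-β) α, add_comm (B.posInd (-β))]
    simp
  have h2 : onV V B.ghostPartialBar
      = -((1 / 2 : ℂ) • ∑ α ∈ B.pos, ∑ β ∈ B.pos, B.N α β • B.cubic V α β) := by
    simp only [onV_eq, ghostPartialBar, onVHom_neg, map_smul, map_sum, map_mul]
    rfl
  have h3 : ∑ α ∈ B.pos, onV V (B.c (-α) * B.tPos α)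
      = -∑ α ∈ B.pos, ∑ β ∈ B.pos with β - α ∈ B.pos, B.N α (-β) • B.cubic V α (-β) := by
    rw [← Finset.sum_neg_distrib]
    refine Finset.sum_congr rfl fun α _ => ?_
    simp only [onV_eq, tPos, onVHom_neg, map_smul, map_sum, map_mul, mul_neg, Finset.mul_sum,
      mul_smul_comm, cubic, neg_neg, ← sub_eq_add_neg α, mul_assoc]
    rfl
  rw [weighted, h1, B.sum_sum_roots, hpp, hnn, hnp, hpn, diffBarOp, h2, h3]
  module

/-- This is the complementary part, of degree $0$ in the positive modes. The relation
$N_{-\alpha,-\beta}=N_{\alpha\beta}$ brings its coefficients to the stated form. -/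
theorem diffOp_eq {χ : Module.Dual ℂ (Cx 𝔤)} (hχ : B.IsRegularDominant χ) :
    B.diffOp ρ χ = B.weighted ρ (fun α => 1 - B.posInd α) (fun α β => 1 - B.cubicDeg α β) := by
  classical
  have h1 : ∑ α ∈ roots 𝔥, (1 - B.posInd α) • (B.cV V (-α) * B.tV ρ α)
      = ∑ α ∈ B.pos, tensorOp (B.c α) (constraint ρ χ (B.τ (-α))) := by
    rw [B.sum_roots, Finset.sum_congr rfl fun α hα => by rw [B.posInd_pos hα, sub_self, zero_smul],
      Finset.sum_const_zero, zero_add]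
    refine Finset.sum_congr rfl fun α hα => ?_
    rw [B.constraint_τ ρ hχ (B.neg_mem_roots hα), tensorOp_eq, B.posInd_neg hα, sub_zero, one_smul,
      neg_neg]
    rfl
  have hpp : ∑ α ∈ B.pos, ∑ β ∈ B.pos, ((1 - B.cubicDeg α β) * B.N α β) • B.cubic V α β
      = 0 := by
    refine Finset.sum_eq_zero fun α hα => Finset.sum_eq_zero fun β hβ => ?_
    by_cases h : α + β ∈ roots 𝔥
    · rw [cubicDeg, B.posInd_pos hα, B.posInd_pos hβ, B.posInd_pos (B.add_mem_pos α hα β hβ h),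
        add_sub_cancel_right, sub_self, zero_mul, zero_smul]
    · rw [B.N_eq_zero _ _ h, mul_zero, zero_smul]
  have hnn : ∑ α ∈ B.pos, ∑ β ∈ B.pos,
        ((1 - B.cubicDeg (-α) (-β)) * B.N (-α) (-β)) • B.cubic V (-α) (-β)
      = ∑ α ∈ B.pos, ∑ β ∈ B.pos, B.N α β • B.cubic V (-α) (-β) := by
    refine Finset.sum_congr rfl fun α hα => Finset.sum_congr rfl fun β hβ => ?_
    rw [B.N_neg_neg α (B.pos_subset hα) β (B.pos_subset hβ)]
    by_cases h : α + β ∈ roots 𝔥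
    · rw [cubicDeg, B.posInd_neg hα, B.posInd_neg hβ, ← neg_add,
        B.posInd_neg (B.add_mem_pos α hα β hβ h)]
      simp
    · rw [B.N_eq_zero _ _ h, mul_zero]
  have hnp : ∑ α ∈ B.pos, ∑ β ∈ B.pos, ((1 - B.cubicDeg (-α) β) * B.N (-α) β) • B.cubic V (-α) β
      = ∑ α ∈ B.pos, ∑ β ∈ B.pos with β - α ∈ B.pos, B.N α (-β) • B.cubic V (-α) β := by
    refine Finset.sum_congr rfl fun α hα => ?_
    rw [Finset.sum_filter]
    refine Finset.sum_congr rfl fun β hβ => ?_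
    have h0 := B.N_neg_neg α (B.pos_subset hα) (-β) (B.neg_mem_roots hβ)
    rw [neg_neg] at h0
    rw [h0, cubicDeg, B.posInd_pos hβ, B.posInd_neg hα, zero_add, neg_add_eq_sub, sub_sub_cancel,
      posInd]
    split_ifs <;> simp
  have hpn : ∑ α ∈ B.pos, ∑ β ∈ B.pos, ((1 - B.cubicDeg α (-β)) * B.N α (-β)) • B.cubic V α (-β)
      = ∑ α ∈ B.pos, ∑ β ∈ B.pos, ((1 - B.cubicDeg (-α) β) * B.N (-α) β) • B.cubic V (-α) β := by
    rw [Finset.sum_comm]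
    refine Finset.sum_congr rfl fun α hα => Finset.sum_congr rfl fun β hβ => ?_
    rw [B.cubic_swap V (-α) β, B.N_antisymm (B.pos_subset hβ) (B.neg_mem_roots hα), cubicDeg,
      cubicDeg, add_comm (-α) β, add_comm (B.posInd (-α))]
    simp
  have h2 : onV V B.ghostPartial
      = -((1 / 2 : ℂ) • ∑ α ∈ B.pos, ∑ β ∈ B.pos, B.N α β • B.cubic V (-α) (-β)) := by
    simp only [onV_eq, ghostPartial, onVHom_neg, map_smul, map_sum, map_mul, cubic, neg_neg,
      ← sub_eq_add_neg]
    rfl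
  have h3 : ∑ α ∈ B.pos, onV V (B.c α * B.tNeg α)
      = -∑ α ∈ B.pos, ∑ β ∈ B.pos with β - α ∈ B.pos, B.N α (-β) • B.cubic V (-α) β := by
    rw [← Finset.sum_neg_distrib]
    refine Finset.sum_congr rfl fun α _ => ?_
    simp only [onV_eq, tNeg, onVHom_neg, map_smul, map_sum, map_mul, mul_neg, Finset.mul_sum,
      mul_smul_comm, cubic, neg_neg, neg_add_eq_sub, mul_assoc]
    rfl
  rw [weighted, h1, B.sum_sum_roots, hpp, hnn, hpn, hnp, diffOp, h2, h3]
  module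

theorem diffBarOp_add_diffOp {χ : Module.Dual ℂ (Cx 𝔤)} (hχ : B.IsRegularDominant χ) :
    B.diffBarOp ρ χ + B.diffOp ρ χ = B.weighted ρ (fun _ => 1) (fun _ _ => 1) := by
  rw [B.diffBarOp_eq ρ hχ, B.diffOp_eq ρ hχ, B.weighted_add]
  simp

theorem posInd_mul_self (α : Functional 𝔥) : B.posInd α * B.posInd α = B.posInd α := by
  rw [posInd]
  split_ifs <;> simp

/-- The degree is $0$ or $1$. The other conceivable values $2$ and $-1$ would need two positive
roots with negative sum, or two negative roots with positive sum. -/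
theorem cubicDeg_mul_self {α β : Functional 𝔥} (hα : α ∈ roots 𝔥) (hβ : β ∈ roots 𝔥)
    (h : α + β ∈ roots 𝔥) : B.cubicDeg α β * B.cubicDeg α β = B.cubicDeg α β := by
  have hn : ∀ {γ : Functional 𝔥}, γ ∈ roots 𝔥 → γ ∉ B.pos → -γ ∈ B.pos :=
    fun h => B.neg_mem_pos_of_notMem h
  rw [cubicDeg, posInd, posInd, posInd]
  split_ifs with h1 h2 h3 h3 h2 h3 h3
  · norm_num
  · exact absurd (B.add_mem_pos α h1 β h2 h) h3
  · norm_num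
  · norm_num
  · norm_num
  · norm_num
  · have h4 := B.add_mem_pos _ (hn hα h1) _ (hn hβ h2) (by rw [← neg_add, B.mem_roots_neg_iff]; exact h)
    rw [← neg_add] at h4
    exact absurd h4 (B.neg_notMem_pos _ h3)
  · norm_num

theorem grading_diffBarOp {χ : Module.Dual ℂ (Cx 𝔤)} (hχ : B.IsRegularDominant χ) :
    B.grading V B.posInd * B.diffBarOp ρ χ - B.diffBarOp ρ χ * B.grading V B.posInd
      = B.diffBarOp ρ χ := by
  rw [B.diffBarOp_eq ρ hχ, B.grading_weighted]
  exact B.weighted_congr ρ (fun α _ => B.posInd_mul_self α)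
    fun α hα β hβ h => B.cubicDeg_mul_self hα hβ h

theorem weighted_zero : B.weighted ρ (fun _ => 0) (fun _ _ => 0) = 0 := by
  simp [weighted]

theorem grading_diffOp {χ : Module.Dual ℂ (Cx 𝔤)} (hχ : B.IsRegularDominant χ) :
    B.grading V B.posInd * B.diffOp ρ χ - B.diffOp ρ χ * B.grading V B.posInd = 0 := by
  rw [B.diffOp_eq ρ hχ, B.grading_weighted, ← B.weighted_zero ρ]
  refine B.weighted_congr ρ (fun α _ => ?_) fun α hα β hβ h => ?_
  · rw [mul_sub, B.posInd_mul_self, mul_one, sub_self]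
  · have := B.cubicDeg_mul_self hα hβ h
    rw [cubicDeg] at this ⊢
    rw [mul_sub, this, mul_one, sub_self]

theorem grading_one_diffBarOp {χ : Module.Dual ℂ (Cx 𝔤)} (hχ : B.IsRegularDominant χ) :
    B.grading V (fun _ => 1) * B.diffBarOp ρ χ - B.diffBarOp ρ χ * B.grading V (fun _ => 1)
      = B.diffBarOp ρ χ := by
  rw [B.diffBarOp_eq ρ hχ, B.grading_weighted]
  simp

theorem grading_one_diffOp {χ : Module.Dual ℂ (Cx 𝔤)} (hχ : B.IsRegularDominant χ) :
    B.grading V (fun _ => 1) * B.diffOp ρ χ - B.diffOp ρ χ * B.grading V (fun _ => 1)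
      = B.diffOp ρ χ := by
  rw [B.diffOp_eq ρ hχ, B.grading_weighted]
  simp

end TotalOperators
end ChevalleyBasis
end
end AnomalousBRST

namespace AnomalousBRST
noncomputable section

namespace ChevalleyBasis

/-! ### The total differential as a twisted Chevalley-Eilenberg differential, and its square. -/

section Differential

variable {𝔤 : Type*} [LieRing 𝔤] [LieAlgebra ℝ 𝔤] [FiniteDimensional ℝ 𝔤]
  {𝔥 : LieSubalgebra ℝ 𝔤} [𝔥.IsCartanSubalgebra] (B : ChevalleyBasis 𝔥)
  {V : Type*} [NormedAddCommGroup V] [InnerProductSpace ℂ V]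
  (ρ : 𝔤 →ₗ[ℝ] Module.End ℂ V)

theorem onVHom_chevalleyD :
    chevalleyD B.basis (totalC 𝔤 V) (totalI 𝔤 V) (totalR ρ)
      = ∑ α ∈ roots 𝔥, B.cV V (-α) * B.tV ρ α
        + ∑ i, onVHom 𝔤 V (B.cH i) * opV 𝔤 V (complexRep ρ (B.cartan i))
        + onVHom 𝔤 V (chevalleyD B.basis (wedgeHom 𝔤) (substHom 𝔤) 0) := by
  have h1 : ∀ a, totalC 𝔤 V (B.basis.coord a) *
        (totalR ρ (B.basis a) + (1 / 2 : ℂ) • lieGhost B.basis (totalC 𝔤 V) (totalI 𝔤 V) (B.basis a))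
      = totalC 𝔤 V (B.basis.coord a) * totalR ρ (B.basis a)
        + onVHom 𝔤 V (wedgeHom 𝔤 (B.basis.coord a) *
          ((0 : Cx 𝔤 →ₗ[ℂ] Module.End ℂ (Ghost 𝔤)) (B.basis a)
            + (1 / 2 : ℂ) • lieGhost B.basis (wedgeHom 𝔤) (substHom 𝔤) (B.basis a))) := by
    intro a
    rw [LinearMap.zero_apply, zero_add, map_mul, map_smul, onVHom_lieGhost, mul_add]
    rfl
  rw [chevalleyD, Finset.sum_congr rfl fun a _ => h1 a, Finset.sum_add_distrib, ← map_sum,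
    sum_idx _ (fun α => B.cV V (-α) * B.tV ρ α)]
  · congr 2
    refine Finset.sum_congr rfl fun i _ => ?_
    rw [B.basis_inr]
    rfl
  · intro a
    rw [B.coord_inl, B.basis_inl, cV, c, neg_neg]
    rfl

/-- The functional `χ + 2ϱ`, extended by zero to the root vectors. -/
def shiftedForm (χ : Module.Dual ℂ (Cx 𝔤)) : Module.Dual ℂ (Cx 𝔤) := χ + B.rhoForm

theorem θH_basis (i j : Fin (rank 𝔥)) :
    B.θH j (B.basis (Sum.inr i)) = if i = j then 1 else 0 := by
  rw [θH, Module.Basis.coord_apply, Module.Basis.repr_self]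
  by_cases h : i = j
  · rw [h, if_pos rfl, Finsupp.single_eq_same]
  · rw [if_neg h, Finsupp.single_eq_of_ne fun e => h (Sum.inr_injective e).symm]

theorem rhoForm_cartan (h : complexify 𝔥) : B.rhoForm h = B.twoRho h := by
  conv_lhs => rw [B.cartan_sum h]
  conv_rhs => rw [← B.cartan.sum_repr h]
  rw [map_sum, map_sum]
  refine Finset.sum_congr rfl fun i _ => ?_
  rw [map_smul, map_smul, rhoForm, LinearMap.sum_apply]
  simp only [LinearMap.smul_apply, B.θH_basis]
  simp

theorem rhoForm_τ {α : Functional 𝔥} (hα : α ∈ roots 𝔥) : B.rhoForm (B.τ α) = 0 := by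
  rw [B.τ_eq hα, rhoForm]
  simp [θH]

theorem shiftedForm_cartan (χ : Module.Dual ℂ (Cx 𝔤)) (h : complexify 𝔥) :
    B.shiftedForm χ h = B.shifted χ h := by
  rw [shiftedForm, LinearMap.add_apply, B.rhoForm_cartan]
  rfl

theorem shiftedForm_τ {χ : Module.Dual ℂ (Cx 𝔤)} (hχ : B.IsRegularDominant χ) {α : Functional 𝔥}
    (hα : α ∈ roots 𝔥) : B.shiftedForm χ (B.τ α) = 0 := by
  rw [shiftedForm, LinearMap.add_apply, B.rhoForm_τ hα, hχ.apply_τ α hα, add_zero]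

theorem form_eq_sum {ξ : Module.Dual ℂ (Cx 𝔤)} (hξ : ∀ α ∈ roots 𝔥, ξ (B.τ α) = 0) :
    ξ = ∑ i, ξ (B.cartan i) • B.θH i := by
  refine B.basis.ext fun a => ?_
  rcases a with a | i
  · rw [B.basis_inl, hξ a a.2, B.τ_eq a.2]
    simp [θH]
  · rw [LinearMap.sum_apply]
    simp only [LinearMap.smul_apply, B.θH_basis, ← B.basis_inr]
    simp

variable [LieAlgebra.IsKilling ℂ (Cx 𝔤)]

/-- The constraints contribute the ghost of $\chi$, which has only Cartan components because $\chi$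
vanishes on root vectors; normal ordering contributes the ghost of $2\varrho$. -/
theorem totalD_eq {χ : Module.Dual ℂ (Cx 𝔤)} (hχ : B.IsRegularDominant χ) :
    B.totalD ρ χ = chevalleyD B.basis (totalC 𝔤 V) (totalI 𝔤 V) (totalR ρ)
      - totalC 𝔤 V (B.shiftedForm χ) := by
  have h1 : ∑ α ∈ roots 𝔥, tensorOp (B.c (-α)) (constraint ρ χ (B.τ α))
      = ∑ α ∈ roots 𝔥, B.cV V (-α) * B.tV ρ α :=
    Finset.sum_congr rfl fun α hα => by rw [B.constraint_τ ρ hχ hα, tensorOp_eq]; rfl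
  have h2 : ∑ i, tensorOp (B.cH i) (constraint ρ χ (B.cartan i))
      = ∑ i, onVHom 𝔤 V (B.cH i) * opV 𝔤 V (complexRep ρ (B.cartan i)) - totalC 𝔤 V χ := by
    rw [B.form_eq_sum hχ.apply_τ, map_sum, ← Finset.sum_sub_distrib, ← B.form_eq_sum hχ.apply_τ]
    refine Finset.sum_congr rfl fun i _ => ?_
    rw [tensorOp_eq, constraint, map_sub, mul_sub, map_smul, map_one, mul_smul_comm, mul_one,
      map_smul]
    rfl
  rw [totalD, h1, h2, B.onVHom_chevalleyD, B.ghostD_eq, shiftedForm, map_add, onV_eq, onVHom_sub]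
  change _ = _ - (_ + onVHom 𝔤 V (wedge B.rhoForm))
  abel

theorem totalLH_eq (χ : Module.Dual ℂ (Cx 𝔤)) (h : complexify 𝔥) :
    B.totalLH ρ χ h = totalR ρ (h : Cx 𝔤)
      + lieGhost B.basis (totalC 𝔤 V) (totalI 𝔤 V) (h : Cx 𝔤) - B.shifted χ h • 1 := by
  rw [totalLH, tensorOp_one, constraint, map_sub, map_smul, map_one, onV_eq, B.ghostLH_eq,
    onVHom_sub, onVHom_lieGhost, map_smul, map_one]
  change opV 𝔤 V (complexRep ρ (h : Cx 𝔤)) - χ h • 1 + _ = opV 𝔤 V (complexRep ρ (h : Cx 𝔤)) + _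
    - (χ h + B.twoRho h) • 1
  module

theorem totalLH_eq_grading (χ : Module.Dual ℂ (Cx 𝔤)) (h : complexify 𝔥) :
    B.totalLH ρ χ h = totalR ρ (h : Cx 𝔤)
      - B.grading V (fun α => α h) - B.shifted χ h • 1 := by
  rw [B.totalLH_eq, ← onVHom_lieGhost, B.lieGhost_cartan, onVHom_neg, map_sum, grading,
    ← sub_eq_add_neg]
  simp only [map_smul, map_mul]
  rfl

variable (hρ : ∀ x y : 𝔤, ρ ⁅x, y⁆ = ρ x * ρ y - ρ y * ρ x)
include hρ

/-- Cartan's formula for the untwisted differential; contracting the twisting ghost with $H$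
supplies precisely the scalar by which $L^{\rm tot}_H$ is shifted. -/
theorem totalD_subst {χ : Module.Dual ℂ (Cx 𝔤)} (hχ : B.IsRegularDominant χ) (h : complexify 𝔥) :
    B.totalD ρ χ * totalI 𝔤 V (h : Cx 𝔤) + totalI 𝔤 V (h : Cx 𝔤) * B.totalD ρ χ
      = B.totalLH ρ χ h := by
  have h1 := (isGhostSystem_total ρ hρ).chevalleyD_I B.basis (h : Cx 𝔤)
  have h2 := (isGhostSystem_total ρ hρ).I_C (h : Cx 𝔤) (B.shiftedForm χ)
  rw [B.totalD_eq ρ hχ, B.totalLH_eq, ← h1, sub_mul, mul_sub, h2, B.shiftedForm_cartan]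
  abel

/-- In `twisted_sq` the functional $\chi+2\varrho$ vanishes on root vectors, so only brackets of
opposite root vectors contribute. The pairs $(\alpha,-\alpha)$ and $(-\alpha,\alpha)$ give equal
terms, absorbing the factor $\tfrac12$. -/
theorem totalD_sq {χ : Module.Dual ℂ (Cx 𝔤)} (hχ : B.IsRegularDominant χ) :
    B.totalD ρ χ * B.totalD ρ χ = -onV V (B.ghostJplus χ) := by
  classical
  have h1 := (isGhostSystem_total ρ hρ).twisted_sq B.basis (B.shiftedForm χ)
  set Λ := B.shiftedForm χ
  have hc : ∀ (α : Functional 𝔥), α ∈ roots 𝔥 → ∀ h : complexify 𝔥, Λ ⁅B.τ α, (h : Cx 𝔤)⁆ = 0 := by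
    intro α hα h
    rw [B.lie_τ_cartan hα, map_neg, map_smul, B.shiftedForm_τ hχ hα, smul_zero, neg_zero]
  have hr : ∀ α ∈ roots 𝔥, ∀ β ∈ roots 𝔥, Λ ⁅B.τ α, B.τ β⁆ • (totalC 𝔤 V (B.θ α) * totalC 𝔤 V (B.θ β))
      = if β = -α then -B.shifted χ (B.coroot α) • (B.cV V (-α) * B.cV V α) else 0 := by
    intro α hα β hβ
    split_ifs with h
    · subst h
      have h2 := B.lie_neg α hα
      change ⁅B.τ α, B.τ (-α)⁆ = _ at h2
      rw [h2, map_neg, B.shiftedForm_cartan, cV, cV, c, c, neg_neg]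
      rfl
    · have h2 := B.lie_root α hα β hβ (fun e => h (eq_neg_of_add_eq_zero_right e))
      change ⁅B.τ α, B.τ β⁆ = B.N α β • B.τ (α + β) at h2
      rw [h2, map_smul]
      by_cases h3 : α + β ∈ roots 𝔥
      · rw [B.shiftedForm_τ hχ h3, smul_zero, zero_smul]
      · rw [B.N_eq_zero _ _ h3, zero_smul, zero_smul]
  rw [B.totalD_eq ρ hχ, h1,
    sum_idx _ (fun α => -B.shifted χ (B.coroot α) • (B.cV V (-α) * B.cV V α))]
  · have hi : ∀ i, ∑ x, Λ ⁅B.basis (Sum.inr i), B.basis x⁆ •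
        (totalC 𝔤 V (B.basis.coord (Sum.inr i)) * totalC 𝔤 V (B.basis.coord x)) = 0 := by
      intro i
      refine Finset.sum_eq_zero fun x _ => ?_
      rcases x with a | j
      · rw [B.basis_inr, B.basis_inl, ← lie_skew, map_neg, hc a a.2, neg_zero, zero_smul]
      · rw [B.basis_inr, B.basis_inr, lie_cartan_cartan, map_zero, zero_smul]
    rw [Finset.sum_congr rfl fun i _ => hi i, Finset.sum_const_zero, add_zero, B.sum_roots,
      ← Finset.sum_add_distrib, onV_eq, ghostJplus, map_sum, ← Finset.sum_neg_distrib,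
      Finset.smul_sum]
    refine Finset.sum_congr rfl fun α hα => ?_
    rw [B.coroot_neg (B.pos_subset hα), neg_neg, map_neg, neg_neg, B.cV_cV V α, map_smul, map_mul,
      B.r_of_pos χ hα]
    change _ = -(_ • (B.cV V (-α) * B.cV V α))
    module
  · intro a
    rw [sum_idx _ (fun β => if β = -a.1 then
      -B.shifted χ (B.coroot a) • (B.cV V (-a.1) * B.cV V a) else 0), Finset.sum_ite_eq',
      if_pos (B.mem_roots_neg_iff.2 a.2)]
    · rw [add_eq_left]
      refine Finset.sum_eq_zero fun i _ => ?_
      rw [B.basis_inr, B.basis_inl, hc a a.2, zero_smul]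
    · intro b
      rw [B.basis_inl, B.basis_inl, B.coord_inl, B.coord_inl, hr a a.2 b b.2]

end Differential

/-! ### Operators preserving the relative space, and the form of the differential on it. -/

section Relative

variable {𝔤 : Type*} [LieRing 𝔤] [LieAlgebra ℝ 𝔤] [FiniteDimensional ℝ 𝔤]
  {𝔥 : LieSubalgebra ℝ 𝔤} [𝔥.IsCartanSubalgebra] (B : ChevalleyBasis 𝔥)
  {V : Type*} [NormedAddCommGroup V] [InnerProductSpace ℂ V]
  (ρ : 𝔤 →ₗ[ℝ] Module.End ℂ V)

theorem mem_Crel {χ : Module.Dual ℂ (Cx 𝔤)} {Ψ : GhostV 𝔤 V} :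
    Ψ ∈ B.Crel ρ χ ↔ (∀ h, B.totalLH ρ χ h Ψ = 0) ∧
      ∀ h : complexify 𝔥, totalI 𝔤 V (h : Cx 𝔤) Ψ = 0 := by
  simp only [Crel, Submodule.mem_inf, Submodule.mem_iInf, LinearMap.mem_ker]
  refine and_congr_right fun _ => ⟨fun h x => ?_, fun h i => ?_⟩
  · have : totalI 𝔤 V (x : Cx 𝔤) = ∑ i, B.cartan.repr x i • onV V (B.bH i) := by
      conv_lhs => rw [B.cartan_sum x]
      rw [map_sum]
      simp only [map_smul]
      rfl
    rw [this, LinearMap.sum_apply]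
    refine Finset.sum_eq_zero fun i _ => ?_
    rw [LinearMap.smul_apply, h i, smul_zero]
  · have := h (B.cartan i)
    rwa [← B.basis_inr] at this

theorem bH_apply {χ : Module.Dual ℂ (Cx 𝔤)} {Ψ : GhostV 𝔤 V} (hΨ : Ψ ∈ B.Crel ρ χ)
    (i : Fin (rank 𝔥)) : onVHom 𝔤 V (B.bH i) Ψ = 0 := by
  have := ((B.mem_Crel ρ).1 hΨ).2 (B.cartan i)
  rwa [← B.basis_inr] at this

theorem Crel_invariant {χ : Module.Dual ℂ (Cx 𝔤)} {A : Module.End ℂ (GhostV 𝔤 V)}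
    (h1 : ∀ h, Commute (B.totalLH ρ χ h) A)
    (h2 : ∀ h : complexify 𝔥, Commute (totalI 𝔤 V (h : Cx 𝔤)) A) :
    ∀ Ψ ∈ B.Crel ρ χ, A Ψ ∈ B.Crel ρ χ := by
  intro Ψ hΨ
  rw [mem_Crel] at hΨ ⊢
  refine ⟨fun h => ?_, fun h => ?_⟩
  · have := LinearMap.congr_fun (h1 h).eq Ψ
    rw [Module.End.mul_apply, Module.End.mul_apply, hΨ.1 h, map_zero] at this
    exact this
  · have := LinearMap.congr_fun (h2 h).eq Ψ
    rw [Module.End.mul_apply, Module.End.mul_apply, hΨ.2 h, map_zero] at this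
    exact this

theorem substCartan_cV (h : complexify 𝔥) {α : Functional 𝔥} (hα : α ∈ roots 𝔥) :
    totalI 𝔤 V (h : Cx 𝔤) * B.cV V α = -(B.cV V α * totalI 𝔤 V (h : Cx 𝔤)) := by
  have h0 : B.θ (-α) (h : Cx 𝔤) = 0 := by
    rw [B.cartan_sum, θ, dif_pos (B.mem_roots_neg_iff.2 hα)]
    simp
  have := congrArg (onVHom 𝔤 V) (isGhostSystem_ghost.I_C (h : Cx 𝔤) (B.θ (-α)))
  rw [h0, zero_smul, map_mul, zero_sub, onVHom_neg, map_mul] at this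
  exact this

theorem substCartan_bV (h : complexify 𝔥) (α : Functional 𝔥) :
    totalI 𝔤 V (h : Cx 𝔤) * B.bV V α = -(B.bV V α * totalI 𝔤 V (h : Cx 𝔤)) := by
  have := congrArg (onVHom 𝔤 V) (isGhostSystem_ghost.I_I (h : Cx 𝔤) (B.τ α))
  rw [map_mul, onVHom_neg, map_mul] at this
  exact this

theorem commute_of_anticommute {E : Type*} [Ring E] {x y z : E} (h1 : x * y = -(y * x))
    (h2 : x * z = -(z * x)) : Commute x (y * z) := by
  rw [Commute, SemiconjBy, ← mul_assoc, h1, neg_mul, mul_assoc, h2, mul_neg, neg_neg, mul_assoc]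

variable (V) in
/-- `J⁺` on `𝒞(V)`. -/
theorem onV_ghostJplus (χ : Module.Dual ℂ (Cx 𝔤)) :
    onV V (B.ghostJplus χ) = ∑ α ∈ B.pos, B.r χ α • (B.cV V (-α) * B.cV V α) := by
  simp only [onV_eq, ghostJplus, map_sum, map_smul, map_mul]
  rfl

variable (V) in
/-- `J⁻` on `𝒞(V)`. -/
theorem onV_ghostJminus (χ : Module.Dual ℂ (Cx 𝔤)) :
    onV V (B.ghostJminus χ) = ∑ α ∈ B.pos, (B.r χ α)⁻¹ • (B.bV V (-α) * B.bV V α) := by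
  simp only [onV_eq, ghostJminus, map_sum, map_smul, map_mul]
  rfl

variable (V) in
-- Reordering $b_{-\alpha}c^\alpha$ shows that the ghost number is the total degree minus the number
-- of positive roots. The constant drops out of commutators.
theorem onV_ghostNumber :
    onV V B.ghostNumber = B.grading V (fun _ => 1) - (B.pos.card : ℂ) • 1 := by
  classical
  have h1 : ∀ α ∈ B.pos, B.bV V (-α) * B.cV V α = 1 - B.cV V α * B.bV V (-α) := by
    intro α hα
    have := B.bV_cV V (B.neg_mem_roots hα) (B.neg_mem_roots hα)
    rwa [if_pos rfl, neg_neg] at this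
  have h2 : onV V B.ghostNumber
      = ∑ α ∈ B.pos, (B.cV V (-α) * B.bV V α - B.bV V (-α) * B.cV V α) := by
    simp only [onV_eq, ghostNumber, map_sum, onVHom_sub, map_mul]
    rfl
  rw [h2, Finset.sum_congr rfl fun α hα => by rw [h1 α hα], grading, B.sum_roots]
  simp only [one_smul, neg_neg, Finset.sum_sub_distrib, Finset.sum_const, Nat.cast_smul_eq_nsmul]
  abel

theorem grading_Jplus (χ : Module.Dual ℂ (Cx 𝔤)) {q : Functional 𝔥 → ℂ} {k : ℂ}
    (hq : ∀ α ∈ B.pos, q α + q (-α) = k) :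
    B.grading V q * onV V (B.ghostJplus χ) - onV V (B.ghostJplus χ) * B.grading V q
      = k • onV V (B.ghostJplus χ) := by
  rw [B.onV_ghostJplus, Finset.mul_sum, Finset.sum_mul, ← Finset.sum_sub_distrib, Finset.smul_sum]
  refine Finset.sum_congr rfl fun α hα => ?_
  have h1 := B.grading_cV V q (B.neg_mem_roots hα)
  rw [neg_neg] at h1
  have := commutator_mul (B.grading_cV V q (B.pos_subset hα)) h1
  rw [mul_smul_comm, smul_mul_assoc, ← smul_sub, this, hq α hα, smul_comm]

theorem grading_Jminus (χ : Module.Dual ℂ (Cx 𝔤)) {q : Functional 𝔥 → ℂ} {k : ℂ}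
    (hq : ∀ α ∈ B.pos, q α + q (-α) = k) :
    B.grading V q * onV V (B.ghostJminus χ) - onV V (B.ghostJminus χ) * B.grading V q
      = -k • onV V (B.ghostJminus χ) := by
  rw [B.onV_ghostJminus, Finset.mul_sum, Finset.sum_mul, ← Finset.sum_sub_distrib, Finset.smul_sum]
  refine Finset.sum_congr rfl fun α hα => ?_
  have := commutator_mul (B.grading_bV V q (B.neg_mem_roots hα)) (B.grading_bV V q (B.pos_subset hα))
  rw [mul_smul_comm, smul_mul_assoc, ← smul_sub, this, ← hq α hα, smul_comm]
  congr 2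
  ring

theorem grading_grading (q q' : Functional 𝔥 → ℂ) :
    B.grading V q * B.grading V q' - B.grading V q' * B.grading V q = 0 := by
  have h1 : B.grading V q' = ∑ α ∈ roots 𝔥, q' α • (B.cV V (-α) * B.bV V α) := rfl
  rw [h1, Finset.mul_sum, Finset.sum_mul, ← Finset.sum_sub_distrib]
  refine Finset.sum_eq_zero fun α hα => ?_
  have := commutator_mul (B.grading_cV V q hα) (B.grading_bV V q hα)
  rw [mul_smul_comm, smul_mul_assoc, ← smul_sub, this, add_neg_cancel, zero_smul, smul_zero]

variable [LieAlgebra.IsKilling ℂ (Cx 𝔤)]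

theorem totalLH_commute (χ : Module.Dual ℂ (Cx 𝔤)) (h : complexify 𝔥) {A : Module.End ℂ (Ghost 𝔤)}
    (hA : B.grading V (fun α => α h) * onV V A - onV V A * B.grading V (fun α => α h) = 0) :
    Commute (B.totalLH ρ χ h) (onV V A) := by
  rw [B.totalLH_eq_grading]
  exact ((show Commute (totalR ρ (h : Cx 𝔤)) (onV V A) from opV_onVHom _ _).sub_left (sub_eq_zero.1 hA)).sub_left
    ((Commute.one_left _).smul_left _)

theorem Jplus_invariant (χ : Module.Dual ℂ (Cx 𝔤)) :
    ∀ Ψ ∈ B.Crel ρ χ, onV V (B.ghostJplus χ) Ψ ∈ B.Crel ρ χ := by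
  refine B.Crel_invariant ρ (fun h => B.totalLH_commute ρ χ h ?_) fun h => ?_
  · rw [B.grading_Jplus χ (k := 0), zero_smul]
    intro α _
    simp
  · rw [B.onV_ghostJplus]
    exact Commute.sum_right _ _ _ fun α hα => (commute_of_anticommute
      (B.substCartan_cV h (B.neg_mem_roots hα)) (B.substCartan_cV h (B.pos_subset hα))).smul_right _

theorem Jminus_invariant (χ : Module.Dual ℂ (Cx 𝔤)) :
    ∀ Ψ ∈ B.Crel ρ χ, onV V (B.ghostJminus χ) Ψ ∈ B.Crel ρ χ := by
  refine B.Crel_invariant ρ (fun h => B.totalLH_commute ρ χ h ?_) fun h => ?_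
  · rw [B.grading_Jminus χ (k := 0), neg_zero, zero_smul]
    intro α _
    simp
  · rw [B.onV_ghostJminus]
    exact Commute.sum_right _ _ _ fun α _ => (commute_of_anticommute
      (B.substCartan_bV h _) (B.substCartan_bV h _)).smul_right _

/-- All gradings are simultaneously diagonal and contain no Cartan modes. The case `B.posInd` is
used to separate the two components of the differential inside the relative space. -/
theorem grading_invariant (χ : Module.Dual ℂ (Cx 𝔤)) (q : Functional 𝔥 → ℂ) :
    ∀ Ψ ∈ B.Crel ρ χ, B.grading V q Ψ ∈ B.Crel ρ χ := by
  have e : B.grading V q = onV V (∑ α ∈ roots 𝔥, q α • (B.c (-α) * B.b α)) := by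
    simp only [onV_eq, map_sum, map_smul, map_mul]
    rfl
  refine B.Crel_invariant ρ (fun h => ?_) fun h => ?_
  · rw [e]
    refine B.totalLH_commute ρ χ h ?_
    rw [← e]
    exact B.grading_grading _ _
  · exact Commute.sum_right _ _ _ fun α hα => (commute_of_anticommute
      (B.substCartan_cV h (B.mem_roots_neg_iff.2 hα)) (B.substCartan_bV h _)).smul_right _

theorem ghostNumber_invariant (χ : Module.Dual ℂ (Cx 𝔤)) :
    ∀ Ψ ∈ B.Crel ρ χ, onV V B.ghostNumber Ψ ∈ B.Crel ρ χ := by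
  intro Ψ hΨ
  rw [B.onV_ghostNumber, LinearMap.sub_apply, LinearMap.smul_apply]
  exact sub_mem (B.grading_invariant ρ χ _ Ψ hΨ) (Submodule.smul_mem _ _ hΨ)

section

variable (hρ : ∀ x y : 𝔤, ρ ⁅x, y⁆ = ρ x * ρ y - ρ y * ρ x)
include hρ

/-- $L^{\rm tot}_H$ is the anticommutator of $D$ with the substitution of $H$, so its commutator
with $D$ is governed by that of $D^2$ with this substitution. Although $D^2=-J^+$ is not zero, it
contains only root ghosts, in pairs, and commutes with the substitution. -/
theorem totalD_invariant {χ : Module.Dual ℂ (Cx 𝔤)} (hχ : B.IsRegularDominant χ) :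
    ∀ Ψ ∈ B.Crel ρ χ, B.totalD ρ χ Ψ ∈ B.Crel ρ χ := by
  intro Ψ hΨ
  rw [mem_Crel] at hΨ ⊢
  have hJ : ∀ h : complexify 𝔥, totalI 𝔤 V (h : Cx 𝔤) * onV V (B.ghostJplus χ)
      = onV V (B.ghostJplus χ) * totalI 𝔤 V (h : Cx 𝔤) := by
    intro h
    rw [B.onV_ghostJplus]
    exact Commute.sum_right _ _ _ fun α hα => (commute_of_anticommute
      (B.substCartan_cV h (B.neg_mem_roots hα)) (B.substCartan_cV h (B.pos_subset hα))).smul_right _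
  refine ⟨fun h => ?_, fun h => ?_⟩
  · have h1 : B.totalLH ρ χ h * B.totalD ρ χ = B.totalD ρ χ * B.totalLH ρ χ h := by
      have h2 := B.totalD_sq ρ hρ hχ
      have h3 := hJ h
      rw [← B.totalD_subst ρ hρ hχ h, add_mul, mul_add, mul_assoc (totalI 𝔤 V (h : Cx 𝔤)), h2,
        ← mul_assoc (B.totalD ρ χ) (B.totalD ρ χ), h2, mul_neg, neg_mul, h3, mul_assoc]
      abel
    have h2 := LinearMap.congr_fun h1 Ψ
    rw [Module.End.mul_apply, Module.End.mul_apply, hΨ.1 h, map_zero] at h2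
    exact h2
  · have h1 := LinearMap.congr_fun (B.totalD_subst ρ hρ hχ h) Ψ
    rw [LinearMap.add_apply, Module.End.mul_apply, Module.End.mul_apply, hΨ.2 h, map_zero, hΨ.1 h,
      zero_add] at h1
    exact h1

end

/-- The terms $c^{-\alpha}c^ib_\alpha$ of the root part reassemble into $c^iL_{H_i}$, which raises
the coefficient of the Cartan part from $\tfrac12$ to $1$. This full coefficient is needed to
complete $L^{\rm tot}_{H_i}$ in `totalD_apply`. -/
theorem ghostD_split :
    B.ghostD = -((1 / 2 : ℂ) • ∑ α ∈ roots 𝔥, ∑ β ∈ roots 𝔥,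
        B.N α β • (B.c (-α) * (B.c (-β) * B.b (α + β))))
      + (1 / 2 : ℂ) • ∑ α ∈ roots 𝔥, ∑ i, B.cartan.repr (B.coroot α) i •
        (B.c (-α) * (B.c α * B.bH i))
      + ∑ i, B.cH i * B.ghostLH (B.cartan i) := by
  have h1 : ∀ α ∈ roots 𝔥, B.c (-α) * lieGhost B.basis (wedgeHom 𝔤) (substHom 𝔤) (B.τ α)
      = -(∑ β ∈ roots 𝔥, B.N α β • (B.c (-α) * (B.c (-β) * B.b (α + β))))
        + ∑ i, B.cartan.repr (B.coroot α) i • (B.c (-α) * (B.c α * B.bH i))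
        + ∑ i, α (B.cartan i) • (B.c (-α) * (B.cH i * B.b α)) := by
    intro α hα
    rw [← B.ghostL_eq hα, ghostL, mul_add, mul_add, ghost_mul_neg, Finset.mul_sum, Finset.mul_sum,
      Finset.mul_sum]
    simp only [mul_smul_comm]
  have h2 : ∑ α ∈ roots 𝔥, ∑ i, α (B.cartan i) • (B.c (-α) * (B.cH i * B.b α))
      = ∑ i, B.cH i * lieGhost B.basis (wedgeHom 𝔤) (substHom 𝔤) (B.cartan i) := by
    rw [Finset.sum_comm]
    refine Finset.sum_congr rfl fun i _ => ?_
    rw [B.lieGhost_cartan, ghost_mul_neg, Finset.mul_sum, ← Finset.sum_neg_distrib]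
    refine Finset.sum_congr rfl fun α _ => ?_
    have h3 : B.c (-α) * B.cH i = -(B.cH i * B.c (-α)) := isGhostSystem_ghost.C_C _ _
    have h4 : B.c (-α) * (B.cH i * B.b α) = -(B.cH i * (B.c (-α) * B.b α)) := by
      rw [← mul_assoc, ← mul_assoc, h3, ghost_neg_mul]
    rw [h4, mul_smul_comm]
    exact smul_neg _ _
  rw [B.ghostD_eq, B.chevalleyD_ghost, B.sum_cH_ghostLH, Finset.sum_congr rfl h1,
    Finset.sum_add_distrib, Finset.sum_add_distrib, h2, Finset.sum_neg_distrib]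
  module

/-- Every term of $D$ beyond the two components ends on the right in some $L^{\rm tot}_{H_i}$ or
some $b_i$, and therefore kills relative elements. -/
theorem totalD_apply {χ : Module.Dual ℂ (Cx 𝔤)} (hχ : B.IsRegularDominant χ) {Ψ : GhostV 𝔤 V}
    (hΨ : Ψ ∈ B.Crel ρ χ) : B.totalD ρ χ Ψ = (B.diffBarOp ρ χ + B.diffOp ρ χ) Ψ := by
  have h1 : B.totalD ρ χ = B.weighted ρ (fun _ => 1) (fun _ _ => 1)
      + (∑ i, onVHom 𝔤 V (B.cH i) * B.totalLH ρ χ (B.cartan i)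
      + (1 / 2 : ℂ) • ∑ α ∈ roots 𝔥, ∑ i, B.cartan.repr (B.coroot α) i •
        (B.cV V (-α) * B.cV V α * onVHom 𝔤 V (B.bH i))) := by
    have e1 : ∑ α ∈ roots 𝔥, tensorOp (B.c (-α)) (constraint ρ χ (B.τ α))
        = ∑ α ∈ roots 𝔥, B.cV V (-α) * B.tV ρ α :=
      Finset.sum_congr rfl fun α hα => by rw [B.constraint_τ ρ hχ hα, tensorOp_eq]; rfl
    have e2 : ∑ i, onVHom 𝔤 V (B.cH i) * B.totalLH ρ χ (B.cartan i)
        = ∑ i, tensorOp (B.cH i) (constraint ρ χ (B.cartan i))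
          + onVHom 𝔤 V (∑ i, B.cH i * B.ghostLH (B.cartan i)) := by
      rw [map_sum, ← Finset.sum_add_distrib]
      refine Finset.sum_congr rfl fun i _ => ?_
      rw [totalLH, mul_add, map_mul, tensorOp_eq (B.cH i), tensorOp_one, onV_eq]
    have e3 : onVHom 𝔤 V ((1 / 2 : ℂ) • ∑ α ∈ roots 𝔥, ∑ i, B.cartan.repr (B.coroot α) i •
          (B.c (-α) * (B.c α * B.bH i)))
        = (1 / 2 : ℂ) • ∑ α ∈ roots 𝔥, ∑ i, B.cartan.repr (B.coroot α) i •
          (B.cV V (-α) * B.cV V α * onVHom 𝔤 V (B.bH i)) := by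
      simp only [map_smul, map_sum, map_mul, mul_assoc]
      rfl
    have e4 : onVHom 𝔤 V (-((1 / 2 : ℂ) • ∑ α ∈ roots 𝔥, ∑ β ∈ roots 𝔥,
          B.N α β • (B.c (-α) * (B.c (-β) * B.b (α + β)))))
        = -((1 / 2 : ℂ) • ∑ α ∈ roots 𝔥, ∑ β ∈ roots 𝔥, B.N α β • B.cubic V α β) := by
      simp only [onVHom_neg, map_smul, map_sum, map_mul, cubic, mul_assoc]
      rfl
    rw [totalD, e1, e2, onV_eq, B.ghostD_split, map_add, map_add, e3, e4, weighted]
    simp only [one_smul, one_mul]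
    abel
  rw [B.diffBarOp_add_diffOp ρ hχ, h1, LinearMap.add_apply, add_eq_left, LinearMap.add_apply,
    LinearMap.smul_apply, LinearMap.sum_apply, LinearMap.sum_apply]
  rw [Finset.sum_eq_zero, Finset.sum_eq_zero, smul_zero, add_zero]
  · intro α _
    rw [LinearMap.sum_apply]
    refine Finset.sum_eq_zero fun i _ => ?_
    rw [LinearMap.smul_apply, Module.End.mul_apply, B.bH_apply ρ hΨ, map_zero, smul_zero]
  · intro i _
    rw [Module.End.mul_apply, ((B.mem_Crel ρ).1 hΨ).1, map_zero]

end Relative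
end ChevalleyBasis
end
end AnomalousBRST

namespace AnomalousBRST
noncomputable section

/-! ### Exterior monomials and multiplication by a generator. -/

section ExteriorBasis

variable {R M I : Type*} [CommRing R] [AddCommGroup M] [Module R M] [LinearOrder I]
  (b : Module.Basis I R M)

theorem extBasis_singleton (a : I) : b.ExteriorAlgebra {a} = ExteriorAlgebra.ι R (b a) := by
  have h := ExteriorAlgebra.basis_apply_ofCard b (s := {a}) (Finset.card_singleton a)
  rw [h, ExteriorAlgebra.ιMulti_family, ExteriorAlgebra.ιMulti_apply]
  have h0 := (Set.powersetCard.mem_range_ofFinEmbEquiv_symm_iff_mem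
    (Set.powersetCard.ofCard (Finset.card_singleton a))
    (Set.powersetCard.ofFinEmbEquiv.symm (Set.powersetCard.ofCard (Finset.card_singleton a)) 0)).1
    ⟨0, rfl⟩
  have h1 : Set.powersetCard.ofFinEmbEquiv.symm (Set.powersetCard.ofCard (Finset.card_singleton a)) 0
      = a := by
    exact Finset.mem_singleton.1 h0
  simp [h1]

theorem extBasis_empty : b.ExteriorAlgebra ∅ = 1 := by
  have h := ExteriorAlgebra.basis_apply_ofCard b (s := ∅) Finset.card_empty
  rw [h, ExteriorAlgebra.ιMulti_family, ExteriorAlgebra.ιMulti_apply]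
  simp

/-- Only the fact that the coefficient is $\pm1$ is kept: later uses need it to be real with square
$1$, never its value. -/
theorem ι_mul_extBasis {a : I} {S : Finset I} (ha : a ∉ S) :
    ∃ s : R, (s = 1 ∨ s = -1) ∧
      ExteriorAlgebra.ι R (b a) * b.ExteriorAlgebra S = s • b.ExteriorAlgebra (insert a S) := by
  have hd : Disjoint (Set.powersetCard.ofCard (Finset.card_singleton a)).val
      (Set.powersetCard.ofCard (rfl : S.card = S.card)).val := by
    simpa using ha
  have h := ExteriorAlgebra.basis_mul_of_disjoint b _ _ hd
  simp only [Set.powersetCard.val_ofCard, extBasis_singleton, Set.powersetCard.coe_disjUnion,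
    Finset.disjUnion_eq_union] at h
  rw [← Finset.insert_eq] at h
  rw [h]
  rcases Int.units_eq_one_or (Equiv.Perm.sign (Set.powersetCard.permOfDisjoint hd)) with e | e
  · exact ⟨1, Or.inl rfl, by rw [e, one_smul, one_smul]⟩
  · refine ⟨-1, Or.inr rfl, ?_⟩
    rw [e, Units.neg_smul, one_smul, neg_smul, one_smul]

end ExteriorBasis

namespace ChevalleyBasis

section Substitution

variable {𝔤 : Type*} [LieRing 𝔤] [LieAlgebra ℝ 𝔤]

theorem subst_one (x : Cx 𝔤) : subst x (1 : Ghost 𝔤) = 0 :=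
  CliffordAlgebra.contractLeft_one
    (Q := (0 : QuadraticForm ℂ (Module.Dual ℂ (Cx 𝔤)))) (Module.Dual.eval ℂ (Cx 𝔤) x)

theorem subst_wedge_apply (x : Cx 𝔤) (ξ : Module.Dual ℂ (Cx 𝔤)) (Φ : Ghost 𝔤) :
    subst x (wedge ξ Φ) = ξ x • Φ - wedge ξ (subst x Φ) :=
  eq_sub_of_add_eq (LinearMap.congr_fun (subst_wedge x ξ) Φ)

end Substitution

/-! ### Matrices of the ghost operators in the basis of monomials, and their reality. -/

section GhostBasis

variable {𝔤 : Type*} [LieRing 𝔤] [LieAlgebra ℝ 𝔤] [FiniteDimensional ℝ 𝔤]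
  {𝔥 : LieSubalgebra ℝ 𝔤} [𝔥.IsCartanSubalgebra] (B : ChevalleyBasis 𝔥)

theorem ghostBasis_empty : B.ghostBasis ∅ = 1 := by
  let : LinearOrder (Idx 𝔥) := idxOrder 𝔥
  exact extBasis_empty _

open Classical in
theorem wedge_ghostBasis {a : Idx 𝔥} {S : Finset (Idx 𝔥)} (ha : a ∉ S) :
    ∃ s : ℝ, (s = 1 ∨ s = -1) ∧
      wedge (B.basis.coord a) (B.ghostBasis S) = (s : ℂ) • B.ghostBasis (insert a S) := by
  have h := @ι_mul_extBasis ℂ (Module.Dual ℂ (Cx 𝔤)) (Idx 𝔥) _ _ _ (idxOrder 𝔥) B.basis.dualBasis a S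
    (by convert ha)
  obtain ⟨s, hs, h⟩ := h
  rw [Module.Basis.coe_dualBasis] at h
  have e : (@insert (Idx 𝔥) (Finset (Idx 𝔥)) (@Finset.instInsert _ (idxOrder 𝔥).toDecidableEq) a S)
      = insert a S := by
    congr!
  rw [e] at h
  rcases hs with rfl | rfl
  · exact ⟨1, Or.inl rfl, by rw [Complex.ofReal_one]; exact h⟩
  · exact ⟨-1, Or.inr rfl, by push_cast; exact h⟩

theorem sign_smul_cancel {E : Type*} [AddCommGroup E] [Module ℂ E] {s : ℝ} (hs : s = 1 ∨ s = -1)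
    {x y : E} (h : x = (s : ℂ) • y) : y = (s : ℂ) • x := by
  rw [h, smul_smul]
  rcases hs with rfl | rfl <;> norm_num

open Classical in
theorem coord_basis (a d : Idx 𝔥) : B.basis.coord a (B.basis d) = if a = d then 1 else 0 := by
  rw [Module.Basis.coord_apply, Module.Basis.repr_self]
  by_cases h : a = d
  · rw [h, if_pos rfl, Finsupp.single_eq_same]
  · rw [if_neg h, Finsupp.single_eq_of_ne h]

theorem subst_ghostBasis_of_notMem {a : Idx 𝔥} {S : Finset (Idx 𝔥)} (ha : a ∉ S) :
    subst (B.basis a) (B.ghostBasis S) = 0 := by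
  classical
  induction S using Finset.induction_on with
  | empty => rw [B.ghostBasis_empty, subst_one]
  | insert d S hd ih =>
    obtain ⟨s, hs, h⟩ := B.wedge_ghostBasis hd
    rw [Finset.mem_insert, not_or] at ha
    rw [sign_smul_cancel hs h, map_smul, subst_wedge_apply, ih ha.2, B.coord_basis,
      if_neg (Ne.symm ha.1), map_zero, zero_smul, sub_zero, smul_zero]

open Classical in
theorem subst_ghostBasis_insert {a : Idx 𝔥} {S : Finset (Idx 𝔥)} (ha : a ∉ S) :
    ∃ s : ℝ, (s = 1 ∨ s = -1) ∧
      subst (B.basis a) (B.ghostBasis (insert a S)) = (s : ℂ) • B.ghostBasis S := by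
  obtain ⟨s, hs, h⟩ := B.wedge_ghostBasis ha
  refine ⟨s, hs, ?_⟩
  rw [sign_smul_cancel hs h, map_smul, subst_wedge_apply, B.subst_ghostBasis_of_notMem ha, map_zero,
    sub_zero, B.coord_basis, if_pos rfl, one_smul]

theorem wedge_ghostBasis_of_mem {a : Idx 𝔥} {S : Finset (Idx 𝔥)} (ha : a ∈ S) :
    wedge (B.basis.coord a) (B.ghostBasis S) = 0 := by
  classical
  obtain ⟨s, hs, h⟩ := B.wedge_ghostBasis (Finset.notMem_erase a S)
  rw [Finset.insert_erase ha] at h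
  rw [sign_smul_cancel hs h, map_smul]
  have := LinearMap.congr_fun (wedge_sq (B.basis.coord a)) (B.ghostBasis (S.erase a))
  rw [Module.End.mul_apply, LinearMap.zero_apply] at this
  rw [this, smul_zero]

/-- Operators with real matrices in the basis of exterior monomials. -/
def IsRealOp (A : Module.End ℂ (Ghost 𝔤)) : Prop :=
  ∀ S T, starRingEnd ℂ (B.ghostBasis.repr (A (B.ghostBasis T)) S) = B.ghostBasis.repr (A (B.ghostBasis T)) S

namespace IsRealOp

variable {B}

theorem add {A A' : Module.End ℂ (Ghost 𝔤)} (h : B.IsRealOp A) (h' : B.IsRealOp A') :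
    B.IsRealOp (A + A') := fun S T => by
  rw [LinearMap.add_apply, map_add, Finsupp.add_apply, map_add, h, h']

theorem smul {A : Module.End ℂ (Ghost 𝔤)} (h : B.IsRealOp A) {t : ℂ} (ht : starRingEnd ℂ t = t) :
    B.IsRealOp (t • A) := fun S T => by
  rw [LinearMap.smul_apply, map_smul, Finsupp.smul_apply, smul_eq_mul, map_mul, h, ht]

theorem sub {A A' : Module.End ℂ (Ghost 𝔤)} (h : B.IsRealOp A) (h' : B.IsRealOp A') :
    B.IsRealOp (A - A') := fun S T => by
  rw [LinearMap.sub_apply, map_sub, Finsupp.sub_apply, map_sub, h, h']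

theorem one : B.IsRealOp 1 := fun S T => by
  rw [Module.End.one_apply, Module.Basis.repr_self]
  by_cases h : S = T
  · rw [h, Finsupp.single_eq_same, map_one]
  · rw [Finsupp.single_eq_of_ne h, map_zero]

theorem repr_mul (A A' : Module.End ℂ (Ghost 𝔤)) (S T : Finset (Idx 𝔥)) :
    B.ghostBasis.repr ((A * A') (B.ghostBasis T)) S
      = ∑ U, B.ghostBasis.repr (A' (B.ghostBasis T)) U * B.ghostBasis.repr (A (B.ghostBasis U)) S := by
  rw [Module.End.mul_apply]
  conv_lhs => rw [← B.ghostBasis.sum_repr (A' (B.ghostBasis T))]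
  simp only [map_sum, map_smul, Finsupp.coe_finsetSum, Finset.sum_apply, Finsupp.smul_apply,
    smul_eq_mul]

theorem mul {A A' : Module.End ℂ (Ghost 𝔤)} (h : B.IsRealOp A) (h' : B.IsRealOp A') :
    B.IsRealOp (A * A') := fun S T => by
  rw [repr_mul, map_sum]
  refine Finset.sum_congr rfl fun U _ => ?_
  rw [map_mul, h, h']

theorem list_prod {l : List (Module.End ℂ (Ghost 𝔤))} (h : ∀ A ∈ l, B.IsRealOp A) :
    B.IsRealOp l.prod := by
  induction l with
  | nil => exact one
  | cons A l ih =>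
    rw [List.prod_cons]
    exact (h A (by simp)).mul (ih fun A' hA' => h A' (by simp [hA']))

end IsRealOp

theorem star_repr_smul {s : ℝ} (S T : Finset (Idx 𝔥)) :
    starRingEnd ℂ (B.ghostBasis.repr ((s : ℂ) • B.ghostBasis T) S) = B.ghostBasis.repr ((s : ℂ) • B.ghostBasis T) S := by
  rw [map_smul, Finsupp.smul_apply, Module.Basis.repr_self, smul_eq_mul, map_mul]
  by_cases h : S = T
  · rw [h, Finsupp.single_eq_same, map_one]
    simp
  · rw [Finsupp.single_eq_of_ne h, map_zero]
    simp

theorem isRealOp_wedge (a : Idx 𝔥) : B.IsRealOp (wedge (B.basis.coord a)) := by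
  classical
  intro S T
  by_cases h : a ∈ T
  · rw [B.wedge_ghostBasis_of_mem h, map_zero, Finsupp.zero_apply, map_zero]
  · obtain ⟨s, -, e⟩ := B.wedge_ghostBasis h
    rw [e, B.star_repr_smul]

theorem isRealOp_subst (a : Idx 𝔥) : B.IsRealOp (subst (B.basis a)) := by
  classical
  intro S T
  by_cases h : a ∈ T
  · obtain ⟨s, -, e⟩ := B.subst_ghostBasis_insert (Finset.notMem_erase a T)
    rw [Finset.insert_erase h] at e
    rw [e, B.star_repr_smul]
  · rw [B.subst_ghostBasis_of_notMem h, map_zero, Finsupp.zero_apply, map_zero]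

theorem isRealOp_c {α : Functional 𝔥} (hα : α ∈ roots 𝔥) : B.IsRealOp (B.c α) := by
  rw [c, θ, dif_pos (B.mem_roots_neg_iff.2 hα)]
  exact B.isRealOp_wedge _

theorem isRealOp_b {α : Functional 𝔥} (hα : α ∈ roots 𝔥) : B.IsRealOp (B.b α) := by
  rw [b, B.τ_eq hα]
  exact B.isRealOp_subst _

end GhostBasis

/-! ### The Berezin pairing and its conjugation rules. -/

section GhostForm

variable {𝔤 : Type*} [LieRing 𝔤] [LieAlgebra ℝ 𝔤] [FiniteDimensional ℝ 𝔤]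
  {𝔥 : LieSubalgebra ℝ 𝔤} [𝔥.IsCartanSubalgebra] (B : ChevalleyBasis 𝔥)

/-- `preForm` as a bilinear map. -/
def preFormBil : Ghost 𝔤 →ₗ[ℂ] Ghost 𝔤 →ₗ[ℂ] ℂ :=
  (LinearMap.mul ℂ (Ghost 𝔤)).compr₂ B.top ∘ₗ
    (CliffordAlgebra.reverse (Q := (0 : QuadraticForm ℂ (Module.Dual ℂ (Cx 𝔤))))) ∘ₗ
    (ExteriorAlgebra.map B.conjForm).toLinearMap

theorem preFormBil_apply (Φ Ψ : Ghost 𝔤) : B.preFormBil Φ Ψ = B.preForm Φ Ψ := rfl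

theorem preForm_one (Ψ : Ghost 𝔤) : B.preForm 1 Ψ = B.top Ψ := by
  rw [preForm, map_one]
  rw [show (1 : Ghost 𝔤) = algebraMap ℂ (CliffordAlgebra 0) 1 from (map_one _).symm,
    CliffordAlgebra.reverse.commutes, map_one, one_mul]

theorem preForm_wedge (ξ : Module.Dual ℂ (Cx 𝔤)) (Φ Ψ : Ghost 𝔤) :
    B.preForm (wedge ξ Φ) Ψ = B.preForm Φ (wedge (B.conjForm ξ) Ψ) := by
  have h1 : CliffordAlgebra.reverse (ExteriorAlgebra.map B.conjForm (wedge ξ Φ))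
      = CliffordAlgebra.reverse (ExteriorAlgebra.map B.conjForm Φ)
        * ExteriorAlgebra.ι ℂ (B.conjForm ξ) := by
    rw [wedge, LinearMap.mulLeft_apply, map_mul, ExteriorAlgebra.map_apply_ι]
    refine (CliffordAlgebra.reverse.map_mul _ _).trans ?_
    congr 1
    exact CliffordAlgebra.reverse_ι _
  rw [preForm, preForm, h1, mul_assoc]
  rfl

/-- A substitution removes an index from each monomial, so the full index set never occurs in the
result. This is the integration-by-parts property of the Berezin integral. -/
theorem top_subst (x : Cx 𝔤) (Φ : Ghost 𝔤) : B.top (subst x Φ) = 0 := by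
  classical
  have h1 : ∀ a, B.top ∘ₗ subst (B.basis a) = 0 := by
    intro a
    refine B.ghostBasis.ext fun S => ?_
    rw [LinearMap.comp_apply, LinearMap.zero_apply]
    by_cases h : a ∈ S
    · obtain ⟨s, -, e⟩ := B.subst_ghostBasis_insert (Finset.notMem_erase a S)
      rw [Finset.insert_erase h] at e
      rw [e, map_smul, top, Module.Basis.coord_apply, Module.Basis.repr_self,
        Finsupp.single_eq_of_ne, smul_zero]
      intro e'
      have := Finset.mem_univ a
      rw [e'] at this
      exact Finset.notMem_erase a S this
    · rw [B.subst_ghostBasis_of_notMem h, map_zero]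
  have h2 : subst x = ∑ a, B.basis.repr x a • subst (B.basis a) := by
    rw [← substHom_apply]
    conv_lhs => rw [← B.basis.sum_repr x]
    rw [map_sum]
    simp only [map_smul]
    rfl
  rw [h2, LinearMap.sum_apply, map_sum]
  refine Finset.sum_eq_zero fun a _ => ?_
  rw [LinearMap.smul_apply, map_smul]
  have := LinearMap.congr_fun (h1 a) Φ
  rw [LinearMap.comp_apply, LinearMap.zero_apply] at this
  rw [this, smul_zero]

/-- Induction on the left argument. For scalars both sides vanish, the right one by `top_subst`; for
a further factor $\xi$, both sides are expanded by the contraction rule, and the hypothesis makes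
the two contraction constants agree. -/
theorem preForm_subst {x y : Cx 𝔤} (h : ∀ ξ : Module.Dual ℂ (Cx 𝔤), ξ x = B.conjForm ξ y)
    (Φ Ψ : Ghost 𝔤) : B.preForm (subst x Φ) Ψ = B.preForm Φ (subst y Ψ) := by
  revert Ψ
  refine CliffordAlgebra.left_induction (Q := (0 : QuadraticForm ℂ (Module.Dual ℂ (Cx 𝔤))))
    (P := fun Φ => ∀ Ψ, B.preForm (subst x Φ) Ψ = B.preForm Φ (subst y Ψ)) ?_ ?_ ?_ Φ
  · intro r Ψ
    have e : (algebraMap ℂ (CliffordAlgebra (0 : QuadraticForm ℂ (Module.Dual ℂ (Cx 𝔤)))) r)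
        = r • (1 : Ghost 𝔤) := Algebra.algebraMap_eq_smul_one r
    rw [e, map_smul, subst_one, smul_zero, ← preFormBil_apply, ← preFormBil_apply, map_zero,
      map_smul, LinearMap.zero_apply, LinearMap.smul_apply, preFormBil_apply, B.preForm_one,
      B.top_subst, smul_zero]
  · intro Φ Φ' h1 h2 Ψ
    rw [map_add, ← preFormBil_apply, ← preFormBil_apply, map_add, map_add, LinearMap.add_apply,
      LinearMap.add_apply]
    simp only [preFormBil_apply]
    rw [h1, h2]
  · intro Φ ξ ih Ψ
    change B.preForm (subst x (wedge ξ Φ)) Ψ = B.preForm (wedge ξ Φ) (subst y Ψ)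
    have e2 := subst_wedge_apply y (B.conjForm ξ) Ψ
    rw [← h ξ] at e2
    rw [subst_wedge_apply, B.preForm_wedge, ← preFormBil_apply, map_sub, map_smul,
      LinearMap.sub_apply, LinearMap.smul_apply, preFormBil_apply, preFormBil_apply,
      B.preForm_wedge, ih, e2, ← preFormBil_apply, ← preFormBil_apply, map_sub, map_smul,
      sub_sub_cancel]
    rfl

theorem conjForm_coord_inl {α : Functional 𝔥} (hα : α ∈ roots 𝔥) :
    B.conjForm (B.θ α) = -B.θ (-α) := by
  classical
  rw [θ, dif_pos hα, conjForm]
  have := B.basis.dualBasis.constr_basis ℂ (Sum.elim (fun α => -B.θ (-α.1)) B.θH) (Sum.inl ⟨α, hα⟩)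
  rw [Module.Basis.coe_dualBasis] at this
  exact this

theorem conjForm_θH (i : Fin (rank 𝔥)) : B.conjForm (B.θH i) = B.θH i := by
  classical
  have := B.basis.dualBasis.constr_basis ℂ (Sum.elim (fun α => -B.θ (-α.1)) B.θH) (Sum.inr i)
  rw [Module.Basis.coe_dualBasis] at this
  exact this

theorem conjForm_τ {α : Functional 𝔥} (hα : α ∈ roots 𝔥) (ξ : Module.Dual ℂ (Cx 𝔤)) :
    ξ (B.τ α) = B.conjForm ξ (-B.τ (-α)) := by
  classical
  have key : LinearMap.applyₗ (B.τ α) = LinearMap.applyₗ (-B.τ (-α)) ∘ₗ B.conjForm := by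
    refine B.basis.dualBasis.ext fun a => ?_
    rw [Module.Basis.coe_dualBasis]
    simp only [LinearMap.comp_apply, LinearMap.applyₗ_apply_apply]
    rcases a with a | i
    · rw [B.coord_inl, B.conjForm_coord_inl a.2, map_neg, LinearMap.neg_apply, neg_neg,
        B.θ_τ a.2 hα, B.θ_τ (B.mem_roots_neg_iff.2 a.2) (B.mem_roots_neg_iff.2 hα)]
      simp only [neg_inj]
    · have h := B.conjForm_θH i
      rw [θH] at h
      rw [h, map_neg, B.τ_eq hα, B.τ_eq (B.mem_roots_neg_iff.2 hα)]
      simp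
  exact LinearMap.congr_fun key ξ

theorem ghostForm_c {α : Functional 𝔥} (hα : α ∈ roots 𝔥) (Φ Ψ : Ghost 𝔤) :
    B.ghostForm (B.c α Φ) Ψ = -B.ghostForm Φ (B.c (-α) Ψ) := by
  rw [ghostForm, ghostForm, c, B.preForm_wedge, B.conjForm_coord_inl (B.mem_roots_neg_iff.2 hα),
    wedge_neg, LinearMap.neg_apply, ← preFormBil_apply, map_neg, neg_div]
  rfl

theorem ghostForm_b {α : Functional 𝔥} (hα : α ∈ roots 𝔥) (Φ Ψ : Ghost 𝔤) :
    B.ghostForm (B.b α Φ) Ψ = -B.ghostForm Φ (B.b (-α) Ψ) := by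
  rw [ghostForm, ghostForm, b, B.preForm_subst (B.conjForm_τ hα), subst_neg,
    LinearMap.neg_apply, ← preFormBil_apply, map_neg, neg_div]
  rfl

end GhostForm
end ChevalleyBasis
end
end AnomalousBRST

namespace AnomalousBRST
noncomputable section

namespace ChevalleyBasis

/-! ### Star exchanges ghosts and anti-ghosts. -/

section StarOperator

variable {𝔤 : Type*} [LieRing 𝔤] [LieAlgebra ℝ 𝔤] [FiniteDimensional ℝ 𝔤]
  {𝔥 : LieSubalgebra ℝ 𝔤} [𝔥.IsCartanSubalgebra] (B : ChevalleyBasis 𝔥)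

theorem add_self_ne_zero (B : ChevalleyBasis 𝔥) {α : Functional 𝔥} (hα : α ∈ roots 𝔥) :
    α + α ≠ 0 := by
  rw [← two_smul ℂ α]
  exact smul_ne_zero two_ne_zero (B.ne_zero_of_mem_roots hα)

theorem starFactor_b_neg (χ : Module.Dual ℂ (Cx 𝔤)) {α : Functional 𝔥} (hα : α ∈ roots 𝔥)
    (hr : B.r χ α ≠ 0) :
    B.starFactor χ α * B.b (-α)
      = ((-1 : ℂ) ^ (rank 𝔥 + 1) * B.r χ α) • (B.c (-α) * B.starFactor χ α) := by
  have hn := B.mem_roots_neg_iff.2 hα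
  have h2 := B.b_c_self hn
  rw [neg_neg] at h2
  refine factor_left (by rw [← mul_pow]; simp) hr ?_ (B.b_b _ _) ?_ (subst_sq _) (wedge_sq _)
  · rw [h2, sub_sub_cancel]
  · rw [B.b_c hn hn, neg_neg]
    rw [← neg_add, neg_ne_zero]
    exact B.add_self_ne_zero hα

theorem starFactor_c_neg (χ : Module.Dual ℂ (Cx 𝔤)) {α : Functional 𝔥} (hα : α ∈ roots 𝔥)
    (hr : B.r χ α ≠ 0) :
    B.starFactor χ α * B.c (-α)
      = ((-1 : ℂ) ^ (rank 𝔥 + 1) * (B.r χ α)⁻¹) • (B.b (-α) * B.starFactor χ α) :=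
  factor_right (by rw [← mul_pow]; simp) hr (B.b_c_self hα) (B.c_c _ _) (subst_sq _) (wedge_sq _)

theorem factor_flip {E : Type*} [Ring E] [Algebra ℂ E] {A a C d : E} {ε r : ℂ}
    (hAa : a * A = 1 - A * a) (hCd : d * C = 1 - C * d) (hCa : a * C = -(C * a))
    (hAd : d * A = -(A * d)) :
    1 - d * C - a * A + ε • (r • (a * C) + r⁻¹ • (d * A))
      = -(1 - A * a - C * d + ε • (r • (C * a) + r⁻¹ • (A * d))) := by
  rw [hAa, hCd, hCa, hAd]
  simp only [smul_neg, smul_add]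
  abel

/-- Replacing $\alpha$ by $-\alpha$ reverses the order of every product in the factor; the canonical
relations then turn $1-x-y$ into $-1+x+y$ and negate the quadratic terms of the last bracket. The
overall sign drops out of relations that are linear in the factor on both sides. -/
theorem starFactor_neg (χ : Module.Dual ℂ (Cx 𝔤)) {α : Functional 𝔥} (hα : α ∈ roots 𝔥) :
    B.starFactor χ (-α) = -B.starFactor χ α := by
  have h2 := B.b_c_self (B.mem_roots_neg_iff.2 hα)
  rw [neg_neg] at h2
  rw [starFactor, starFactor, neg_neg, B.r_neg χ hα]
  exact factor_flip (by rw [h2, sub_sub_cancel]) (B.b_c_self hα) (B.c_c _ _) (B.b_b _ _)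

theorem starFactor_commute_b (χ : Module.Dual ℂ (Cx 𝔤)) {α β : Functional 𝔥} (hα : α ∈ roots 𝔥)
    (hβ : β ∈ roots 𝔥) (h : β ≠ α) (h' : β ≠ -α) : Commute (B.starFactor χ β) (B.b α) := by
  refine factor_comm (B.b_b _ _) ?_ ?_ (B.b_b _ _)
  · rw [B.b_c hα hβ (fun e => h' (eq_neg_of_add_eq_zero_right e)), neg_neg]
  · rw [B.b_c hα (B.mem_roots_neg_iff.2 hβ), neg_neg]
    rw [← sub_eq_add_neg, sub_ne_zero]
    exact h.symm

theorem starFactor_commute_c (χ : Module.Dual ℂ (Cx 𝔤)) {α β : Functional 𝔥} (hα : α ∈ roots 𝔥)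
    (hβ : β ∈ roots 𝔥) (h : β ≠ α) (h' : β ≠ -α) : Commute (B.starFactor χ β) (B.c α) := by
  refine factor_comm ?_ (B.c_c _ _) (B.c_c _ _) ?_
  · rw [B.b_c (B.mem_roots_neg_iff.2 hβ) hα]
    rw [neg_add_eq_sub, sub_ne_zero]
    exact h.symm
  · rw [B.b_c hβ hα]
    exact fun e => h' (eq_neg_of_add_eq_zero_left e)

/-- Only the factor of star belonging to the positive one of $\alpha,-\alpha$ involves these modes.
The other factors are even in anticommuting modes and commute with them, so the relation for one
factor passes to the product. -/
theorem star_intertwine (χ : Module.Dual ℂ (Cx 𝔤)) {α : Functional 𝔥} (hα : α ∈ roots 𝔥)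
    (hr : B.r χ α ≠ 0) :
    B.star χ * B.b α = ((-1 : ℂ) ^ (rank 𝔥 + 1) * B.r χ α) • (B.c α * B.star χ) ∧
    B.star χ * B.c α = ((-1 : ℂ) ^ (rank 𝔥 + 1) * (B.r χ α)⁻¹) • (B.b α * B.star χ) := by
  have hn := B.mem_roots_neg_iff.2 hα
  have hb := B.starFactor_b_neg χ hn (by rwa [B.r_neg χ hα])
  have hc := B.starFactor_c_neg χ hn (by rwa [B.r_neg χ hα])
  rw [neg_neg, B.r_neg χ hα] at hb hc
  -- `β` is the positive root among $\pm\alpha$; for positive $\alpha$ the relation known for the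
  -- factor at $-\alpha$ is transferred by `starFactor_neg`.
  obtain ⟨β, hβ, hβα, hb, hc⟩ : ∃ β ∈ B.pos, (β = α ∨ β = -α) ∧
      B.starFactor χ β * B.b α
        = ((-1 : ℂ) ^ (rank 𝔥 + 1) * B.r χ α) • (B.c α * B.starFactor χ β) ∧
      B.starFactor χ β * B.c α
        = ((-1 : ℂ) ^ (rank 𝔥 + 1) * (B.r χ α)⁻¹) • (B.b α * B.starFactor χ β) := by
    rcases (B.mem_roots_iff α).1 hα with h | h
    · rw [B.starFactor_neg χ hα] at hb hc
      refine ⟨α, h, Or.inl rfl, ?_, ?_⟩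
      · rw [ghost_mul_neg, ghost_neg_mul, smul_neg] at hb
        exact neg_injective hb
      · rw [ghost_mul_neg, ghost_neg_mul, smul_neg] at hc
        exact neg_injective hc
    · exact ⟨-α, h, Or.inr rfl, hb, hc⟩
  have hne : ∀ j, j ≠ β → -j ≠ β → j ≠ α ∧ j ≠ -α := by
    rintro j h1 h2
    rcases hβα with rfl | rfl
    · exact ⟨h1, fun e => h2 (by rw [e, neg_neg])⟩
    · exact ⟨fun e => h2 (by rw [e]), h1⟩
  have hneg : ∀ j ∈ B.pos, -j ≠ β := fun j hj e => B.neg_notMem_pos j hj (e ▸ hβ)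
  have kb : ∀ j ∈ B.pos, j ≠ β → Commute (B.starFactor χ j) (B.b α) := fun j hj h =>
    B.starFactor_commute_b χ hα (B.pos_subset hj) (hne j h (hneg j hj)).1 (hne j h (hneg j hj)).2
  have kc : ∀ j ∈ B.pos, j ≠ β → Commute (B.starFactor χ j) (B.c α) := fun j hj h =>
    B.starFactor_commute_c χ hα (B.pos_subset hj) (hne j h (hneg j hj)).1 (hne j h (hneg j hj)).2
  exact ⟨prod_intertwine (l := B.pos.toList) hb kb kc (fun j hj => Finset.mem_toList.1 hj)
      B.pos.nodup_toList (Finset.mem_toList.2 hβ),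
    prod_intertwine (l := B.pos.toList) hc kc kb (fun j hj => Finset.mem_toList.1 hj)
      B.pos.nodup_toList (Finset.mem_toList.2 hβ)⟩

theorem upsilon_intertwine {X : Module.End ℂ (Ghost 𝔤)} (hX : ∀ i, X * B.cH i = -(B.cH i * X)) :
    X * B.upsilon = (-1 : ℂ) ^ rank 𝔥 • (B.upsilon * X) := by
  have h := list_intertwine (S := X) (f := B.cH) (g := B.cH) (k := fun _ => (-1 : ℂ))
    (List.finRange (rank 𝔥)) fun i _ => by rw [hX, neg_smul, one_smul]
  rw [upsilon, List.ofFn_eq_map]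
  simpa using h

theorem upsilon_b {α : Functional 𝔥} (hα : α ∈ roots 𝔥) :
    B.b α * B.upsilon = (-1 : ℂ) ^ rank 𝔥 • (B.upsilon * B.b α) := by
  refine B.upsilon_intertwine fun i => eq_neg_of_add_eq_zero_left ?_
  have h0 : B.θH i (B.τ α) = 0 := by
    rw [B.τ_eq hα, θH, B.coord_basis, if_neg (by simp)]
  have := subst_wedge (B.τ α) (B.θH i)
  rw [h0, zero_smul] at this
  exact this

theorem upsilon_c (α : Functional 𝔥) :
    B.c α * B.upsilon = (-1 : ℂ) ^ rank 𝔥 • (B.upsilon * B.c α) :=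
  B.upsilon_intertwine fun _ => eq_neg_of_add_eq_zero_left (wedge_wedge _ _)

/-- The pairing conjugates coordinates of its first argument; real matrix entries allow star to be
absorbed there into the bilinear form. -/
theorem isRealOp_star {χ : Module.Dual ℂ (Cx 𝔤)}
    (hr : ∀ α ∈ B.pos, starRingEnd ℂ (B.r χ α) = B.r χ α) : B.IsRealOp (B.star χ) := by
  refine IsRealOp.list_prod fun A hA => ?_
  obtain ⟨α, hα, rfl⟩ := List.mem_map.1 hA
  rw [Finset.mem_toList] at hα
  have h1 := B.pos_subset hα
  have h2 := B.neg_mem_roots hα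
  refine (((IsRealOp.one).sub ((B.isRealOp_b h2).mul (B.isRealOp_c h1))).sub
    ((B.isRealOp_c h2).mul (B.isRealOp_b h1))).add (IsRealOp.smul (IsRealOp.add
      (IsRealOp.smul ((B.isRealOp_c h2).mul (B.isRealOp_c h1)) (hr α hα))
      (IsRealOp.smul ((B.isRealOp_b h2).mul (B.isRealOp_b h1)) ?_)) ?_)
  · rw [map_inv₀, hr α hα]
  · simp

end StarOperator

/-! ### Nonvanishing of the normalization constant of the pairing. -/

section Normalization

variable {𝔤 : Type*} [LieRing 𝔤] [LieAlgebra ℝ 𝔤] [FiniteDimensional ℝ 𝔤]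
  {𝔥 : LieSubalgebra ℝ 𝔤} [𝔥.IsCartanSubalgebra] (B : ChevalleyBasis 𝔥)

/-- `Φ` is, up to a sign, the exterior monomial with index set `S`. -/
def IsMonomial (S : Finset (Idx 𝔥)) (Φ : Ghost 𝔤) : Prop :=
  ∃ s : ℝ, (s = 1 ∨ s = -1) ∧ Φ = (s : ℂ) • B.ghostBasis S

variable {B}

theorem IsMonomial.neg {S : Finset (Idx 𝔥)} {Φ : Ghost 𝔤} (h : B.IsMonomial S Φ) :
    B.IsMonomial S (-Φ) := by
  obtain ⟨s, hs, rfl⟩ := h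
  refine ⟨-s, hs.elim (fun e => Or.inr (by rw [e])) fun e => Or.inl (by rw [e, neg_neg]), ?_⟩
  push_cast
  rw [neg_smul]

open Classical in
theorem IsMonomial.wedge {S : Finset (Idx 𝔥)} {Φ : Ghost 𝔤} (h : B.IsMonomial S Φ) {a : Idx 𝔥}
    (ha : a ∉ S) : B.IsMonomial (insert a S) (wedge (B.basis.coord a) Φ) := by
  obtain ⟨s, hs, rfl⟩ := h
  obtain ⟨t, ht, e⟩ := B.wedge_ghostBasis ha
  refine ⟨s * t, ?_, ?_⟩
  · rcases hs with rfl | rfl <;> rcases ht with rfl | rfl <;> simp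
  · rw [map_smul, e, smul_smul]
    push_cast
    rfl

variable (B)

theorem isMonomial_one : B.IsMonomial ∅ 1 :=
  ⟨1, Or.inl rfl, by rw [B.ghostBasis_empty, Complex.ofReal_one, one_smul]⟩

open Classical in
/-- The indices of the forms `θ^{-α}` for `α` in a list of roots. -/
def negIdx (l : List (Functional 𝔥)) : Finset (Idx 𝔥) :=
  Finset.univ.filter fun a => ∃ β : {α // α ∈ roots 𝔥}, a = Sum.inl β ∧ -β.1 ∈ l

open Classical in
/-- The indices of the forms `θ^α` for `α` in a list of roots. -/
def posIdx (l : List (Functional 𝔥)) : Finset (Idx 𝔥) :=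
  Finset.univ.filter fun a => ∃ β : {α // α ∈ roots 𝔥}, a = Sum.inl β ∧ β.1 ∈ l

theorem isMonomial_list {l : List (Functional 𝔥)} (hl : l.Nodup) (hp : ∀ α ∈ l, α ∈ roots 𝔥) :
    B.IsMonomial (negIdx l) (l.map fun α => ExteriorAlgebra.ι ℂ (B.θ (-α))).prod := by
  classical
  induction l with
  | nil =>
    have : (negIdx ([] : List (Functional 𝔥))) = ∅ := by
      ext a; simp [negIdx]
    rw [this]
    exact B.isMonomial_one
  | cons α l ih =>
    rw [List.nodup_cons] at hl
    have hα := B.mem_roots_neg_iff.2 (hp α (by simp))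
    have h := (ih hl.2 fun β hβ => hp β (by simp [hβ])).wedge (a := Sum.inl ⟨-α, hα⟩) (by
      simp only [negIdx, Finset.mem_filter, Finset.mem_univ, true_and, not_exists]
      rintro β ⟨e, hβ⟩
      rw [← Sum.inl.inj e, neg_neg] at hβ
      exact hl.1 hβ)
    have e : negIdx (α :: l) = insert (Sum.inl ⟨-α, hα⟩ : Idx 𝔥) (negIdx l) := by
      ext a
      simp only [negIdx, Finset.mem_filter, Finset.mem_univ, true_and, Finset.mem_insert,
        List.mem_cons]
      constructor
      · rintro ⟨β, rfl, h | h⟩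
        · left
          congr 1
          exact Subtype.ext (neg_eq_iff_eq_neg.1 h)
        · exact Or.inr ⟨β, rfl, h⟩
      · rintro (rfl | ⟨β, rfl, h⟩)
        · exact ⟨_, rfl, Or.inl (neg_neg α)⟩
        · exact ⟨β, rfl, Or.inr h⟩
    rw [e, List.map_cons, List.prod_cons]
    rw [B.coord_inl] at h
    exact h

theorem isMonomial_vacuum : B.IsMonomial (negIdx B.pos.toList) B.vacuum :=
  B.isMonomial_list B.pos.nodup_toList fun _ hα => B.pos_subset (Finset.mem_toList.1 hα)

open Classical in
theorem isMonomial_cartan {l : List (Fin (rank 𝔥))} (hl : l.Nodup) {S : Finset (Idx 𝔥)}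
    (hS : ∀ i, Sum.inr i ∉ S) {Φ : Ghost 𝔤} (h : B.IsMonomial S Φ) :
    B.IsMonomial (S ∪ (l.map Sum.inr).toFinset) ((l.map B.cH).prod Φ) := by
  induction l with
  | nil => simpa using h
  | cons i l ih =>
    rw [List.nodup_cons] at hl
    have h1 := (ih hl.2).wedge (a := Sum.inr i) (by
      simp only [Finset.mem_union, hS i, List.mem_toFinset, List.mem_map, Sum.inr.injEq,
        exists_eq_right, hl.1, or_self, not_false_eq_true])
    rw [List.map_cons, List.toFinset_cons, Finset.union_insert, List.map_cons]
    exact h1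

theorem inr_notMem_negIdx (_ : ChevalleyBasis 𝔥) (l : List (Functional 𝔥)) (i : Fin (rank 𝔥)) :
    (Sum.inr i : Idx 𝔥) ∉ negIdx l := by
  simp [negIdx]

/-- The factors $\theta^{-\alpha}$ are moved one at a time to the second argument, where each
becomes $-\theta^\alpha$. Complementarity of the index sets guarantees that no factor is repeated
and that the process ends at $\pm$ the top monomial. -/
theorem preForm_list_ne_zero {l : List (Functional 𝔥)} (hl : l.Nodup)
    (hp : ∀ α ∈ l, α ∈ roots 𝔥) {S : Finset (Idx 𝔥)} (hS : Disjoint S (posIdx l))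
    (hu : ∀ a, a ∈ S ∨ a ∈ posIdx l) {Φ : Ghost 𝔤} (h : B.IsMonomial S Φ) :
    B.preForm (l.map fun α => ExteriorAlgebra.ι ℂ (B.θ (-α))).prod Φ ≠ 0 := by
  classical
  induction l generalizing S Φ with
  | nil =>
    have hS : S = Finset.univ := by
      ext a
      simpa [posIdx] using hu a
    obtain ⟨s, hs, rfl⟩ := h
    rw [List.map_nil, List.prod_nil, B.preForm_one, map_smul, top, hS, Module.Basis.coord_apply,
      Module.Basis.repr_self, Finsupp.single_eq_same]
    rcases hs with rfl | rfl <;> simp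
  | cons α l ih =>
    rw [List.nodup_cons] at hl
    have hα := hp α (by simp)
    have e : posIdx (α :: l) = insert (Sum.inl ⟨α, hα⟩ : Idx 𝔥) (posIdx l) := by
      ext a
      simp only [posIdx, Finset.mem_filter, Finset.mem_univ, true_and, Finset.mem_insert,
        List.mem_cons]
      constructor
      · rintro ⟨β, rfl, h | h⟩
        · left
          congr 1
          exact Subtype.ext h
        · exact Or.inr ⟨β, rfl, h⟩
      · rintro (rfl | ⟨β, rfl, h⟩)
        · exact ⟨_, rfl, Or.inl rfl⟩
        · exact ⟨β, rfl, Or.inr h⟩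
    rw [e, Finset.disjoint_insert_right] at hS
    have hmon := (h.wedge hS.1).neg
    rw [List.map_cons, List.prod_cons]
    change B.preForm (AnomalousBRST.wedge (B.θ (-α)) _) Φ ≠ 0
    rw [B.preForm_wedge, B.conjForm_coord_inl (B.mem_roots_neg_iff.2 hα), neg_neg, wedge_neg]
    rw [B.coord_inl] at hmon
    refine ih hl.2 (fun β hβ => hp β (by simp [hβ])) ?_ ?_ hmon
    · rw [Finset.disjoint_insert_left]
      refine ⟨?_, hS.2⟩
      simp only [posIdx, Finset.mem_filter, Finset.mem_univ, true_and, not_exists]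
      rintro β ⟨e, hβ⟩
      rw [← Sum.inl.inj e] at hβ
      exact hl.1 hβ
    · intro a
      rw [Finset.mem_insert]
      have := hu a
      rw [e, Finset.mem_insert] at this
      tauto

/-- This justifies the division in `ghostForm`, which would otherwise return the default value $0$.
The vacuum carries the negative roots, $\upsilon$ the Cartan indices, and conjugating the first
vacuum supplies the positive roots. -/
theorem preForm_vacuum_ne_zero : B.preForm B.vacuum (B.upsilon B.vacuum) ≠ 0 := by
  classical
  have h := B.isMonomial_cartan (List.nodup_finRange (rank 𝔥))
    (B.inr_notMem_negIdx B.pos.toList) B.isMonomial_vacuum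
  have hu : B.upsilon = ((List.finRange (rank 𝔥)).map B.cH).prod := by
    rw [upsilon, List.ofFn_eq_map]
  rw [← hu] at h
  refine B.preForm_list_ne_zero B.pos.nodup_toList
    (fun _ hα => B.pos_subset (Finset.mem_toList.1 hα)) ?_ ?_ h
  · rw [Finset.disjoint_left]
    intro a ha hb
    simp only [posIdx, negIdx, Finset.mem_filter, Finset.mem_univ, true_and, Finset.mem_union,
      Finset.mem_toList, List.mem_toFinset, List.mem_map] at ha hb
    obtain ⟨β, rfl, hβ⟩ := hb
    rcases ha with ⟨γ, e, hγ⟩ | ⟨i, -, e⟩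
    · rw [← Sum.inl.inj e] at hγ
      exact B.neg_notMem_pos _ hβ hγ
    · cases e
  · intro a
    simp only [posIdx, negIdx, Finset.mem_filter, Finset.mem_univ, true_and, Finset.mem_union,
      Finset.mem_toList, List.mem_toFinset, List.mem_map]
    rcases a with a | i
    · rcases (B.mem_roots_iff a.1).1 a.2 with h | h
      · exact Or.inr ⟨a, rfl, h⟩
      · exact Or.inl (Or.inl ⟨a, rfl, h⟩)
    · exact Or.inl (Or.inr ⟨i, List.mem_finRange i, rfl⟩)

theorem ghostForm_vacuum : B.ghostForm B.vacuum (B.upsilon B.vacuum) = 1 :=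
  div_self B.preForm_vacuum_ne_zero

end Normalization

end ChevalleyBasis
end
end AnomalousBRST

namespace AnomalousBRST
noncomputable section

namespace ChevalleyBasis

/-! ### Sesquilinear forms on $\mathcal C\otimes V$ induced by bilinear forms on ghosts. -/

section Sesquilinear

variable {𝔤 : Type*} [LieRing 𝔤] [LieAlgebra ℝ 𝔤] [FiniteDimensional ℝ 𝔤]
  {𝔥 : LieSubalgebra ℝ 𝔤} [𝔥.IsCartanSubalgebra] (B : ChevalleyBasis 𝔥)
  {V : Type*} [NormedAddCommGroup V] [InnerProductSpace ℂ V]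

theorem coeff_tmul (S : Finset (Idx 𝔥)) (Φ : Ghost 𝔤) (v : V) :
    B.coeff V S (Φ ⊗ₜ[ℂ] v : Ghost 𝔤 ⊗[ℂ] V) = B.ghostBasis.repr Φ S • v := rfl

theorem sum_coeff (Ψ : GhostV 𝔤 V) :
    Ψ = ∑ S : Finset (Idx 𝔥), (B.ghostBasis S ⊗ₜ[ℂ] B.coeff V S Ψ : Ghost 𝔤 ⊗[ℂ] V) := by
  refine TensorProduct.induction_on (motive := fun Ψ : Ghost 𝔤 ⊗[ℂ] V =>
    Ψ = ∑ S : Finset (Idx 𝔥), (B.ghostBasis S ⊗ₜ[ℂ] B.coeff V S Ψ : Ghost 𝔤 ⊗[ℂ] V)) Ψ ?_ ?_ ?_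
  · have : ∀ S, B.coeff V S (0 : Ghost 𝔤 ⊗[ℂ] V) = 0 := fun S => map_zero (B.coeff V S)
    simp only [this, TensorProduct.tmul_zero, Finset.sum_const_zero]
  · intro Φ v
    simp only [coeff_tmul, ← TensorProduct.smul_tmul]
    rw [← TensorProduct.sum_tmul, B.ghostBasis.sum_repr]
  · intro x y hx hy
    have : ∀ S, B.coeff V S (x + y : Ghost 𝔤 ⊗[ℂ] V) = B.coeff V S x + B.coeff V S y :=
      fun S => map_add (B.coeff V S) x y
    simp only [this, TensorProduct.tmul_add, Finset.sum_add_distrib]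
    rw [← hx, ← hy]

theorem coeff_onV (S : Finset (Idx 𝔥)) (A : Module.End ℂ (Ghost 𝔤)) (Ψ : GhostV 𝔤 V) :
    B.coeff V S (onV V A Ψ)
      = ∑ T, B.ghostBasis.repr (A (B.ghostBasis T)) S • B.coeff V T Ψ := by
  conv_lhs => rw [B.sum_coeff Ψ]
  exact (congrArg (B.coeff V S) (map_sum (onV V A) _ _)).trans (map_sum (B.coeff V S) _ _)

theorem coeff_opV (S : Finset (Idx 𝔥)) (T : Module.End ℂ V) (Ψ : GhostV 𝔤 V) :
    B.coeff V S (opV 𝔤 V T Ψ) = T (B.coeff V S Ψ) := by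
  refine TensorProduct.induction_on (motive := fun Ψ : Ghost 𝔤 ⊗[ℂ] V =>
    B.coeff V S (opV 𝔤 V T Ψ) = T (B.coeff V S Ψ)) Ψ ?_ ?_ ?_
  · exact (congrArg (B.coeff V S) (map_zero (opV 𝔤 V T))).trans
      ((map_zero (B.coeff V S)).trans
        (((congrArg T (map_zero (B.coeff V S))).trans (map_zero T)).symm))
  · intro Φ v
    exact (map_smul T _ _).symm
  · intro x y hx hy
    exact (congrArg (B.coeff V S) (map_add (opV 𝔤 V T) x y)).trans
      ((map_add (B.coeff V S) _ _).trans ((congrArg₂ (· + ·) hx hy).trans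
      ((map_add T _ _).symm.trans (congrArg T (map_add (B.coeff V S) x y).symm))))

/-- The sesquilinear form on `𝒞(V)` induced by a bilinear form on `𝒞` and the inner product. -/
def sesq (K : Ghost 𝔤 →ₗ[ℂ] Ghost 𝔤 →ₗ[ℂ] ℂ) (Ψ Ψ' : GhostV 𝔤 V) : ℂ :=
  ∑ S : Finset (Idx 𝔥), ∑ T : Finset (Idx 𝔥),
    K (B.ghostBasis S) (B.ghostBasis T) * inner ℂ (B.coeff V S Ψ) (B.coeff V T Ψ')

variable (K : Ghost 𝔤 →ₗ[ℂ] Ghost 𝔤 →ₗ[ℂ] ℂ)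

theorem sesq_add_right (Ψ Ψ₁ Ψ₂ : GhostV 𝔤 V) :
    B.sesq K Ψ (Ψ₁ + Ψ₂) = B.sesq K Ψ Ψ₁ + B.sesq K Ψ Ψ₂ := by
  simp only [sesq, map_add, inner_add_right, mul_add, Finset.sum_add_distrib]

theorem sesq_smul_right (z : ℂ) (Ψ Ψ' : GhostV 𝔤 V) :
    B.sesq K Ψ (z • Ψ') = z * B.sesq K Ψ Ψ' := by
  simp only [sesq, map_smul, inner_smul_right, Finset.mul_sum]
  refine Finset.sum_congr rfl fun S _ => Finset.sum_congr rfl fun T _ => ?_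
  ring

theorem sesq_add_left (Ψ₁ Ψ₂ Ψ : GhostV 𝔤 V) :
    B.sesq K (Ψ₁ + Ψ₂) Ψ = B.sesq K Ψ₁ Ψ + B.sesq K Ψ₂ Ψ := by
  simp only [sesq, map_add, inner_add_left, mul_add, Finset.sum_add_distrib]

theorem sesq_smul_left (z : ℂ) (Ψ Ψ' : GhostV 𝔤 V) :
    B.sesq K (z • Ψ) Ψ' = starRingEnd ℂ z * B.sesq K Ψ Ψ' := by
  simp only [sesq, map_smul, inner_smul_left, Finset.mul_sum]
  refine Finset.sum_congr rfl fun S _ => Finset.sum_congr rfl fun T _ => ?_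
  ring

/-- Moving an operator out of the conjugate-linear argument conjugates its matrix entries, hence the
reality assumption. No such assumption is needed on the right. -/
theorem sesq_onV_left {A : Module.End ℂ (Ghost 𝔤)} (hA : B.IsRealOp A) (Ψ Ψ' : GhostV 𝔤 V) :
    B.sesq K (onV V A Ψ) Ψ' = B.sesq (K ∘ₗ A) Ψ Ψ' := by
  have h : ∀ S, A (B.ghostBasis S)
      = ∑ U, B.ghostBasis.repr (A (B.ghostBasis S)) U • B.ghostBasis U :=
    fun S => (B.ghostBasis.sum_repr _).symm
  simp only [sesq, coeff_onV, sum_inner, inner_smul_left, LinearMap.comp_apply]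
  conv_rhs =>
    enter [2, S, 2, T]
    rw [h S, map_sum, LinearMap.sum_apply, Finset.sum_mul]
  simp only [map_smul, LinearMap.smul_apply, smul_eq_mul, Finset.mul_sum]
  rw [Finset.sum_comm]
  rw [Finset.sum_comm' (t' := Finset.univ) (s' := fun _ => Finset.univ) (by simp)]
  conv_lhs => enter [2, S]; rw [Finset.sum_comm]
  conv_lhs => rw [Finset.sum_comm]
  refine Finset.sum_congr rfl fun S _ => ?_
  rw [Finset.sum_comm]
  refine Finset.sum_congr rfl fun T _ => Finset.sum_congr rfl fun U _ => ?_
  rw [hA]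
  ring

theorem sesq_onV_right (A : Module.End ℂ (Ghost 𝔤)) (Ψ Ψ' : GhostV 𝔤 V) :
    B.sesq K Ψ (onV V A Ψ') = B.sesq (K.compl₂ A) Ψ Ψ' := by
  have h : ∀ S, A (B.ghostBasis S)
      = ∑ U, B.ghostBasis.repr (A (B.ghostBasis S)) U • B.ghostBasis U :=
    fun S => (B.ghostBasis.sum_repr _).symm
  simp only [sesq, coeff_onV, inner_sum, inner_smul_right, LinearMap.compl₂_apply]
  refine Finset.sum_congr rfl fun S _ => ?_
  conv_rhs =>
    enter [2, T]
    rw [h T, map_sum, Finset.sum_mul]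
  simp only [map_smul, smul_eq_mul, Finset.mul_sum]
  rw [Finset.sum_comm]
  refine Finset.sum_congr rfl fun T _ => Finset.sum_congr rfl fun U _ => ?_
  ring

theorem sesq_opV {T T' : Module.End ℂ V} (hT : ∀ v w : V, inner ℂ (T v) w = inner ℂ v (T' w))
    (Ψ Ψ' : GhostV 𝔤 V) : B.sesq K (opV 𝔤 V T Ψ) Ψ' = B.sesq K Ψ (opV 𝔤 V T' Ψ') := by
  simp only [sesq, coeff_opV, hT]

end Sesquilinear

/-! ### Conjugates of the ghosts and definiteness of the Kähler form. -/

section KahlerForm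

variable {𝔤 : Type*} [LieRing 𝔤] [LieAlgebra ℝ 𝔤] [FiniteDimensional ℝ 𝔤]
  {𝔥 : LieSubalgebra ℝ 𝔤} [𝔥.IsCartanSubalgebra] (B : ChevalleyBasis 𝔥)
  {V : Type*} [NormedAddCommGroup V] [InnerProductSpace ℂ V]

/-- `ghostForm` as a bilinear map. -/
def ghostFormBil : Ghost 𝔤 →ₗ[ℂ] Ghost 𝔤 →ₗ[ℂ] ℂ :=
  (B.preForm B.vacuum (B.upsilon B.vacuum))⁻¹ • B.preFormBil

theorem ghostFormBil_apply (Φ Φ' : Ghost 𝔤) : B.ghostFormBil Φ Φ' = B.ghostForm Φ Φ' := by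
  rw [ghostFormBil, ghostForm, LinearMap.smul_apply, LinearMap.smul_apply, preFormBil_apply,
    smul_eq_mul, div_eq_inv_mul]

/-- The bilinear form `(⋆Φ, υ Φ')` on ghosts. -/
def kahlerForm (χ : Module.Dual ℂ (Cx 𝔤)) : Ghost 𝔤 →ₗ[ℂ] Ghost 𝔤 →ₗ[ℂ] ℂ :=
  (B.ghostFormBil ∘ₗ B.star χ).compl₂ B.upsilon

theorem kahlerForm_apply (χ : Module.Dual ℂ (Cx 𝔤)) (Φ Φ' : Ghost 𝔤) :
    B.kahlerForm χ Φ Φ' = B.ghostForm (B.star χ Φ) (B.upsilon Φ') := by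
  rw [kahlerForm, LinearMap.compl₂_apply, LinearMap.comp_apply, ghostFormBil_apply]

theorem kahlerForm_vacuum (χ : Module.Dual ℂ (Cx 𝔤)) :
    B.kahlerForm χ B.vacuum B.vacuum = 1 := by
  rw [kahlerForm_apply, B.star_vacuum, B.ghostForm_vacuum]

/-- Three signs meet and cancel: $(-1)^{l+1}$ from star, $-1$ from the pairing, and $(-1)^l$ from
moving an anti-ghost past $\upsilon$. The sign $(-1)^{l+1}$ in star serves exactly this purpose. -/
theorem kahlerForm_c (χ : Module.Dual ℂ (Cx 𝔤)) {α : Functional 𝔥} (hα : α ∈ roots 𝔥)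
    (hr : B.r χ α ≠ 0) (Φ Φ' : Ghost 𝔤) :
    B.kahlerForm χ (B.c (-α) Φ) Φ' = (B.r χ α)⁻¹ * B.kahlerForm χ Φ (B.b α Φ') := by
  have hn := B.mem_roots_neg_iff.2 hα
  have h1 := LinearMap.congr_fun (B.star_intertwine χ hn (by rwa [B.r_neg χ hα])).2 Φ
  have h2 := LinearMap.congr_fun (B.upsilon_b hα) Φ'
  rw [LinearMap.smul_apply] at h1 h2
  simp only [Module.End.mul_apply] at h1 h2
  rw [kahlerForm_apply, kahlerForm_apply, h1, ← ghostFormBil_apply, map_smul, LinearMap.smul_apply,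
    ghostFormBil_apply, B.ghostForm_b hn, neg_neg, h2, ← ghostFormBil_apply, map_smul,
    ghostFormBil_apply, smul_eq_mul, smul_eq_mul, B.r_neg χ hα, pow_succ]
  have h3 : (-1 : ℂ) ^ rank 𝔥 * (-1 : ℂ) ^ rank 𝔥 = 1 := by rw [← mul_pow]; simp
  linear_combination ((B.r χ α)⁻¹ * B.ghostForm (B.star χ Φ) (B.upsilon (B.b α Φ'))) * h3

theorem kahlerForm_b (χ : Module.Dual ℂ (Cx 𝔤)) {α : Functional 𝔥} (hα : α ∈ roots 𝔥)
    (hr : B.r χ α ≠ 0) (Φ Φ' : Ghost 𝔤) :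
    B.kahlerForm χ (B.b α Φ) Φ' = B.r χ α * B.kahlerForm χ Φ (B.c (-α) Φ') := by
  have h1 := LinearMap.congr_fun (B.star_intertwine χ hα hr).1 Φ
  have h2 := LinearMap.congr_fun (B.upsilon_c (-α)) Φ'
  rw [LinearMap.smul_apply] at h1 h2
  simp only [Module.End.mul_apply] at h1 h2
  rw [kahlerForm_apply, kahlerForm_apply, h1, ← ghostFormBil_apply, map_smul, LinearMap.smul_apply,
    ghostFormBil_apply, B.ghostForm_c hα, h2, ← ghostFormBil_apply, map_smul,
    ghostFormBil_apply, smul_eq_mul, smul_eq_mul, pow_succ]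
  have h3 : (-1 : ℂ) ^ rank 𝔥 * (-1 : ℂ) ^ rank 𝔥 = 1 := by rw [← mul_pow]; simp
  linear_combination ((B.r χ α) * B.ghostForm (B.star χ Φ) (B.upsilon (B.c (-α) Φ'))) * h3

/-- Up to sign, $b_i$ deletes the index $i$, and sends distinct monomials containing it to distinct
monomials; so no cancellation among such coefficients is possible. -/
theorem coeff_eq_zero {Ψ : GhostV 𝔤 V} {i : Fin (rank 𝔥)} (h : onV V (B.bH i) Ψ = 0)
    {S : Finset (Idx 𝔥)} (hS : Sum.inr i ∈ S) : B.coeff V S Ψ = 0 := by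
  classical
  have h1 := B.coeff_onV (S.erase (Sum.inr i)) (B.bH i) Ψ
  rw [h, map_zero, Finset.sum_eq_single S] at h1
  · obtain ⟨s, hs, e⟩ := B.subst_ghostBasis_insert (Finset.notMem_erase (Sum.inr i) S)
    rw [Finset.insert_erase hS] at e
    rw [bH, e, map_smul, Finsupp.smul_apply, Module.Basis.repr_self, Finsupp.single_eq_same] at h1
    rcases hs with rfl | rfl <;> simpa using h1.symm
  · intro T _ hT
    by_cases hi : Sum.inr i ∈ T
    · obtain ⟨s, hs, e⟩ := B.subst_ghostBasis_insert (Finset.notMem_erase (Sum.inr i) T)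
      rw [Finset.insert_erase hi] at e
      rw [bH, e, map_smul, Finsupp.smul_apply, Module.Basis.repr_self, Finsupp.single_eq_of_ne,
        smul_zero, zero_smul]
      intro e'
      apply hT
      rw [← Finset.insert_erase hS, ← Finset.insert_erase hi, e']
    · rw [bH, B.subst_ghostBasis_of_notMem hi, map_zero, Finsupp.zero_apply, zero_smul]
  · simp

variable [LieAlgebra.IsKilling ℂ (Cx 𝔤)] {χ : Module.Dual ℂ (Cx 𝔤)} (hχ : B.IsRegularDominant χ)
include hχ

theorem r_ne_zero {α : Functional 𝔥} (hα : α ∈ roots 𝔥) : B.r χ α ≠ 0 := by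
  obtain ⟨t, ht, e⟩ := B.exists_r_eq hχ hα
  rw [e]
  exact_mod_cast ht.ne'

theorem r_real {α : Functional 𝔥} (hα : α ∈ roots 𝔥) : starRingEnd ℂ (B.r χ α) = B.r χ α := by
  obtain ⟨t, ht, e⟩ := B.exists_r_eq hχ hα
  rw [e, Complex.conj_ofReal]

theorem kahler_eq (Ψ Ψ' : GhostV 𝔤 V) : B.kahler χ Ψ Ψ' = B.sesq (B.kahlerForm χ) Ψ Ψ' := by
  have h1 : B.kahler χ Ψ Ψ' = B.sesq B.ghostFormBil (onV V (B.star χ) Ψ) (onV V B.upsilon Ψ') := by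
    simp only [kahler, pairing, sesq, ghostFormBil_apply]
  rw [h1, B.sesq_onV_left _ (B.isRealOp_star fun α hα => B.r_real hχ (B.pos_subset hα)),
    B.sesq_onV_right]
  rfl

theorem kahlerForm_insert (a : {α // α ∈ roots 𝔥}) (Φ Φ' : Ghost 𝔤) :
    B.kahlerForm χ (wedge (B.basis.coord (Sum.inl a)) Φ) Φ'
      = (B.r χ a)⁻¹ * B.kahlerForm χ Φ (subst (B.basis (Sum.inl a)) Φ') := by
  have := B.kahlerForm_c χ a.2 (B.r_ne_zero hχ a.2) Φ Φ'
  rw [c, neg_neg, ← B.coord_inl, b, ← B.basis_inl] at this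
  exact this

theorem kahlerForm_insert_right (a : {α // α ∈ roots 𝔥}) (Φ Φ' : Ghost 𝔤) :
    B.kahlerForm χ Φ (wedge (B.basis.coord (Sum.inl a)) Φ')
      = (B.r χ a)⁻¹ * B.kahlerForm χ (subst (B.basis (Sum.inl a)) Φ) Φ' := by
  have := B.kahlerForm_b χ a.2 (B.r_ne_zero hχ a.2) Φ Φ'
  rw [c, neg_neg, ← B.coord_inl, b, ← B.basis_inl] at this
  rw [this, ← mul_assoc, inv_mul_cancel₀ (B.r_ne_zero hχ a.2), one_mul]

/-- Some root index belongs to only one of the two monomials. Moved to the other side, its ghost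
becomes a substitution that kills the other monomial. -/
theorem kahlerForm_ghostBasis_ne {S T : Finset (Idx 𝔥)} (hS : ∀ i, Sum.inr i ∉ S)
    (hT : ∀ i, Sum.inr i ∉ T) (h : S ≠ T) :
    B.kahlerForm χ (B.ghostBasis S) (B.ghostBasis T) = 0 := by
  classical
  have h1 : ∃ a, ¬(a ∈ S ↔ a ∈ T) := by
    by_contra hn
    push Not at hn
    exact h (Finset.ext hn)
  obtain ⟨a, ha⟩ := h1
  rcases a with a | i
  · by_cases haS : Sum.inl a ∈ S
    · have haT : Sum.inl a ∉ T := fun h => ha ⟨fun _ => h, fun _ => haS⟩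
      obtain ⟨s, hs, e⟩ := B.wedge_ghostBasis (Finset.notMem_erase (Sum.inl a) S)
      rw [Finset.insert_erase haS] at e
      rw [sign_smul_cancel hs e, map_smul, LinearMap.smul_apply, B.kahlerForm_insert hχ,
        B.subst_ghostBasis_of_notMem haT, map_zero, mul_zero, smul_zero]
    · have haT : Sum.inl a ∈ T := by
        by_contra h
        exact ha ⟨fun h => absurd h haS, fun h' => absurd h' h⟩
      obtain ⟨s, hs, e⟩ := B.wedge_ghostBasis (Finset.notMem_erase (Sum.inl a) T)
      rw [Finset.insert_erase haT] at e
      rw [sign_smul_cancel hs e, map_smul, B.kahlerForm_insert_right hχ,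
        B.subst_ghostBasis_of_notMem haS, map_zero, LinearMap.zero_apply, mul_zero, smul_zero]
  · exact absurd ⟨fun h => absurd h (hS i), fun h => absurd h (hT i)⟩ ha

/-- Removing a root index from both arguments costs a factor $r_\alpha^{-1}>0$, and the ordering
signs occur squared. -/
theorem kahlerForm_ghostBasis_self (S : Finset (Idx 𝔥)) (hS : ∀ i, Sum.inr i ∉ S) :
    ∃ t : ℝ, 0 < t ∧ B.kahlerForm χ (B.ghostBasis S) (B.ghostBasis S)
      = t * B.kahlerForm χ 1 1 := by
  classical
  induction S using Finset.induction_on with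
  | empty => exact ⟨1, one_pos, by rw [B.ghostBasis_empty, Complex.ofReal_one, one_mul]⟩
  | insert a S ha ih =>
    obtain ⟨t, ht, e⟩ := ih fun i h => hS i (Finset.mem_insert_of_mem h)
    rcases a with a | i
    · obtain ⟨u, hu, hr⟩ := B.exists_r_eq hχ a.2
      obtain ⟨s, hs, e'⟩ := B.wedge_ghostBasis ha
      refine ⟨u⁻¹ * t, by positivity, ?_⟩
      rw [sign_smul_cancel hs e', map_smul, map_smul, LinearMap.smul_apply,
        B.kahlerForm_insert hχ, subst_wedge_apply, B.subst_ghostBasis_of_notMem ha, map_zero,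
        sub_zero, B.coord_basis, if_pos rfl, one_smul, e, hr, smul_smul]
      have : (s : ℂ) * s = 1 := by rcases hs with rfl | rfl <;> simp
      rw [this, one_smul]
      push_cast
      ring
    · exact absurd (Finset.mem_insert_self _ _) (hS i)

/-- The vacuum is itself a monomial up to sign and has norm $1$, which fixes the remaining constant
in `kahlerForm_ghostBasis_self` and shows that it is positive. -/
theorem kahlerForm_one_one : ∃ t : ℝ, 0 < t ∧ B.kahlerForm χ 1 1 = t := by
  obtain ⟨s, hs, e⟩ := B.isMonomial_vacuum
  obtain ⟨t, ht, e'⟩ := B.kahlerForm_ghostBasis_self hχ _ (B.inr_notMem_negIdx B.pos.toList)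
  refine ⟨t⁻¹, inv_pos.2 ht, ?_⟩
  have h := B.kahlerForm_vacuum χ
  rw [e, map_smul, map_smul, LinearMap.smul_apply, e', smul_smul] at h
  have : (s : ℂ) * s = 1 := by rcases hs with rfl | rfl <;> simp
  rw [this, one_smul] at h
  push_cast
  exact eq_inv_of_mul_eq_one_right h

theorem kahlerForm_pos (S : Finset (Idx 𝔥)) (hS : ∀ i, Sum.inr i ∉ S) :
    ∃ t : ℝ, 0 < t ∧ B.kahlerForm χ (B.ghostBasis S) (B.ghostBasis S) = t := by
  obtain ⟨t, ht, e⟩ := B.kahlerForm_ghostBasis_self hχ S hS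
  obtain ⟨u, hu, e'⟩ := B.kahlerForm_one_one hχ
  exact ⟨t * u, mul_pos ht hu, by rw [e, e']; push_cast; rfl⟩

/-- The Kähler inner product is definite on the part of `𝒞(V)` killed by all `b_i`. -/
theorem eq_zero_of_kahler_self {Ψ : GhostV 𝔤 V} (hΨ : ∀ i, onV V (B.bH i) Ψ = 0)
    (h : B.kahler χ Ψ Ψ = 0) : Ψ = 0 := by
  classical
  have hz : ∀ S : Finset (Idx 𝔥), ¬(∀ i, Sum.inr i ∉ S) → B.coeff V S Ψ = 0 := by
    intro S hS
    push Not at hS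
    obtain ⟨i, hi⟩ := hS
    exact B.coeff_eq_zero (hΨ i) hi
  -- Monomials with a Cartan index have zero coefficient, and there any positive `t`, for instance
  -- $1$, will do. The other monomials are orthogonal, so the self-pairing is a positive combination
  -- of $\|\cdot\|^2$ of the coefficients.
  have ht : ∀ S : Finset (Idx 𝔥), ∃ t : ℝ, 0 < t ∧
      ∑ T, B.kahlerForm χ (B.ghostBasis S) (B.ghostBasis T)
        * inner ℂ (B.coeff V S Ψ) (B.coeff V T Ψ) = ((t * ‖B.coeff V S Ψ‖ ^ 2 : ℝ) : ℂ) := by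
    intro S
    by_cases hS : ∀ i, Sum.inr i ∉ S
    · obtain ⟨t, ht, e⟩ := B.kahlerForm_pos hχ S hS
      refine ⟨t, ht, ?_⟩
      rw [Finset.sum_eq_single S, e, inner_self_eq_norm_sq_to_K]
      · push_cast
        rfl
      · intro T _ hT
        by_cases hT' : ∀ i, Sum.inr i ∉ T
        · rw [B.kahlerForm_ghostBasis_ne hχ hS hT' hT.symm, zero_mul]
        · rw [hz T hT', inner_zero_right, mul_zero]
      · simp
    · refine ⟨1, one_pos, ?_⟩
      simp [hz S hS]
  choose t ht e using ht
  rw [B.kahler_eq hχ, sesq, Finset.sum_congr rfl fun S _ => e S] at h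
  have h' : ∑ S, t S * ‖B.coeff V S Ψ‖ ^ 2 = 0 := by exact_mod_cast h
  rw [Finset.sum_eq_zero_iff_of_nonneg fun S _ => mul_nonneg (ht S).le (sq_nonneg _)] at h'
  have h0 : ∀ S, B.coeff V S Ψ = 0 := by
    intro S
    have := h' S (Finset.mem_univ S)
    simpa [(ht S).ne'] using this
  rw [B.sum_coeff Ψ]
  simp only [h0, TensorProduct.tmul_zero, Finset.sum_const_zero]
  rfl

end KahlerForm

end ChevalleyBasis
end
end AnomalousBRST

namespace AnomalousBRST
noncomputable section

/-! ### Complex conjugation and the anti-hermitian representation. -/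

section Conjugation

variable {𝔤 : Type*} [LieRing 𝔤] [LieAlgebra ℝ 𝔤]

theorem Cx.conj_add (x y : Cx 𝔤) : (x + y).conj = x.conj + y.conj := map_add _ x y

theorem Cx.conj_tmul (z : ℂ) (x : 𝔤) :
    (Cx.tmul z x).conj = Cx.tmul (starRingEnd ℂ z) x := rfl

theorem Cx.conj_smul (z : ℂ) (x : Cx 𝔤) : (z • x).conj = starRingEnd ℂ z • x.conj := by
  obtain ⟨a, b, rfl⟩ := Cx.exists_re_im x
  rw [smul_add, Cx.smul_tmul, Cx.smul_tmul, Cx.conj_add, Cx.conj_add, smul_add]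
  simp only [Cx.conj_tmul, Cx.smul_tmul, map_mul]

theorem Cx.conj_lie (x y : Cx 𝔤) : ⁅x, y⁆.conj = ⁅x.conj, y.conj⁆ := by
  obtain ⟨a, b, rfl⟩ := Cx.exists_re_im x
  obtain ⟨c, d, rfl⟩ := Cx.exists_re_im y
  simp only [add_lie, lie_add, Cx.conj_add, Cx.lie_tmul, Cx.conj_tmul, map_mul]

theorem inner_complexRep {V : Type*} [NormedAddCommGroup V] [InnerProductSpace ℂ V]
    {ρ : 𝔤 →ₗ[ℝ] Module.End ℂ V}
    (hunitary : ∀ (x : 𝔤) (v w : V), inner ℂ (ρ x v) w = -inner ℂ v (ρ x w)) (x : Cx 𝔤) (v w : V) :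
    inner ℂ (complexRep ρ x v) w = -inner ℂ v (complexRep ρ x.conj w) := by
  obtain ⟨a, b, rfl⟩ := Cx.exists_re_im x
  rw [Cx.conj_add, map_add, map_add, Cx.conj_tmul, Cx.conj_tmul]
  simp only [complexRep_tmul, LinearMap.add_apply, LinearMap.smul_apply, inner_add_left,
    inner_add_right, inner_smul_left, inner_smul_right, hunitary]
  ring

end Conjugation

namespace ChevalleyBasis

/-! ### Conjugates of the elementary operators on all of $\mathcal C(V)$. -/

section Adjoints

variable {𝔤 : Type*} [LieRing 𝔤] [LieAlgebra ℝ 𝔤] [FiniteDimensional ℝ 𝔤]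
  {𝔥 : LieSubalgebra ℝ 𝔤} [𝔥.IsCartanSubalgebra] (B : ChevalleyBasis 𝔥)
  {V : Type*} [NormedAddCommGroup V] [InnerProductSpace ℂ V]

/-- Conjugating $[\tau_\alpha,\tau_\beta]=N_{\alpha\beta}\tau_{\alpha+\beta}$ gives the same
relation for the opposite roots with conjugated coefficient; compare with
$N_{-\alpha,-\beta}=N_{\alpha\beta}$. -/
theorem N_real {α β : Functional 𝔥} (hα : α ∈ roots 𝔥) (hβ : β ∈ roots 𝔥) :
    starRingEnd ℂ (B.N α β) = B.N α β := by
  by_cases h : α + β ∈ roots 𝔥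
  · have h0 := B.ne_zero_of_mem_roots h
    have h1 := congrArg Cx.conj (B.lie_root α hα β hβ h0)
    have h2 := B.lie_root (-α) (B.mem_roots_neg_iff.2 hα) (-β) (B.mem_roots_neg_iff.2 hβ)
      (by rwa [← neg_add, neg_ne_zero])
    rw [Cx.conj_lie, Cx.conj_smul, B.conj_rootVector α hα, B.conj_rootVector β hβ,
      B.conj_rootVector _ h, h2, ← neg_add, B.N_neg_neg α hα β hβ] at h1
    exact (smul_left_injective ℂ (B.τ_ne_zero (B.mem_roots_neg_iff.2 h)) h1).symm
  · rw [B.N_eq_zero _ _ h, map_zero]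

/-- `A'` is conjugate to `A` for the Kähler form on the whole space `𝒞(V)`. -/
def IsAdj (χ : Module.Dual ℂ (Cx 𝔤)) (A A' : Module.End ℂ (GhostV 𝔤 V)) : Prop :=
  ∀ Ψ Ψ', B.sesq (B.kahlerForm χ) (A Ψ) Ψ' = B.sesq (B.kahlerForm χ) Ψ (A' Ψ')

namespace IsAdj

variable {B} {χ : Module.Dual ℂ (Cx 𝔤)} {A A' C C' : Module.End ℂ (GhostV 𝔤 V)}

theorem add (h : B.IsAdj χ A A') (h' : B.IsAdj χ C C') : B.IsAdj χ (A + C) (A' + C') :=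
  fun Ψ Ψ' => by
    rw [LinearMap.add_apply, LinearMap.add_apply, sesq_add_left, sesq_add_right, h, h']

theorem mul (h : B.IsAdj χ A A') (h' : B.IsAdj χ C C') : B.IsAdj χ (A * C) (C' * A') :=
  fun Ψ Ψ' => by
    rw [Module.End.mul_apply, Module.End.mul_apply, h, h']

theorem smul (h : B.IsAdj χ A A') {z : ℂ} (hz : starRingEnd ℂ z = z) :
    B.IsAdj χ (z • A) (z • A') :=
  fun Ψ Ψ' => by
    rw [LinearMap.smul_apply, LinearMap.smul_apply, sesq_smul_left, sesq_smul_right, h, hz]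

theorem neg (h : B.IsAdj χ A A') : B.IsAdj χ (-A) (-A') := by
  have := h.smul (z := -1) (by simp)
  rwa [neg_one_smul, neg_one_smul] at this

theorem sub (h : B.IsAdj χ A A') (h' : B.IsAdj χ C C') : B.IsAdj χ (A - C) (A' - C') := by
  rw [sub_eq_add_neg, sub_eq_add_neg]
  exact h.add h'.neg

theorem zero : B.IsAdj χ (0 : Module.End ℂ (GhostV 𝔤 V)) 0 := fun Ψ Ψ' => by
  have h1 := sesq_smul_left B (B.kahlerForm χ) 0 Ψ Ψ'
  have h2 := sesq_smul_right B (B.kahlerForm χ) 0 Ψ Ψ'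
  rw [zero_smul, map_zero, zero_mul] at h1
  rw [zero_smul, zero_mul] at h2
  rw [LinearMap.zero_apply, LinearMap.zero_apply, h2, h1]

theorem sum {ι : Type*} {s : Finset ι} {A A' : ι → Module.End ℂ (GhostV 𝔤 V)}
    (h : ∀ i ∈ s, B.IsAdj χ (A i) (A' i)) : B.IsAdj χ (∑ i ∈ s, A i) (∑ i ∈ s, A' i) := by
  classical
  induction s using Finset.induction_on with
  | empty => exact zero
  | insert a s ha ih =>
    rw [Finset.sum_insert ha, Finset.sum_insert ha]
    exact (h a (Finset.mem_insert_self _ _)).add (ih fun i hi => h i (Finset.mem_insert_of_mem hi))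

end IsAdj

theorem isAdj_tV (χ : Module.Dual ℂ (Cx 𝔤)) {ρ : 𝔤 →ₗ[ℝ] Module.End ℂ V}
    (hunitary : ∀ (x : 𝔤) (v w : V), inner ℂ (ρ x v) w = -inner ℂ v (ρ x w))
    {α : Functional 𝔥} (hα : α ∈ roots 𝔥) : B.IsAdj χ (B.tV ρ α) (-B.tV ρ (-α)) := by
  intro Ψ Ψ'
  have : -B.tV ρ (-α) = opV 𝔤 V (-complexRep ρ (B.τ (-α))) := (map_neg _ _).symm
  rw [this]
  refine B.sesq_opV _ (fun v w => ?_) Ψ Ψ'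
  rw [inner_complexRep hunitary, LinearMap.neg_apply, inner_neg_right]
  congr 3
  exact congrArg (complexRep ρ) (B.conj_rootVector α hα)

variable [LieAlgebra.IsKilling ℂ (Cx 𝔤)] {χ : Module.Dual ℂ (Cx 𝔤)} (hχ : B.IsRegularDominant χ)
include hχ

variable (V) in
theorem isAdj_cV {α : Functional 𝔥} (hα : α ∈ roots 𝔥) :
    B.IsAdj χ (B.cV V (-α)) ((B.r χ α)⁻¹ • B.bV V α) := by
  intro Ψ Ψ'
  rw [cV, bV, ← map_smul]
  have h1 := B.sesq_onV_left (B.kahlerForm χ) (B.isRealOp_c (B.mem_roots_neg_iff.2 hα)) Ψ Ψ'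
  have h2 := B.sesq_onV_right (B.kahlerForm χ) ((B.r χ α)⁻¹ • B.b α) Ψ Ψ'
  refine h1.trans (Eq.trans ?_ h2.symm)
  congr 1
  refine LinearMap.ext fun Φ => LinearMap.ext fun Φ' => ?_
  rw [LinearMap.comp_apply, LinearMap.compl₂_apply, B.kahlerForm_c χ hα (B.r_ne_zero hχ hα),
    LinearMap.smul_apply, map_smul, smul_eq_mul]

variable (V) in
theorem isAdj_bV {α : Functional 𝔥} (hα : α ∈ roots 𝔥) :
    B.IsAdj χ (B.bV V α) (B.r χ α • B.cV V (-α)) := by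
  intro Ψ Ψ'
  rw [cV, bV, ← map_smul]
  have h1 := B.sesq_onV_left (B.kahlerForm χ) (B.isRealOp_b hα) Ψ Ψ'
  have h2 := B.sesq_onV_right (B.kahlerForm χ) (B.r χ α • B.c (-α)) Ψ Ψ'
  refine h1.trans (Eq.trans ?_ h2.symm)
  congr 1
  refine LinearMap.ext fun Φ => LinearMap.ext fun Φ' => ?_
  rw [LinearMap.comp_apply, LinearMap.compl₂_apply, B.kahlerForm_b χ hα (B.r_ne_zero hχ hα),
    LinearMap.smul_apply, map_smul, smul_eq_mul]

variable (V) in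
theorem isAdj_grading {q : Functional 𝔥 → ℂ} (hq : ∀ α, starRingEnd ℂ (q α) = q α) :
    B.IsAdj χ (B.grading V q) (B.grading V q) := by
  refine IsAdj.sum fun α hα => IsAdj.smul ?_ (hq α)
  have h := (B.isAdj_cV V hχ hα).mul (B.isAdj_bV V hχ hα)
  rwa [smul_mul_smul_comm, mul_inv_cancel₀ (B.r_ne_zero hχ hα), one_smul] at h

variable (V) in
theorem isAdj_Jplus : B.IsAdj χ (onV V (B.ghostJplus χ)) (onV V (B.ghostJminus χ)) := by
  rw [B.onV_ghostJplus, B.onV_ghostJminus]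
  refine IsAdj.sum fun α hα => ?_
  have h1 := B.pos_subset hα
  have h2 := B.neg_mem_roots hα
  have h := ((B.isAdj_cV V hχ h1).mul (B.isAdj_cV V hχ h2)).smul (B.r_real hχ h1)
  rw [neg_neg, B.r_neg χ h1, smul_mul_smul_comm, smul_smul, ← mul_assoc,
    mul_inv_cancel₀ (B.r_ne_zero hχ h1), one_mul] at h
  exact h

end Adjoints

/-! ### The Kähler identity: conjugation of the differential as a commutator with $J^-$. -/

section KahlerIdentity

variable {𝔤 : Type*} [LieRing 𝔤] [LieAlgebra ℝ 𝔤] [FiniteDimensional ℝ 𝔤]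
  {𝔥 : LieSubalgebra ℝ 𝔤} [𝔥.IsCartanSubalgebra] (B : ChevalleyBasis 𝔥)
  {V : Type*} [NormedAddCommGroup V] [InnerProductSpace ℂ V]

/-- The sign of a root. -/
def sgn (α : Functional 𝔥) : ℂ := 2 * B.posInd α - 1

theorem sgn_pos {α : Functional 𝔥} (h : α ∈ B.pos) : B.sgn α = 1 := by
  rw [sgn, B.posInd_pos h]; norm_num

theorem sgn_of_notMem {α : Functional 𝔥} (h : α ∉ B.pos) : B.sgn α = -1 := by
  rw [sgn, posInd, if_neg h]; norm_num

theorem sgn_mul_self (α : Functional 𝔥) : B.sgn α * B.sgn α = 1 := by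
  by_cases h : α ∈ B.pos
  · rw [B.sgn_pos h, one_mul]
  · rw [B.sgn_of_notMem h]; norm_num

theorem sgn_neg {α : Functional 𝔥} (hα : α ∈ roots 𝔥) : B.sgn (-α) = -B.sgn α := by
  by_cases h : α ∈ B.pos
  · rw [B.sgn_pos h, B.sgn_of_notMem (B.neg_notMem_pos α h)]
  · rw [B.sgn_of_notMem h, B.sgn_pos (B.neg_mem_pos_of_notMem hα h), neg_neg]

theorem r_eq_sgn (χ : Module.Dual ℂ (Cx 𝔤)) (α : Functional 𝔥) :
    B.r χ α = B.sgn α * B.shifted χ (B.coroot α) := by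
  by_cases h : α ∈ B.pos
  · rw [B.sgn_pos h, B.r_of_pos χ h, one_mul]
  · rw [B.sgn_of_notMem h, r, if_neg h]
    rfl

theorem sgn_mul_r (χ : Module.Dual ℂ (Cx 𝔤)) (α : Functional 𝔥) :
    B.sgn α * B.r χ α = B.shifted χ (B.coroot α) := by
  rw [B.r_eq_sgn, ← mul_assoc, B.sgn_mul_self, one_mul]

theorem sgn_inv (α : Functional 𝔥) : (B.sgn α)⁻¹ = B.sgn α :=
  inv_eq_of_mul_eq_one_right (B.sgn_mul_self α)

/-- The degree is $0$ or $1$, so the left side is the sign with which a cubic term enters $D^c_{\rm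
rel}$. Writing it as a product of signs of roots matches the signs relating $r_\alpha$ to
$\langle\chi+2\varrho,H_\alpha\rangle$. -/
theorem one_sub_cubicDeg {α β : Functional 𝔥} (hα : α ∈ roots 𝔥) (hβ : β ∈ roots 𝔥)
    (h : α + β ∈ roots 𝔥) :
    1 - 2 * B.cubicDeg α β = -(B.sgn α * B.sgn β * B.sgn (α + β)) := by
  have hn : ∀ {γ : Functional 𝔥}, γ ∈ roots 𝔥 → γ ∉ B.pos → -γ ∈ B.pos :=
    fun h => B.neg_mem_pos_of_notMem h
  rw [cubicDeg, sgn, sgn, sgn, posInd, posInd, posInd]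
  split_ifs with h1 h2 h3 h3 h2 h3 h3
  · norm_num
  · exact absurd (B.add_mem_pos α h1 β h2 h) h3
  · norm_num
  · norm_num
  · norm_num
  · norm_num
  · have h4 := B.add_mem_pos _ (hn hα h1) _ (hn hβ h2) (by rw [← neg_add, B.mem_roots_neg_iff]; exact h)
    rw [← neg_add] at h4
    exact absurd h4 (B.neg_notMem_pos _ h3)
  · norm_num

variable (V) in
-- For positive $\alpha$ the contraction hits the second anti-ghost of $b_{-\alpha}b_\alpha$, for
-- negative $\alpha$ the first anti-ghost of its pair, which produces opposite signs. Together with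
-- the even `r` this yields one formula with an odd coefficient.
theorem Jminus_cV (χ : Module.Dual ℂ (Cx 𝔤)) {α : Functional 𝔥} (hα : α ∈ roots 𝔥) :
    onV V (B.ghostJminus χ) * B.cV V (-α) - B.cV V (-α) * onV V (B.ghostJminus χ)
      = (B.shifted χ (B.coroot α))⁻¹ • B.bV V (-α) := by
  classical
  have key : ∀ β ∈ B.pos, B.bV V (-β) * B.bV V β * B.cV V (-α)
      - B.cV V (-α) * (B.bV V (-β) * B.bV V β)
      = (if β = α then B.bV V (-β) else 0) - if -β = α then B.bV V β else 0 := by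
    intro β hβ
    rw [mul_assoc, B.bV_cV V (B.pos_subset hβ) hα, mul_sub, ← mul_assoc, ← mul_assoc,
      B.bV_cV V (B.neg_mem_roots hβ) hα, sub_mul]
    split_ifs <;> simp
    abel
  rw [B.onV_ghostJminus, Finset.mul_sum, Finset.sum_mul, ← Finset.sum_sub_distrib]
  have h1 : ∀ β ∈ B.pos, (B.r χ β)⁻¹ • (B.bV V (-β) * B.bV V β) * B.cV V (-α)
      - B.cV V (-α) * ((B.r χ β)⁻¹ • (B.bV V (-β) * B.bV V β))
      = (if β = α then (B.r χ β)⁻¹ • B.bV V (-β) else 0)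
        - if β = -α then (B.r χ β)⁻¹ • B.bV V β else 0 := by
    intro β hβ
    rw [smul_mul_assoc, mul_smul_comm, ← smul_sub, key β hβ, smul_sub, smul_ite, smul_ite, smul_zero]
    simp only [neg_eq_iff_eq_neg]
  rw [Finset.sum_congr rfl h1, Finset.sum_sub_distrib, Finset.sum_ite_eq', Finset.sum_ite_eq',
    ← B.sgn_mul_r, mul_inv, B.sgn_inv]
  by_cases h : α ∈ B.pos
  · rw [if_pos h, if_neg (B.neg_notMem_pos α h), sub_zero, B.sgn_pos h, one_mul]
  · rw [if_neg h, if_pos (B.neg_mem_pos_of_notMem hα h), zero_sub, B.sgn_of_notMem h, B.r_neg χ hα,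
      neg_one_mul, neg_smul]

variable (V) in
theorem Jminus_bV (χ : Module.Dual ℂ (Cx 𝔤)) (α : Functional 𝔥) :
    onV V (B.ghostJminus χ) * B.bV V α - B.bV V α * onV V (B.ghostJminus χ) = 0 := by
  rw [B.onV_ghostJminus, Finset.mul_sum, Finset.sum_mul, ← Finset.sum_sub_distrib]
  refine Finset.sum_eq_zero fun β _ => ?_
  rw [smul_mul_assoc, mul_smul_comm, ← smul_sub,
    (commute_of_anticommute (B.bV_bV V α (-β)) (B.bV_bV V α β)).eq, sub_self, smul_zero]

theorem Jminus_tV (χ : Module.Dual ℂ (Cx 𝔤)) (ρ : 𝔤 →ₗ[ℝ] Module.End ℂ V) (α : Functional 𝔥) :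
    onV V (B.ghostJminus χ) * B.tV ρ α - B.tV ρ α * onV V (B.ghostJminus χ) = 0 := by
  rw [onV_eq, tV, opV_onVHom, sub_self]

variable (V) in
theorem cV_eq_zero {α : Functional 𝔥} (h : α ∉ roots 𝔥) : B.cV V (-α) = 0 := by
  rw [cV, c, neg_neg, θ, dif_neg h]
  exact (congrArg (onVHom 𝔤 V) (map_zero (wedgeHom 𝔤))).trans (map_zero _)

/-- The relabelling $(\alpha,\beta)\mapsto(\alpha+\beta,-\alpha)$ is a bijection on pairs of roots
whose sum is a root, since the new sum is $\beta$. -/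
theorem sum_pairs (B : ChevalleyBasis 𝔥) {M : Type*} [AddCommMonoid M]
    {F G : Functional 𝔥 → Functional 𝔥 → M}
    (hF : ∀ α β, α + β ∉ roots 𝔥 → F α β = 0) (hG : ∀ α β, α + β ∉ roots 𝔥 → G α β = 0)
    (h : ∀ α ∈ roots 𝔥, ∀ β ∈ roots 𝔥, α + β ∈ roots 𝔥 → F (α + β) (-α) = G α β) :
    ∑ α ∈ roots 𝔥, ∑ β ∈ roots 𝔥, F α β = ∑ α ∈ roots 𝔥, ∑ β ∈ roots 𝔥, G α β := by
  classical
  have hs : ∀ F : Functional 𝔥 → Functional 𝔥 → M, (∀ α β, α + β ∉ roots 𝔥 → F α β = 0) →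
      ∑ α ∈ roots 𝔥, ∑ β ∈ roots 𝔥, F α β
        = ∑ x ∈ (roots 𝔥 ×ˢ roots 𝔥).filter (fun x => x.1 + x.2 ∈ roots 𝔥), F x.1 x.2 := by
    intro F hF
    rw [Finset.sum_filter, Finset.sum_product]
    refine Finset.sum_congr rfl fun α _ => Finset.sum_congr rfl fun β _ => ?_
    split_ifs with h
    · rfl
    · exact hF α β h
  rw [hs F hF, hs G hG]
  refine Finset.sum_nbij' (fun x => (-x.2, x.1 + x.2)) (fun x => (x.1 + x.2, -x.1)) ?_ ?_ ?_ ?_ ?_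
  · rintro ⟨α, β⟩ hx
    simp only [Finset.mem_filter, Finset.mem_product, B.mem_roots_neg_iff] at hx ⊢
    refine ⟨⟨hx.1.2, hx.2⟩, ?_⟩
    rw [add_comm α, neg_add_cancel_left]
    exact hx.1.1
  · rintro ⟨α, β⟩ hx
    simp only [Finset.mem_filter, Finset.mem_product, B.mem_roots_neg_iff] at hx ⊢
    refine ⟨⟨hx.2, hx.1.1⟩, ?_⟩
    rw [add_neg_cancel_comm]
    exact hx.1.2
  · rintro ⟨α, β⟩ _
    simp
  · rintro ⟨α, β⟩ _
    simp
  · rintro ⟨α, β⟩ hx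
    simp only [Finset.mem_filter, Finset.mem_product] at hx
    rw [← h (-β) (B.mem_roots_neg_iff.2 hx.1.2) (α + β) hx.2]
    · simp
    · rw [add_comm α, neg_add_cancel_left]
      exact hx.1.1

theorem commutator_mul_add {E : Type*} [Ring E] (J x y : E) :
    J * (x * y) - x * y * J = (J * x - x * J) * y + x * (J * y - y * J) := by
  noncomm_ring

theorem shifted_ne_zero [LieAlgebra.IsKilling ℂ (Cx 𝔤)] {χ : Module.Dual ℂ (Cx 𝔤)}
    (hχ : B.IsRegularDominant χ) {α : Functional 𝔥} (hα : α ∈ roots 𝔥) :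
    B.shifted χ (B.coroot α) ≠ 0 := fun h => by
  apply B.r_ne_zero hχ hα
  rw [B.r_eq_sgn, h, mul_zero]

/-- The commutator of `J⁻` with the cubic terms of the signed differential. -/
theorem Jminus_cubic_sum [LieAlgebra.IsKilling ℂ (Cx 𝔤)] {χ : Module.Dual ℂ (Cx 𝔤)}
    (hχ : B.IsRegularDominant χ) :
    ∑ α ∈ roots 𝔥, ∑ β ∈ roots 𝔥, (-(B.sgn α * B.sgn β * B.sgn (α + β)) * B.N α β) •
        (onV V (B.ghostJminus χ) * B.cubic V α β - B.cubic V α β * onV V (B.ghostJminus χ))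
      = ∑ α ∈ roots 𝔥, ∑ β ∈ roots 𝔥, (B.N α β * (B.r χ (α + β) * (B.r χ α)⁻¹ * (B.r χ β)⁻¹)) •
        (B.cV V (-(α + β)) * B.bV V β * B.bV V α) := by
  set f : Functional 𝔥 → ℂ := fun α => B.shifted χ (B.coroot α) with hf
  set w : Functional 𝔥 → Functional 𝔥 → ℂ := fun α β => B.sgn α * B.sgn β * B.sgn (α + β) with hw
  have hwc : ∀ α β, w α β = w β α := fun α β => by
    simp only [hw, add_comm β α]; ring
  set X : Functional 𝔥 → Functional 𝔥 → Module.End ℂ (GhostV 𝔤 V) :=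
    fun α β => B.cV V (-α) * B.bV V (-β) * B.bV V (α + β) with hX
  -- $J^-$ converts one of the two ghosts into an anti-ghost and commutes with the anti-ghost
  -- already present, leaving two terms.
  have hcub : ∀ α ∈ roots 𝔥, ∀ β ∈ roots 𝔥, α + β ∈ roots 𝔥 →
      onV V (B.ghostJminus χ) * B.cubic V α β - B.cubic V α β * onV V (B.ghostJminus χ)
        = (f β)⁻¹ • X α β - (f α)⁻¹ • X β α := by
    intro α hα β hβ h
    have hbc : B.bV V (-α) * B.cV V (-β) = -(B.cV V (-β) * B.bV V (-α)) := by
      rw [B.bV_cV V (B.mem_roots_neg_iff.2 hα) hβ, if_neg, zero_sub]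
      intro e
      apply B.ne_zero_of_mem_roots h
      rw [← e, add_neg_cancel]
    rw [cubic, commutator_mul_add, commutator_mul_add, B.Jminus_cV V χ hα, B.Jminus_cV V χ hβ,
      B.Jminus_bV V χ, mul_zero, add_zero, add_mul, smul_mul_assoc, hbc, mul_smul_comm]
    simp only [hX, hf, add_comm β α, smul_neg, neg_mul, smul_mul_assoc]
    abel
  -- The two terms agree after exchanging $\alpha$ and $\beta$, by antisymmetry of $N$; hence the
  -- factor $-2$.
  have h1 : ∑ α ∈ roots 𝔥, ∑ β ∈ roots 𝔥, (-(w α β) * B.N α β) •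
        (onV V (B.ghostJminus χ) * B.cubic V α β - B.cubic V α β * onV V (B.ghostJminus χ))
      = (-2 : ℂ) • ∑ α ∈ roots 𝔥, ∑ β ∈ roots 𝔥, (w α β * B.N α β * (f β)⁻¹) • X α β := by
    have h2 : ∑ α ∈ roots 𝔥, ∑ β ∈ roots 𝔥, (-(w α β) * B.N α β) •
          (onV V (B.ghostJminus χ) * B.cubic V α β - B.cubic V α β * onV V (B.ghostJminus χ))
        = ∑ α ∈ roots 𝔥, ∑ β ∈ roots 𝔥, (-(w α β * B.N α β * (f β)⁻¹) • X α β
          + -(w β α * B.N β α * (f α)⁻¹) • X β α) := by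
      refine Finset.sum_congr rfl fun α hα => Finset.sum_congr rfl fun β hβ => ?_
      by_cases h : α + β ∈ roots 𝔥
      · rw [hcub α hα β hβ h, B.N_antisymm hβ hα, hwc β α]
        module
      · rw [B.N_eq_zero _ _ h, B.N_eq_zero β α (by rwa [add_comm])]
        simp
    rw [h2]
    simp only [Finset.sum_add_distrib]
    rw [Finset.sum_comm (f := fun α β => -(w β α * B.N β α * (f α)⁻¹) • X β α)]
    simp only [neg_smul, Finset.sum_neg_distrib]
    module
  -- Relabelling by `sum_pairs` brings the monomials to the shape $c^{-(\alpha+\beta)}b_\alpha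
  -- b_\beta$ of a conjugated cubic term.
  have h3 : ∑ α ∈ roots 𝔥, ∑ β ∈ roots 𝔥, (w α β * B.N α β * (f β)⁻¹) • X α β
      = ∑ α ∈ roots 𝔥, ∑ β ∈ roots 𝔥, (w α β * B.N (α + β) (-α) * (f α)⁻¹) •
        (B.cV V (-(α + β)) * B.bV V α * B.bV V β) := by
    refine B.sum_pairs (fun α β h => ?_) (fun α β h => ?_) fun α hα β hβ h => ?_
    · rw [B.N_eq_zero _ _ h, mul_zero, zero_mul, zero_smul]
    · rw [B.cV_eq_zero V h, zero_mul, zero_mul, smul_zero]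
    · have hfn : f (-α) = -f α := by
        simp only [hf, B.coroot_neg hα, map_neg]
      simp only [hX, hw, hfn, B.sgn_neg hα, neg_neg, add_neg_cancel_comm]
      congr 1
      rw [inv_neg]
      ring
  set Z : Functional 𝔥 → Functional 𝔥 → Module.End ℂ (GhostV 𝔤 V) :=
    fun α β => B.cV V (-(α + β)) * B.bV V α * B.bV V β with hZ
  have hZs : ∀ α β, Z β α = -Z α β := fun α β => by
    simp only [hZ]
    rw [mul_assoc, B.bV_bV, mul_neg, mul_assoc, add_comm]
  -- The monomials are antisymmetric, so only the antisymmetric part of the coefficient counts, and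
  -- this uses up the factor $-2$.
  have h4 : ∀ g : Functional 𝔥 → Functional 𝔥 → ℂ,
      (-2 : ℂ) • ∑ α ∈ roots 𝔥, ∑ β ∈ roots 𝔥, g α β • Z α β
        = ∑ α ∈ roots 𝔥, ∑ β ∈ roots 𝔥, (g α β - g β α) • Z β α := by
    intro g
    have h5 : ∑ α ∈ roots 𝔥, ∑ β ∈ roots 𝔥, g β α • Z β α
        = ∑ α ∈ roots 𝔥, ∑ β ∈ roots 𝔥, g α β • Z α β := Finset.sum_comm
    simp only [sub_smul, Finset.sum_sub_distrib]
    have h6 : ∑ α ∈ roots 𝔥, ∑ β ∈ roots 𝔥, g α β • Z β α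
        = -∑ α ∈ roots 𝔥, ∑ β ∈ roots 𝔥, g α β • Z α β := by
      rw [← Finset.sum_neg_distrib]
      refine Finset.sum_congr rfl fun α _ => ?_
      rw [← Finset.sum_neg_distrib]
      exact Finset.sum_congr rfl fun β _ => by rw [hZs, smul_neg]
    rw [h5, h6]
    module
  refine (h1.trans (congrArg _ h3)).trans ((h4 _).trans ?_)
  refine Finset.sum_congr rfl fun α hα => Finset.sum_congr rfl fun β hβ => ?_
  by_cases h : α + β ∈ roots 𝔥
  -- For the roots $\alpha+\beta$, $-\alpha$, $-\beta$ the identity expresses $N_{\alpha\beta}$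
  -- times the value of $\chi+2\varrho$ at $H_{\alpha+\beta}$ through the two constants
  -- $N_{\alpha+\beta,-\alpha}$ and $N_{\alpha+\beta,-\beta}$ just obtained. Clearing denominators,
  -- this is the required equality of coefficients.
  · have hj := B.N_jacobi (B.shifted χ) h (B.mem_roots_neg_iff.2 hα) (B.mem_roots_neg_iff.2 hβ)
      (by abel)
    rw [B.coroot_neg hα, B.coroot_neg hβ, map_neg, map_neg, B.N_neg_neg α hα β hβ,
      B.N_antisymm (B.mem_roots_neg_iff.2 hβ) h] at hj
    have e : Z β α = B.cV V (-(α + β)) * B.bV V β * B.bV V α := by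
      simp only [hZ, add_comm]
    rw [← e]
    congr 1
    have h1 := B.shifted_ne_zero hχ hα
    have h2 := B.shifted_ne_zero hχ hβ
    have hs := B.sgn_mul_self α
    rw [hwc β α, B.r_eq_sgn, B.r_eq_sgn χ α, B.r_eq_sgn χ β, mul_inv, mul_inv, B.sgn_inv, B.sgn_inv,
      add_comm β α]
    simp only [hw, hf]
    field_simp
    linear_combination (-(B.sgn α * B.sgn β * B.sgn (α + β))) * hj
  · rw [B.N_eq_zero _ _ h, zero_mul, zero_smul, hZs]
    simp only [hZ]
    rw [B.cV_eq_zero V h, zero_mul, zero_mul, neg_zero, smul_zero]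

variable (ρ : 𝔤 →ₗ[ℝ] Module.End ℂ V)

/-- The Kähler identity for the sum of the two differentials. -/
theorem isAdj_weighted [LieAlgebra.IsKilling ℂ (Cx 𝔤)] {χ : Module.Dual ℂ (Cx 𝔤)}
    (hχ : B.IsRegularDominant χ)
    (hunitary : ∀ (x : 𝔤) (v w : V), inner ℂ (ρ x v) w = -inner ℂ v (ρ x w)) :
    B.IsAdj χ (B.weighted ρ (fun _ => 1) fun _ _ => 1)
      (onV V (B.ghostJminus χ) * B.weighted ρ (fun α => -B.sgn α)
          (fun α β => -(B.sgn α * B.sgn β * B.sgn (α + β)))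
        - B.weighted ρ (fun α => -B.sgn α) (fun α β => -(B.sgn α * B.sgn β * B.sgn (α + β)))
          * onV V (B.ghostJminus χ)) := by
  set J := onV V (B.ghostJminus χ) with hJ
  have hlin : ∀ α ∈ roots 𝔥, J * (-B.sgn α • (B.cV V (-α) * B.tV ρ α))
      - -B.sgn α • (B.cV V (-α) * B.tV ρ α) * J = -(B.r χ α)⁻¹ • (B.bV V (-α) * B.tV ρ α) := by
    intro α hα
    rw [mul_smul_comm, smul_mul_assoc, ← smul_sub, commutator_mul_add, B.Jminus_cV V χ hα,
      B.Jminus_tV, mul_zero, add_zero, smul_mul_assoc, smul_smul, B.r_eq_sgn, mul_inv, B.sgn_inv]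
    congr 1
    ring
  -- Substituting $-\alpha$ for $\alpha$ and using that `r` is even identifies the linear terms with
  -- the conjugates of $c^{-\alpha}\tau_\alpha$.
  have hsum : ∑ α ∈ roots 𝔥, -(B.r χ α)⁻¹ • (B.bV V (-α) * B.tV ρ α)
      = ∑ α ∈ roots 𝔥, (1 : ℂ) • (-B.tV ρ (-α) * ((B.r χ α)⁻¹ • B.bV V α)) := by
    refine Finset.sum_nbij' (fun α => -α) (fun α => -α)
      (fun α hα => B.mem_roots_neg_iff.2 hα) (fun α hα => B.mem_roots_neg_iff.2 hα)
      (fun α _ => neg_neg α) (fun α _ => neg_neg α) fun α hα => ?_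
    rw [neg_neg, B.r_neg χ hα, neg_mul, mul_smul_comm, B.tV_bV, one_smul, neg_smul]
  have hc := B.Jminus_cubic_sum (V := V) hχ
  rw [← hJ] at hc
  have e : J * B.weighted ρ (fun α => -B.sgn α) (fun α β => -(B.sgn α * B.sgn β * B.sgn (α + β)))
        - B.weighted ρ (fun α => -B.sgn α) (fun α β => -(B.sgn α * B.sgn β * B.sgn (α + β))) * J
      = ∑ α ∈ roots 𝔥, (1 : ℂ) • (-B.tV ρ (-α) * ((B.r χ α)⁻¹ • B.bV V α))
        - (1 / 2 : ℂ) • ∑ α ∈ roots 𝔥, ∑ β ∈ roots 𝔥,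
          (B.N α β * (B.r χ (α + β) * (B.r χ α)⁻¹ * (B.r χ β)⁻¹)) •
          (B.cV V (-(α + β)) * B.bV V β * B.bV V α) := by
    rw [← hc, ← hsum, weighted, mul_sub, sub_mul, mul_smul_comm, smul_mul_assoc, sub_sub_sub_comm,
      ← smul_sub]
    refine congrArg₂ _ ?_ (congrArg _ ?_)
    · rw [Finset.mul_sum, Finset.sum_mul, ← Finset.sum_sub_distrib]
      exact Finset.sum_congr rfl hlin
    · rw [Finset.mul_sum, Finset.sum_mul, ← Finset.sum_sub_distrib]
      refine Finset.sum_congr rfl fun α _ => ?_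
      rw [Finset.mul_sum, Finset.sum_mul, ← Finset.sum_sub_distrib]
      refine Finset.sum_congr rfl fun β _ => ?_
      rw [mul_smul_comm, smul_mul_assoc, ← smul_sub]
  rw [e]
  refine IsAdj.sub (IsAdj.sum fun α hα => IsAdj.smul ?_ (by simp)) (IsAdj.smul
    (IsAdj.sum fun α hα => IsAdj.sum fun β hβ => ?_) (by rw [map_div₀, map_one, map_ofNat]))
  · exact (B.isAdj_cV V hχ hα).mul (B.isAdj_tV χ hunitary hα)
  · by_cases h : α + β ∈ roots 𝔥
    · have h1 := (((B.isAdj_cV V hχ hα).mul (B.isAdj_cV V hχ hβ)).mul (B.isAdj_bV V hχ h)).smul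
        (B.N_real hα hβ)
      rw [one_mul]
      convert h1 using 1
      · rfl
      rw [smul_mul_smul_comm, smul_mul_smul_comm, smul_smul, mul_assoc (B.cV V _)]
      congr 1
      ring
    · rw [B.N_eq_zero _ _ h, mul_zero, zero_smul, zero_mul, zero_smul]
      exact IsAdj.zero

end KahlerIdentity

end ChevalleyBasis
end
end AnomalousBRST

namespace AnomalousBRST
noncomputable section

/-! ### Graded algebra of the two differentials and $J^\pm$. -/

section KahlerAlgebra

variable {E : Type*} [Ring E]

theorem commutator_commutator (p x y : E) :
    p * (x * y - y * x) - (x * y - y * x) * p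
      = ((p * x - x * p) * y - y * (p * x - x * p))
        + (x * (p * y - y * p) - (p * y - y * p) * x) := by
  noncomm_ring

theorem commutator_anticommutator (p x y : E) :
    p * (x * y + y * x) - (x * y + y * x) * p
      = ((p * x - x * p) * y + y * (p * x - x * p))
        + (x * (p * y - y * p) + (p * y - y * p) * x) := by
  noncomm_ring

theorem anticommutator_commutes {a b J : E} (haa : a * a = 0) (hab : a * b + b * a = -J) :
    J * a - a * J = 0 := by
  have hJ : J = -(a * b + b * a) := by rw [hab, neg_neg]
  have : J * a - a * J = a * a * b - b * (a * a) := by rw [hJ]; noncomm_ring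
  rw [this, haa, zero_mul, mul_zero, sub_zero]

variable [Algebra ℂ E]

/-- The components of a differential with square `-J`, separated by a grading operator `p`. -/
theorem sq_eq_zero_of_grading {a b J p : E} (hsq : (b + a) * (b + a) = -J)
    (ha : p * a - a * p = 0) (hb : p * b - b * p = b) (hJ : p * J - J * p = J) :
    a * a = 0 ∧ b * b = 0 ∧ a * b + b * a = -J := by
  have pa : p * a = a * p := sub_eq_zero.1 ha
  have pb : p * b = b + b * p := sub_eq_iff_eq_add.1 hb
  have pJ : p * J = J + J * p := sub_eq_iff_eq_add.1 hJ
  have h0 : b * b + (a * b + b * a) + a * a = -J := by rw [← hsq]; noncomm_ring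
  have haa : p * (a * a) - a * a * p = 0 := by
    rw [← mul_assoc, pa, mul_assoc, pa, ← mul_assoc, sub_self]
  have hab : p * (a * b + b * a) - (a * b + b * a) * p = a * b + b * a := by
    rw [commutator_anticommutator, ha, hb, zero_mul, mul_zero, add_zero, zero_add]
  have hbb : p * (b * b) - b * b * p = b * b + b * b := by
    rw [ChevalleyBasis.commutator_mul_add, hb]
  -- The commutator with `p` removes the degree-$0$ term and keeps the degree-$1$ terms. Applied
  -- twice it multiplies $b^2$ by $2$ and then by $4$, while the rest of the identity stays fixed;
  -- subtraction gives $b^2=0$.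
  have key : ∀ x y z w k : E, x + y + z = w → p * x - x * p = k → p * y - y * p = y →
      p * z - z * p = 0 → p * w - w * p = w → k + y = w := by
    intro x y z w k h h1 h2 h3 h4
    calc k + y = (p * x - x * p) + (p * y - y * p) + (p * z - z * p) := by
          rw [h1, h2, h3, add_zero]
      _ = p * (x + y + z) - (x + y + z) * p := by noncomm_ring
      _ = w := by rw [h, h4]
  have hJ' : p * -J - -J * p = -J := by
    rw [mul_neg, neg_mul, sub_neg_eq_add, neg_add_eq_sub, ← neg_sub, hJ]
  have e1 := key _ _ _ _ _ h0 hbb hab haa hJ'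
  have hbb2 : p * (b * b + b * b) - (b * b + b * b) * p = (b * b + b * b) + (b * b + b * b) := by
    nth_rewrite 3 [← hbb]
    nth_rewrite 3 [← hbb]
    noncomm_ring
  have e2 := key _ _ 0 _ _ (by rw [add_zero]; exact e1) hbb2 hab (by simp) hJ'
  have e3 : b * b + b * b = 0 := by
    have := e2.trans e1.symm
    rw [add_right_cancel_iff] at this
    simpa using this
  have e4 : b * b = 0 := by
    rw [← two_smul ℂ] at e3
    exact (smul_eq_zero.1 e3).resolve_left two_ne_zero
  rw [e3, zero_add] at e1
  refine ⟨?_, e4, e1⟩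
  rw [e4, e1, zero_add] at h0
  simpa using h0

variable {a b J K g : E}

/-- The algebra generated by the two differentials and the operators `J⁺`, `J⁻`. -/
theorem kahler_algebra (haa : a * a = 0) (hbb : b * b = 0) (hab : a * b + b * a = -J)
    (hJa : J * a - a * J = 0) (hJb : J * b - b * J = 0) (hJK : J * K - K * J = g)
    (hga : g * a - a * g = a) (hgb : g * b - b * g = b) (hgK : g * K - K * g = (-2 : ℂ) • K)
    (hKa : (K * a - a * K) * K - K * (K * a - a * K) = 0)
    (hKb : -(K * b - b * K) * K - K * -(K * b - b * K) = 0)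
    {A B box boxBar lap lapC : E} (hA : A = K * a - a * K) (hB : B = K * b - b * K)
    (hbox : box = a * -B + -B * a) (hboxBar : boxBar = b * A + A * b)
    (hlap : lap = (b + a) * (A + -B) + (A + -B) * (b + a))
    (hlapC : lapC = (a - b) * (-B - A) + (-B - A) * (a - b)) :
    lap = box + boxBar ∧ box + boxBar = lapC ∧ J * lap - lap * J = 0 ∧ K * lap - lap * K = 0 ∧
      J * box - box * J = J ∧ K * box - box * K = -K ∧
      J * boxBar - boxBar * J = -J ∧ K * boxBar - boxBar * K = K ∧
      g * box - box * g = 0 ∧ g * boxBar - boxBar * g = 0 ∧ box = boxBar - g := by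
  rw [← hA, ← neg_sub, neg_eq_zero] at hKa
  rw [← hB, neg_mul, mul_neg, sub_neg_eq_add, neg_add_eq_sub] at hKb
  -- The anticommutator of $a$ with $[K,a]$ is $[K,a^2]$; these are the cross terms of the
  -- Laplacians.
  have haA : a * A + A * a = 0 := by
    have : a * A + A * a = K * (a * a) - a * a * K := by rw [hA]; noncomm_ring
    rw [this, haa, mul_zero, zero_mul, sub_zero]
  have hbB : b * B + B * b = 0 := by
    have : b * B + B * b = K * (b * b) - b * b * K := by rw [hB]; noncomm_ring
    rw [this, hbb, mul_zero, zero_mul, sub_zero]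
  have hJA : J * A - A * J = a := by
    rw [hA, commutator_commutator, hJK, hga, hJa, mul_zero, zero_mul, sub_zero, add_zero]
  have hJB : J * B - B * J = b := by
    rw [hB, commutator_commutator, hJK, hgb, hJb, mul_zero, zero_mul, sub_zero, add_zero]
  have hgA : g * A - A * g = -A := by
    rw [hA, commutator_commutator, hgK, hga, smul_mul_assoc, mul_smul_comm]
    module
  have hgB : g * B - B * g = -B := by
    rw [hB, commutator_commutator, hgK, hgb, smul_mul_assoc, mul_smul_comm]
    module
  have hbox' : box = -(a * B + B * a) := by rw [hbox, mul_neg, neg_mul, neg_add]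
  -- This is $[K,ab+ba]=-[K,J]=g$, and is the relation $\overline\Box-\Box=g$ in disguise.
  have hKab : (A * b + b * A) + (a * B + B * a) = g := by
    have := commutator_anticommutator K a b
    rw [← hA, ← hB, hab, mul_neg, neg_mul, sub_neg_eq_add, neg_add_eq_sub, hJK] at this
    exact this.symm
  -- Commuting the preceding relation with $K$, each anticommutator yields $AB+BA$ because $K$
  -- commutes with $A$ and $B$. The left side is then $2(AB+BA)$ and the right side $[K,g]=2K$.
  have hAB : A * B + B * A = K := by
    have h1 := commutator_anticommutator K A b
    have h2 := commutator_anticommutator K a B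
    rw [hKa, ← hB, zero_mul, mul_zero, zero_add, zero_add] at h1
    rw [hKb, ← hA, zero_mul, mul_zero, zero_add, add_zero] at h2
    have h3 : K * g - g * K = (2 : ℂ) • (A * B + B * A) := by
      rw [← hKab, two_smul]
      nth_rewrite 2 [← h1]
      rw [← h2]
      noncomm_ring
    rw [← neg_sub, hgK, ← neg_smul, neg_neg] at h3
    exact ((smul_right_injective E (two_ne_zero (α := ℂ))) h3).symm
  have hJbox : J * box - box * J = J := by
    have := commutator_anticommutator J a B
    rw [hJa, hJB, zero_mul, mul_zero, zero_add, zero_add, hab] at this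
    rw [hbox', mul_neg, neg_mul, sub_neg_eq_add, neg_add_eq_sub, ← neg_sub, this, neg_neg]
  have hJbar : J * boxBar - boxBar * J = -J := by
    have := commutator_anticommutator J b A
    rw [hJb, hJA, zero_mul, mul_zero, zero_add, zero_add, add_comm (b * a), hab] at this
    rw [hboxBar, this]
  have hKbox : K * box - box * K = -K := by
    have := commutator_anticommutator K a B
    rw [hKb, ← hA, zero_mul, mul_zero, zero_add, add_zero, hAB] at this
    rw [hbox', mul_neg, neg_mul, sub_neg_eq_add, neg_add_eq_sub, ← neg_sub, this]
  have hKbar : K * boxBar - boxBar * K = K := by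
    have := commutator_anticommutator K b A
    rw [hKa, ← hB, zero_mul, mul_zero, zero_add, add_zero, add_comm (B * A), hAB] at this
    rw [hboxBar, this]
  have hgbox : g * box - box * g = 0 := by
    have := commutator_anticommutator g a B
    rw [hga, hgB, mul_neg, neg_mul, ← neg_add, add_neg_cancel] at this
    rw [hbox', mul_neg, neg_mul, sub_neg_eq_add, neg_add_eq_sub, ← neg_sub, this, neg_zero]
  have hgbar : g * boxBar - boxBar * g = 0 := by
    have := commutator_anticommutator g b A
    rw [hgb, hgA, mul_neg, neg_mul, ← neg_add, add_neg_cancel] at this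
    rw [hboxBar, this]
  have hl : lap = box + boxBar := by
    have : lap = box + boxBar + (a * A + A * a) - (b * B + B * b) := by
      rw [hlap, hbox, hboxBar]; noncomm_ring
    rw [this, haA, hbB, add_zero, sub_zero]
  have hlc : lapC = box + boxBar := by
    have : lapC = box + boxBar - (a * A + A * a) + (b * B + B * b) := by
      rw [hlapC, hbox, hboxBar]; noncomm_ring
    rw [this, haA, hbB, add_zero, sub_zero]
  refine ⟨hl, hlc.symm, ?_, ?_, hJbox, hKbox, hJbar, hKbar, hgbox, hgbar, ?_⟩
  · rw [hl, mul_add, add_mul, add_sub_add_comm, hJbox, hJbar, add_neg_cancel]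
  · rw [hl, mul_add, add_mul, add_sub_add_comm, hKbox, hKbar, neg_add_cancel]
  · rw [hbox', hboxBar, ← hKab]
    abel

end KahlerAlgebra

/-! ### Restriction of operators to an invariant subspace. -/

section Restriction

variable {E : Type*} [AddCommGroup E] [Module ℂ E] {p : Submodule ℂ E} {A C X : Module.End ℂ E}

theorem restrictTo_apply (h : ∀ x ∈ p, A x ∈ p) (x : p) : (restrictTo p A x : E) = A x := by
  rw [restrictTo, dif_pos h]
  rfl

theorem restrictTo_smul (h : ∀ x ∈ p, A x ∈ p) (z : ℂ) :
    restrictTo p (z • A) = z • restrictTo p A := by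
  refine LinearMap.ext fun x => Subtype.ext ?_
  rw [restrictTo_apply fun x hx => p.smul_mem z (h x hx)]
  exact congrArg (z • ·) (restrictTo_apply h x).symm

theorem neg_apply_mem (h : ∀ x ∈ p, A x ∈ p) : ∀ x ∈ p, (-A) x ∈ p :=
  fun x hx => p.neg_mem (h x hx)

theorem restrictTo_neg (h : ∀ x ∈ p, A x ∈ p) : restrictTo p (-A) = -restrictTo p A := by
  refine LinearMap.ext fun x => Subtype.ext ?_
  rw [restrictTo_apply (neg_apply_mem h)]
  exact congrArg (-·) (restrictTo_apply h x).symm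

theorem commutator_mem (hA : ∀ x ∈ p, A x ∈ p) (hC : ∀ x ∈ p, C x ∈ p) :
    ∀ x ∈ p, (A * C - C * A) x ∈ p := fun _ hx =>
  p.sub_mem (hA _ (hC _ hx)) (hC _ (hA _ hx))

theorem restrictTo_commutator (hA : ∀ x ∈ p, A x ∈ p) (hC : ∀ x ∈ p, C x ∈ p)
    (h : A * C - C * A = X) :
    restrictTo p A * restrictTo p C - restrictTo p C * restrictTo p A = restrictTo p X := by
  subst h
  refine LinearMap.ext fun x => Subtype.ext ?_
  rw [restrictTo_apply (commutator_mem hA hC)]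
  change (restrictTo p A (restrictTo p C x) : E) - restrictTo p C (restrictTo p A x) = _
  rw [restrictTo_apply hA, restrictTo_apply hC, restrictTo_apply hC, restrictTo_apply hA]
  rfl

theorem restrictTo_zero : restrictTo p (0 : Module.End ℂ E) = 0 :=
  LinearMap.ext fun x => Subtype.ext (restrictTo_apply (fun _ _ => p.zero_mem) x)

end Restriction

namespace ChevalleyBasis

/-! ### Conjugates of the two differentials; existence and uniqueness on the relative space. -/

section RelativeSpace

variable {𝔤 : Type*} [LieRing 𝔤] [LieAlgebra ℝ 𝔤] [FiniteDimensional ℝ 𝔤]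
  {𝔥 : LieSubalgebra ℝ 𝔤} [𝔥.IsCartanSubalgebra] (B : ChevalleyBasis 𝔥)
  {V : Type*} [NormedAddCommGroup V] [InnerProductSpace ℂ V]

variable (V) in
-- Each positive root contributes separately: $J^-$ contracts with either ghost of
-- $c^{-\alpha}c^\alpha$, and $r_\alpha$ cancels $r_\alpha^{-1}$. With the weights of $J^\pm$ under
-- the ghost number this is an $\mathfrak{sl}_2$-triple.
theorem Jplus_Jminus (χ : Module.Dual ℂ (Cx 𝔤)) (hr : ∀ α ∈ B.pos, B.r χ α ≠ 0) :
    onV V (B.ghostJplus χ) * onV V (B.ghostJminus χ)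
      - onV V (B.ghostJminus χ) * onV V (B.ghostJplus χ) = onV V B.ghostNumber := by
  have h1 : onV V B.ghostNumber
      = ∑ α ∈ B.pos, (B.cV V (-α) * B.bV V α - B.bV V (-α) * B.cV V α) := by
    simp only [onV_eq, ghostNumber, map_sum, onVHom_sub, map_mul]
    rfl
  rw [h1, B.onV_ghostJplus, Finset.mul_sum, Finset.sum_mul, ← Finset.sum_sub_distrib]
  refine Finset.sum_congr rfl fun α hα => ?_
  have h2 := B.Jminus_cV V χ (B.pos_subset hα)
  have h3 := B.Jminus_cV V χ (B.neg_mem_roots hα)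
  rw [neg_neg, B.coroot_neg (B.pos_subset hα), map_neg, inv_neg, ← B.r_of_pos χ hα] at h3
  rw [← B.r_of_pos χ hα] at h2
  rw [smul_mul_assoc, mul_smul_comm, ← smul_sub, ← neg_sub, commutator_mul_add, h2, h3,
    smul_mul_assoc, mul_smul_comm, neg_smul, ← sub_eq_add_neg, ← smul_sub, smul_neg, smul_smul,
    mul_inv_cancel₀ (hr α hα), one_smul, neg_sub]

variable [LieAlgebra.IsKilling ℂ (Cx 𝔤)] {χ : Module.Dual ℂ (Cx 𝔤)} (hχ : B.IsRegularDominant χ)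
  {ρ : 𝔤 →ₗ[ℝ] Module.End ℂ V}
include hχ

/-- The grading by positive modes is self-conjugate, and its commutator with the sum $b+a$ returns
$b$. Conjugating that commutator, with $J^-$ of degree $-1$, isolates the conjugate of $b$;
subtraction gives the conjugate of $a$. -/
theorem isAdj_diff
    (hunitary : ∀ (x : 𝔤) (v w : V), inner ℂ (ρ x v) w = -inner ℂ v (ρ x w)) :
    B.IsAdj χ (B.diffBarOp ρ χ) (onV V (B.ghostJminus χ) * B.diffOp ρ χ
        - B.diffOp ρ χ * onV V (B.ghostJminus χ)) ∧
      B.IsAdj χ (B.diffOp ρ χ) (-(onV V (B.ghostJminus χ) * B.diffBarOp ρ χ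
        - B.diffBarOp ρ χ * onV V (B.ghostJminus χ))) := by
  have hX := B.isAdj_weighted ρ hχ hunitary
  rw [← B.diffBarOp_add_diffOp ρ hχ] at hX
  have hY : B.weighted ρ (fun α => -B.sgn α) (fun α β => -(B.sgn α * B.sgn β * B.sgn (α + β)))
      = B.diffOp ρ χ - B.diffBarOp ρ χ := by
    rw [B.diffOp_eq ρ hχ, B.diffBarOp_eq ρ hχ, B.weighted_sub]
    refine B.weighted_congr ρ (fun α _ => ?_) fun α hα β hβ h => ?_
    · rw [sgn]; ring
    · rw [← B.one_sub_cubicDeg hα hβ h]; ring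
  rw [hY] at hX
  set K := onV V (B.ghostJminus χ)
  set a := B.diffOp ρ χ
  set b := B.diffBarOp ρ χ
  have hP : B.IsAdj χ (B.grading V B.posInd) (B.grading V B.posInd) :=
    B.isAdj_grading V hχ fun α => by rw [posInd]; split_ifs <;> simp
  have hb : B.grading V B.posInd * b - b * B.grading V B.posInd = b := B.grading_diffBarOp ρ hχ
  have ha : B.grading V B.posInd * a - a * B.grading V B.posInd = 0 := B.grading_diffOp ρ hχ
  have hK : B.grading V B.posInd * K - K * B.grading V B.posInd = -(1 : ℂ) • K :=
    B.grading_Jminus χ fun α hα => by rw [B.posInd_pos hα, B.posInd_neg hα, add_zero]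
  set P := B.grading V B.posInd
  have h1 : B.IsAdj χ b (K * a - a * K) := by
    have h := (hP.mul hX).sub (hX.mul hP)
    have e1 : P * (b + a) - (b + a) * P = b := by
      rw [mul_add, add_mul, add_sub_add_comm, hb, ha, add_zero]
    have e2 : (K * (a - b) - (a - b) * K) * P - P * (K * (a - b) - (a - b) * K)
        = K * a - a * K := by
      have e3 : P * (a - b) - (a - b) * P = -b := by
        rw [mul_sub, sub_mul, sub_sub_sub_comm, ha, hb, zero_sub]
      rw [← neg_sub, commutator_commutator, hK, e3, neg_smul, one_smul]
      noncomm_ring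
    rwa [e1, e2] at h
  refine ⟨h1, ?_⟩
  have h := hX.sub h1
  rw [add_sub_cancel_left] at h
  convert h using 1
  noncomm_ring

theorem isKahlerAdjoint_restrictTo {A A' : Module.End ℂ (GhostV 𝔤 V)}
    (hA : ∀ Ψ ∈ B.Crel ρ χ, A Ψ ∈ B.Crel ρ χ) (hA' : ∀ Ψ ∈ B.Crel ρ χ, A' Ψ ∈ B.Crel ρ χ)
    (h : B.IsAdj χ A A') :
    B.IsKahlerAdjoint ρ χ (restrictTo (B.Crel ρ χ) A) (restrictTo (B.Crel ρ χ) A') := by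
  intro Ψ Ψ'
  rw [restrictTo_apply hA, restrictTo_apply hA', B.kahler_eq hχ, B.kahler_eq hχ]
  exact h Ψ Ψ'

/-- The difference of two conjugates, applied to any element, is orthogonal to the relative space,
in particular to itself; definiteness makes it vanish. -/
theorem isKahlerAdjoint_unique {A A₁ A₂ : Module.End ℂ (B.Crel ρ χ)}
    (h₁ : B.IsKahlerAdjoint ρ χ A A₁) (h₂ : B.IsKahlerAdjoint ρ χ A A₂) : A₁ = A₂ := by
  refine LinearMap.ext fun Ψ => sub_eq_zero.1 (Subtype.ext ?_)
  refine B.eq_zero_of_kahler_self hχ (B.bH_apply ρ (A₁ Ψ - A₂ Ψ).2) ?_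
  have h : B.sesq (B.kahlerForm χ) ((A₁ Ψ - A₂ Ψ : B.Crel ρ χ) : GhostV 𝔤 V) (A₁ Ψ)
      = B.sesq (B.kahlerForm χ) ((A₁ Ψ - A₂ Ψ : B.Crel ρ χ) : GhostV 𝔤 V) (A₂ Ψ) := by
    rw [← B.kahler_eq hχ, ← B.kahler_eq hχ]
    exact (h₁ _ _).symm.trans (h₂ _ _)
  have e : ((A₁ Ψ - A₂ Ψ : B.Crel ρ χ) : GhostV 𝔤 V)
      = (A₁ Ψ : GhostV 𝔤 V) + (-1 : ℂ) • (A₂ Ψ : GhostV 𝔤 V) := by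
    rw [neg_one_smul, ← sub_eq_add_neg]
    rfl
  rw [B.kahler_eq hχ]
  conv_lhs => rw [e, ← e]
  nth_rewrite 2 [e]
  rw [sesq_add_right, sesq_smul_right, h]
  ring

theorem dagger_eq {A A' : Module.End ℂ (B.Crel ρ χ)} (h : B.IsKahlerAdjoint ρ χ A A') :
    B.dagger ρ χ A = A' := by
  have hex : ∃ A', B.IsKahlerAdjoint ρ χ A A' := ⟨A', h⟩
  rw [dagger, dif_pos hex]
  exact B.isKahlerAdjoint_unique hχ hex.choose_spec h

theorem existsUnique_isKahlerAdjoint {A A' : Module.End ℂ (B.Crel ρ χ)}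
    (h : B.IsKahlerAdjoint ρ χ A A') : ∃! A', B.IsKahlerAdjoint ρ χ A A' :=
  ⟨A', h, fun _ h' => B.isKahlerAdjoint_unique hχ h' h⟩

end RelativeSpace

end ChevalleyBasis
end
end AnomalousBRST

namespace AnomalousBRST
noncomputable section

namespace ChevalleyBasis

/-! ### The two components of the relative differential. -/

section Components

variable {𝔤 : Type*} [LieRing 𝔤] [LieAlgebra ℝ 𝔤] [FiniteDimensional ℝ 𝔤]
  {𝔥 : LieSubalgebra ℝ 𝔤} [𝔥.IsCartanSubalgebra] (B : ChevalleyBasis 𝔥)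
  {V : Type*} [NormedAddCommGroup V] [InnerProductSpace ℂ V]
  [LieAlgebra.IsKilling ℂ (Cx 𝔤)] {χ : Module.Dual ℂ (Cx 𝔤)} (hχ : B.IsRegularDominant χ)
  {ρ : 𝔤 →ₗ[ℝ] Module.End ℂ V} (hρ : ∀ x y : 𝔤, ρ ⁅x, y⁆ = ρ x * ρ y - ρ y * ρ x)
include hχ hρ

theorem diffBarOp_add_diffOp_invariant :
    ∀ Ψ ∈ B.Crel ρ χ, (B.diffBarOp ρ χ + B.diffOp ρ χ) Ψ ∈ B.Crel ρ χ := by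
  intro Ψ hΨ
  rw [← B.totalD_apply ρ hχ hΨ]
  exact B.totalD_invariant ρ hρ hχ Ψ hΨ

/-- This component is the commutator of the grading by positive modes with the full relative
differential, and both of these preserve the relative space. -/
theorem diffBarOp_invariant : ∀ Ψ ∈ B.Crel ρ χ, B.diffBarOp ρ χ Ψ ∈ B.Crel ρ χ := by
  have e : B.diffBarOp ρ χ = B.grading V B.posInd * (B.diffBarOp ρ χ + B.diffOp ρ χ)
      - (B.diffBarOp ρ χ + B.diffOp ρ χ) * B.grading V B.posInd := by
    rw [mul_add, add_mul, add_sub_add_comm, B.grading_diffBarOp ρ hχ, B.grading_diffOp ρ hχ,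
      add_zero]
  rw [e]
  exact commutator_mem (B.grading_invariant ρ χ _) (B.diffBarOp_add_diffOp_invariant hχ hρ)

theorem diffOp_invariant : ∀ Ψ ∈ B.Crel ρ χ, B.diffOp ρ χ Ψ ∈ B.Crel ρ χ := by
  intro Ψ hΨ
  have := sub_mem (B.diffBarOp_add_diffOp_invariant hχ hρ Ψ hΨ) (B.diffBarOp_invariant hχ hρ Ψ hΨ)
  rwa [LinearMap.add_apply, add_sub_cancel_left] at this

theorem Drel_eq : B.Drel ρ χ = B.diffBar ρ χ + B.diff ρ χ := by
  refine LinearMap.ext fun Ψ => Subtype.ext ?_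
  change (restrictTo _ _ Ψ : GhostV 𝔤 V) = restrictTo _ _ Ψ + restrictTo _ _ Ψ
  rw [restrictTo_apply (B.totalD_invariant ρ hρ hχ), restrictTo_apply (B.diffBarOp_invariant hχ hρ),
    restrictTo_apply (B.diffOp_invariant hχ hρ), B.totalD_apply ρ hχ Ψ.2]
  rfl

theorem Drel_sq : B.Drel ρ χ * B.Drel ρ χ = -B.Jplus ρ χ := by
  refine LinearMap.ext fun Ψ => Subtype.ext ?_
  change (restrictTo _ _ (restrictTo _ _ Ψ) : GhostV 𝔤 V) = -restrictTo _ _ Ψ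
  rw [restrictTo_apply (B.totalD_invariant ρ hρ hχ), restrictTo_apply (B.totalD_invariant ρ hρ hχ),
    restrictTo_apply (B.Jplus_invariant ρ χ)]
  exact LinearMap.congr_fun (B.totalD_sq ρ hρ hχ) (Ψ : GhostV 𝔤 V)

end Components

/-! ### Calculus of conjugates on the relative space. -/

section Adjoints

variable {𝔤 : Type*} [LieRing 𝔤] [LieAlgebra ℝ 𝔤] [FiniteDimensional ℝ 𝔤]
  {𝔥 : LieSubalgebra ℝ 𝔤} [𝔥.IsCartanSubalgebra] {B : ChevalleyBasis 𝔥}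
  {V : Type*} [NormedAddCommGroup V] [InnerProductSpace ℂ V]
  {χ : Module.Dual ℂ (Cx 𝔤)} {ρ : 𝔤 →ₗ[ℝ] Module.End ℂ V}
  {A A' C C' : Module.End ℂ (B.Crel ρ χ)}

namespace IsKahlerAdjoint

theorem mul (h : B.IsKahlerAdjoint ρ χ A A') (h' : B.IsKahlerAdjoint ρ χ C C') :
    B.IsKahlerAdjoint ρ χ (A * C) (C' * A') := fun Ψ Ψ' => by
  rw [Module.End.mul_apply, Module.End.mul_apply, h, h']

variable [LieAlgebra.IsKilling ℂ (Cx 𝔤)] (hχ : B.IsRegularDominant χ)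
include hχ

theorem add (h : B.IsKahlerAdjoint ρ χ A A') (h' : B.IsKahlerAdjoint ρ χ C C') :
    B.IsKahlerAdjoint ρ χ (A + C) (A' + C') := fun Ψ Ψ' => by
  have h1 := h Ψ Ψ'
  have h2 := h' Ψ Ψ'
  rw [B.kahler_eq hχ, B.kahler_eq hχ] at h1 h2 ⊢
  refine (B.sesq_add_left _ _ _ _).trans (Eq.trans ?_ (B.sesq_add_right _ _ _ _).symm)
  rw [h1, h2]

theorem neg (h : B.IsKahlerAdjoint ρ χ A A') : B.IsKahlerAdjoint ρ χ (-A) (-A') := fun Ψ Ψ' => by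
  have h1 := h Ψ Ψ'
  rw [B.kahler_eq hχ, B.kahler_eq hχ] at h1 ⊢
  have e : ∀ D : Module.End ℂ (B.Crel ρ χ), ∀ Φ : B.Crel ρ χ,
      (((-D) Φ : B.Crel ρ χ) : GhostV 𝔤 V) = (-1 : ℂ) • (D Φ : GhostV 𝔤 V) :=
    fun D Φ => (neg_one_smul ℂ (D Φ : GhostV 𝔤 V)).symm
  rw [e, e, sesq_smul_left, sesq_smul_right, h1]
  simp

theorem sub (h : B.IsKahlerAdjoint ρ χ A A') (h' : B.IsKahlerAdjoint ρ χ C C') :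
    B.IsKahlerAdjoint ρ χ (A - C) (A' - C') := by
  rw [sub_eq_add_neg, sub_eq_add_neg]
  exact h.add hχ (h'.neg hχ)

theorem eq_zero (h : B.IsKahlerAdjoint ρ χ A A') (hA : A = 0) : A' = 0 := by
  have h0 := h.sub hχ h
  rw [sub_self, sub_self] at h0
  rw [hA] at h
  exact B.isKahlerAdjoint_unique hχ h h0

end IsKahlerAdjoint

end Adjoints

end ChevalleyBasis

end
end AnomalousBRST

namespace AnomalousBRST
noncomputable section

namespace ChevalleyBasis

section GhostNumber

variable {𝔤 : Type*} [LieRing 𝔤] [LieAlgebra ℝ 𝔤] [FiniteDimensional ℝ 𝔤]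
  {𝔥 : LieSubalgebra ℝ 𝔤} [𝔥.IsCartanSubalgebra] (B : ChevalleyBasis 𝔥)
  {V : Type*} [NormedAddCommGroup V] [InnerProductSpace ℂ V]

theorem ghostNumber_commutator (A : Module.End ℂ (GhostV 𝔤 V)) :
    onV V B.ghostNumber * A - A * onV V B.ghostNumber
      = B.grading V (fun _ => 1) * A - A * B.grading V (fun _ => 1) := by
  rw [B.onV_ghostNumber, sub_mul, mul_sub, smul_mul_assoc, mul_smul_comm, one_mul, mul_one]
  abel

end GhostNumber

end ChevalleyBasis
end
end AnomalousBRST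

theorem proposition2p2 {𝔤 : Type*} [LieRing 𝔤] [LieAlgebra ℝ 𝔤] [FiniteDimensional ℝ 𝔤]
    [LieAlgebra.IsSimple ℝ 𝔤] (hcompact : ∀ x : 𝔤, x ≠ 0 → killingForm ℝ 𝔤 x x < 0)
    (𝔥 : LieSubalgebra ℝ 𝔤) [𝔥.IsCartanSubalgebra] (B : AnomalousBRST.ChevalleyBasis 𝔥)
    (χ : Module.Dual ℂ (AnomalousBRST.Cx 𝔤)) (hχ : B.IsRegularDominant χ)
    {V : Type*} [NormedAddCommGroup V] [InnerProductSpace ℂ V] (ρ : 𝔤 →ₗ[ℝ] Module.End ℂ V)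
    (hρ : ∀ x y : 𝔤, ρ ⁅x, y⁆ = ρ x * ρ y - ρ y * ρ x)
    (hunitary : ∀ (x : 𝔤) (v w : V), inner ℂ (ρ x v) w = -inner ℂ v (ρ x w)) :
    -- all operators below preserve the relative differential space
    ((∀ Ψ ∈ B.Crel ρ χ, B.totalD ρ χ Ψ ∈ B.Crel ρ χ) ∧
      (∀ Ψ ∈ B.Crel ρ χ, B.diffOp ρ χ Ψ ∈ B.Crel ρ χ) ∧
      (∀ Ψ ∈ B.Crel ρ χ, B.diffBarOp ρ χ Ψ ∈ B.Crel ρ χ) ∧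
      (∀ Ψ ∈ B.Crel ρ χ, AnomalousBRST.onV V (B.ghostJplus χ) Ψ ∈ B.Crel ρ χ) ∧
      (∀ Ψ ∈ B.Crel ρ χ, AnomalousBRST.onV V (B.ghostJminus χ) Ψ ∈ B.Crel ρ χ) ∧
      (∀ Ψ ∈ B.Crel ρ χ, AnomalousBRST.onV V B.ghostNumber Ψ ∈ B.Crel ρ χ)) ∧
    -- all differentials have a unique conjugate for the Kähler inner product
    ((∃! A, B.IsKahlerAdjoint ρ χ (B.Drel ρ χ) A) ∧ (∃! A, B.IsKahlerAdjoint ρ χ (B.Dc ρ χ) A) ∧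
      (∃! A, B.IsKahlerAdjoint ρ χ (B.diff ρ χ) A) ∧
      (∃! A, B.IsKahlerAdjoint ρ χ (B.diffBar ρ χ) A)) ∧
    -- the relative differential is the sum of its two components
    B.Drel ρ χ = B.diffBar ρ χ + B.diff ρ χ ∧
    -- the Laplace operators
    B.Lap ρ χ = B.Box ρ χ + B.BoxBar ρ χ ∧
    B.Box ρ χ + B.BoxBar ρ χ = B.LapC ρ χ ∧
    B.Jplus ρ χ * B.Lap ρ χ - B.Lap ρ χ * B.Jplus ρ χ = 0 ∧
    B.Jminus ρ χ * B.Lap ρ χ - B.Lap ρ χ * B.Jminus ρ χ = 0 ∧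
    B.Jplus ρ χ * B.Box ρ χ - B.Box ρ χ * B.Jplus ρ χ = B.Jplus ρ χ ∧
    B.Jminus ρ χ * B.Box ρ χ - B.Box ρ χ * B.Jminus ρ χ = -B.Jminus ρ χ ∧
    B.Jplus ρ χ * B.BoxBar ρ χ - B.BoxBar ρ χ * B.Jplus ρ χ = -B.Jplus ρ χ ∧
    B.Jminus ρ χ * B.BoxBar ρ χ - B.BoxBar ρ χ * B.Jminus ρ χ = B.Jminus ρ χ ∧
    B.ghRel ρ χ * B.Box ρ χ - B.Box ρ χ * B.ghRel ρ χ = 0 ∧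
    B.ghRel ρ χ * B.BoxBar ρ χ - B.BoxBar ρ χ * B.ghRel ρ χ = 0 ∧
    B.Box ρ χ = B.BoxBar ρ χ - B.ghRel ρ χ := by
  have hK := AnomalousBRST.isKilling_cx hcompact
  have iD := B.totalD_invariant ρ hρ hχ
  have ia := B.diffOp_invariant hχ hρ
  have ib := B.diffBarOp_invariant hχ hρ
  have iJ := B.Jplus_invariant ρ χ
  have iK := B.Jminus_invariant ρ χ
  have ig := B.ghostNumber_invariant ρ χ
  have iP := B.grading_invariant ρ χ B.posInd
  obtain ⟨adb, ada⟩ := B.isAdj_diff hχ hunitary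
  have iA := AnomalousBRST.commutator_mem iK ia
  have iB := AnomalousBRST.commutator_mem iK ib
  have kb := B.isKahlerAdjoint_restrictTo hχ ib iA adb
  have ka := B.isKahlerAdjoint_restrictTo hχ ia (AnomalousBRST.neg_apply_mem iB) ada
  rw [AnomalousBRST.restrictTo_neg iB, ← AnomalousBRST.restrictTo_commutator iK ib rfl] at ka
  rw [← AnomalousBRST.restrictTo_commutator iK ia rfl] at kb
  have kJ := B.isKahlerAdjoint_restrictTo hχ iJ iK (B.isAdj_Jplus V hχ)
  change B.IsKahlerAdjoint ρ χ (B.Jplus ρ χ) (B.Jminus ρ χ) at kJ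
  change B.IsKahlerAdjoint ρ χ (B.diffBar ρ χ)
    (B.Jminus ρ χ * B.diff ρ χ - B.diff ρ χ * B.Jminus ρ χ) at kb
  change B.IsKahlerAdjoint ρ χ (B.diff ρ χ)
    (-(B.Jminus ρ χ * B.diffBar ρ χ - B.diffBar ρ χ * B.Jminus ρ χ)) at ka
  have hD : B.Drel ρ χ = B.diffBar ρ χ + B.diff ρ χ := B.Drel_eq hχ hρ
  have kD := kb.add hχ ka
  rw [← hD] at kD
  have kc : B.IsKahlerAdjoint ρ χ (B.Dc ρ χ) _ := ka.sub hχ kb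
  have hsq := B.Drel_sq hχ hρ
  rw [hD] at hsq
  have hJP := AnomalousBRST.restrictTo_commutator iP iJ (B.grading_Jplus (V := V) χ (q := B.posInd)
    (k := 1) fun α hα => by rw [B.posInd_pos hα, B.posInd_neg hα, add_zero])
  rw [one_smul] at hJP
  have hPa := AnomalousBRST.restrictTo_commutator iP ia (B.grading_diffOp ρ hχ)
  rw [AnomalousBRST.restrictTo_zero] at hPa
  obtain ⟨haa, hbb, hab⟩ := AnomalousBRST.sq_eq_zero_of_grading hsq hPa
    (AnomalousBRST.restrictTo_commutator iP ib (B.grading_diffBarOp ρ hχ)) hJP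
  have hJa := AnomalousBRST.anticommutator_commutes haa hab
  have hJb := AnomalousBRST.anticommutator_commutes hbb ((add_comm _ _).trans hab)
  -- Conjugating $[J^+,\overline{\mathcal D}]=0$ shows that $J^-$ commutes with $\overline{\mathcal
  -- D}^\dagger=[J^-,\mathcal D]$; the next line treats $\mathcal D^\dagger$ in the same way.
  have hKa := ((kJ.mul kb).sub hχ (kb.mul kJ)).eq_zero hχ hJb
  have hKb := ((kJ.mul ka).sub hχ (ka.mul kJ)).eq_zero hχ hJa
  have hga := AnomalousBRST.restrictTo_commutator ig ia
    ((B.ghostNumber_commutator _).trans (B.grading_one_diffOp ρ hχ))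
  have hgb := AnomalousBRST.restrictTo_commutator ig ib
    ((B.ghostNumber_commutator _).trans (B.grading_one_diffBarOp ρ hχ))
  -- Each term of $J^-$ contains two anti-ghosts, so its ghost number is $-2$.
  have hgK := AnomalousBRST.restrictTo_commutator ig iK
    ((B.ghostNumber_commutator _).trans (B.grading_Jminus (V := V) χ (q := fun _ => 1) (k := 2)
      fun _ _ => by norm_num))
  rw [AnomalousBRST.restrictTo_smul iK] at hgK
  have hJK := AnomalousBRST.restrictTo_commutator iJ iK
    (B.Jplus_Jminus V χ fun α hα => B.r_ne_zero hχ (B.pos_subset hα))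
  change B.ghRel ρ χ * B.diff ρ χ - B.diff ρ χ * B.ghRel ρ χ = B.diff ρ χ at hga
  change B.ghRel ρ χ * B.diffBar ρ χ - B.diffBar ρ χ * B.ghRel ρ χ = B.diffBar ρ χ at hgb
  change B.ghRel ρ χ * B.Jminus ρ χ - B.Jminus ρ χ * B.ghRel ρ χ = (-2 : ℂ) • B.Jminus ρ χ at hgK
  change B.Jplus ρ χ * B.Jminus ρ χ - B.Jminus ρ χ * B.Jplus ρ χ = B.ghRel ρ χ at hJK
  refine ⟨⟨iD, ia, ib, iJ, iK, ig⟩, ⟨B.existsUnique_isKahlerAdjoint hχ kD,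
    B.existsUnique_isKahlerAdjoint hχ kc, B.existsUnique_isKahlerAdjoint hχ ka,
    B.existsUnique_isKahlerAdjoint hχ kb⟩, hD, ?_⟩
  refine AnomalousBRST.kahler_algebra haa hbb hab hJa hJb hJK hga hgb hgK hKa hKb rfl rfl ?_ ?_ ?_ ?_
  · rw [AnomalousBRST.ChevalleyBasis.Box, AnomalousBRST.ChevalleyBasis.laplace,
      B.dagger_eq hχ ka]
  · rw [AnomalousBRST.ChevalleyBasis.BoxBar, AnomalousBRST.ChevalleyBasis.laplace,
      B.dagger_eq hχ kb]
  · rw [AnomalousBRST.ChevalleyBasis.Lap, AnomalousBRST.ChevalleyBasis.laplace,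
      B.dagger_eq hχ kD, hD]
  · rw [AnomalousBRST.ChevalleyBasis.LapC, AnomalousBRST.ChevalleyBasis.laplace,
      B.dagger_eq hχ kc]
    rfl
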